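/- Let $M$ be an $n$-dimensional $C^\infty$ manifold (Hausdorff, second countable) and let $\mathcal F\colon TM\to\mathbb R$ be a Finsler function: $\mathcal F$ is continuous, smooth on $\hat TM=TM\setminus\{0\}$, positively homogeneous of degree $1$ on each $T_xM$, and $g_{x,y}(u,v)=\frac12\frac{\partial^2}{\partial s\,\partial t}\mathcal F^2(x,y+su+tv)\big|_{s=t=0}$ is positive definite for all $y\in T_xM\setminus\{0\}$. In local coordinates put $$G^i=\tfrac14 g^{il}\Big(2\frac{\partial g_{jl}}{\partial x^k}-\frac{\partial g_{jk}}{\partial x^l}\Big)y^jy^k,\qquad G^i_j=\frac{\partial G^i}{\partial y^j},$$ and define the horizontal lift of $X=X^j\frac{\partial}{\partial x^j}$ by $X^h=X^j\big(\frac{\partial}{\partial x^j}-G^i_j\frac{\partial}{\partial y^i}\big)$. Parallel fields $Y$ along a curve $c$ in $M$ are the solutions of $\dot Y^i+G^i_j(c,Y)\dot c^j=0$; the resulting parallel translation maps the indicatrix $\mathcal I_{c(0)}M$ to $\mathcal I_{c(1)}M$, where $\mathcal I_pM=\{y\in T_pM:\mathcal F(y)=1\}$. Let $\mathcal IM=\{y\in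 TM:\mathcal F(y)=1\}$ be the indicatrix bundle. Fix $1\le r\le\infty$. Let $\mathsf{Hol}(p)$ be the group of diffeomorphisms of $\mathcal I_pM$ given by parallel translation along piecewise $C^r$ closed curves starting at $p$, and let the fibred holonomy group $\mathsf{Hol_f}(M)$ consist of the diffeomorphisms $\Phi$ of $\mathcal IM$ that map each $\mathcal I_pM$ to itself with $\Phi|_{\mathcal I_pM}\in\mathsf{Hol}(p)$. A smooth vector field $\xi$ on $\mathcal IM$ is called strongly tangent to a subgroup $H$ of $\mathsf{Diff}^\infty(\mathcal IM)$ if for some $k\ge1$ and $\varepsilon>0$ there is a $C^\infty$-differentiable family of diffeomorphisms $\phi_{(t_1,\dots,t_k)}\in H$, $t_i\in(-\varepsilon,\varepsilon)$, such that $\phi_{(t_1,\dots,t_k)}=\mathsf{Id}$ whenever some $t_j=0$, and $\frac{\partial^k\phi_{(t_1,\dots,t_k)}}{\partial t_1\cdots\partial t_k}\big|_{(0,\dots,0)}=\xi$. Then: if a smooth vector field $\xi$ on $\mathcal IM$ is strongly tangent to $\mathsf{Hol_f}(M)$, then for every smooth vector field $X$ on $M$ the horizontal Berwald covariant derivative $\nabla_X\xi=[X^h,\xi]$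 is a smooth vector field on $\mathcal IM$ and is strongly tangent to $\mathsf{Hol_f}(M)$. -/

import Mathlib

open Set
open scoped Manifold ContDiff

noncomputable section

namespace FinslerHolonomy

/-! ### Subgroups of diffeomorphism groups and strongly tangent vector fields -/

section Tangency

variable {E : Type*} [NormedAddCommGroup E] [NormedSpace ℝ E]
  {H : Type*} [TopologicalSpace H] (J : ModelWithCorners ℝ E H)
  {N : Type*} [TopologicalSpace N] [ChartedSpace H N]

/-- A map `f : P → N`, defined on a submanifold `P` of the manifold `N`, is smooth.
`ContMDiffOn` depends only on the values of `g` on `P`. -/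
def SmoothMapOn (P : Set N) (f : P → N) : Prop :=
  ∃ g : N → N, (∀ y : P, g y = f y) ∧ ContMDiffOn J J ∞ g P

/-- The group of smooth diffeomorphisms of a submanifold `P` of `N`. -/
def diffeoGroup (P : Set N) : Subgroup (Equiv.Perm P) where
  carrier := {φ | SmoothMapOn J P (fun y => (φ y : N)) ∧
    SmoothMapOn J P (fun y => (φ.symm y : N))}
  one_mem' := ⟨⟨id, fun _ => rfl, contMDiffOn_id⟩, ⟨id, fun _ => rfl, contMDiffOn_id⟩⟩
  mul_mem' := by
    have key : ∀ f g : P → P, SmoothMapOn J P (fun y => (f y : N)) →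
        SmoothMapOn J P (fun y => (g y : N)) → SmoothMapOn J P (fun y => (f (g y) : N)) := by
      rintro f g ⟨f', hf, hf'⟩ ⟨g', hg, hg'⟩
      refine ⟨f' ∘ g', fun y => ?_, hf'.comp hg' fun y hy => ?_⟩
      · simp [hg, hf]
      · have := hg ⟨y, hy⟩
        simp only [mem_preimage] at this ⊢
        rw [this]
        exact (g ⟨y, hy⟩).2
    rintro a b ⟨ha, ha'⟩ ⟨hb, hb'⟩
    exact ⟨key a b ha hb, key b.symm a.symm hb' ha'⟩
  inv_mem' := fun h => ⟨h.2, h.1⟩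

/-- The open cube `(-ε, ε)^k` of parameters. -/
def paramCube (k : ℕ) (ε : ℝ) : Set (Fin k → ℝ) := {t | ∀ i, t i ∈ Ioo (-ε) ε}

/-- `{φ_t}`, `t ∈ (-ε, ε)^k`, is a `C^∞`-differentiable `k`-parameter family of diffeomorphisms
of `P` with `φ_t = Id` whenever some `t_j = 0`. The values of `φ` outside the cube are irrelevant. -/
def IsCommutatorLike (P : Set N) (k : ℕ) (ε : ℝ)
    (φ : (Fin k → ℝ) → diffeoGroup J P) : Prop :=
  (∃ g : (Fin k → ℝ) × N → N,
    (∀ t ∈ paramCube k ε, ∀ y : P, g (t, y) = ((φ t).1 y : N)) ∧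
    ContMDiffOn (𝓘(ℝ, Fin k → ℝ).prod J) J ∞ g (paramCube k ε ×ˢ P)) ∧
  ∀ t ∈ paramCube k ε, (∃ j, t j = 0) → φ t = 1

/-- The vector field `ξ` on `P` is strongly tangent to the subgroup `G` of the diffeomorphism group
of `P`. The mixed derivative `∂^k φ_t(y) / ∂t_1 ⋯ ∂t_k` at `t = 0` is computed in the chart of `N`
at `y`; for a commutator-like family it does not depend on the chart. -/
def IsStronglyTangent (P : Set N) (G : Subgroup (diffeoGroup J P))
    (ξ : ∀ y : N, TangentSpace J y) : Prop :=
  ∃ (k : ℕ) (ε : ℝ) (φ : (Fin k → ℝ) → diffeoGroup J P),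
    1 ≤ k ∧ 0 < ε ∧ IsCommutatorLike J P k ε φ ∧
    (∀ t ∈ paramCube k ε, φ t ∈ G) ∧
    ∀ y : P,
      iteratedFDeriv ℝ k (fun t => extChartAt J (y : N) ((φ t).1 y : N)) 0
          (fun i => Pi.single i (1 : ℝ)) =
        mfderiv J 𝓘(ℝ, E) (extChartAt J (y : N)) (y : N) (ξ y)

end Tangency

/-! ### Finsler manifolds -/

/-- `(1/2) ∂²(f²)(y + s u + t v) / ∂s ∂t` at `s = t = 0`. -/
def fundamentalForm {V : Type*} [AddCommGroup V] [Module ℝ V] (f : V → ℝ) (y u v : V) : ℝ :=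
  (1 / 2) * deriv (fun s : ℝ => deriv (fun t : ℝ => f (y + s • u + t • v) ^ 2) 0) 0

section Finsler

variable {n : ℕ} {M : Type*} [TopologicalSpace M] [ChartedSpace (EuclideanSpace ℝ (Fin n)) M]
  [IsManifold (𝓡 n) ∞ M]

/-- `F` is a Finsler function on `M`. -/
structure IsFinsler (F : TangentBundle (𝓡 n) M → ℝ) : Prop where
  continuous : Continuous F
  smooth : ContMDiffOn (𝓡 n).tangent 𝓘(ℝ, ℝ) ∞ F {v | v.2 ≠ 0}
  homogeneous : ∀ (x : M) (y : TangentSpace (𝓡 n) x) (a : ℝ), 0 < a →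
    F ⟨x, a • y⟩ = a * F ⟨x, y⟩
  posDef : ∀ (x : M) (y u : TangentSpace (𝓡 n) x), y ≠ 0 → u ≠ 0 →
    0 < fundamentalForm (fun w : TangentSpace (𝓡 n) x => F ⟨x, w⟩) y u u

variable (F : TangentBundle (𝓡 n) M → ℝ)

/-- The Finsler function in the coordinates `(x, y)` of `TM` induced by the chart of `M` at `p`. -/
def localF (p : M) (x y : EuclideanSpace ℝ (Fin n)) : ℝ :=
  F ((extChartAt (𝓡 n).tangent (⟨p, 0⟩ : TangentBundle (𝓡 n) M)).symm (x, y))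

/-- The `i`-th coordinate vector. -/
def coordVec (i : Fin n) : EuclideanSpace ℝ (Fin n) := EuclideanSpace.single i 1

/-- The matrix `g_{ij}(x, y)` of the Finsler metric in the chart at `p`. -/
def metricMatrix (p : M) (x y : EuclideanSpace ℝ (Fin n)) : Matrix (Fin n) (Fin n) ℝ :=
  Matrix.of fun i j => fundamentalForm (localF F p x) y (coordVec i) (coordVec j)

/-- `∂g_{ij} / ∂x^k` in the chart at `p`. -/
def metricDeriv (p : M) (i j k : Fin n) (x y : EuclideanSpace ℝ (Fin n)) : ℝ :=
  lineDeriv ℝ (fun x' => metricMatrix F p x' y i j) x (coordVec k)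

/-- The spray coefficients
`G^i = (1/4) g^{il} (2 ∂g_{jl}/∂x^k - ∂g_{jk}/∂x^l) y^j y^k` in the chart at `p`. -/
def spray (p : M) (i : Fin n) (x y : EuclideanSpace ℝ (Fin n)) : ℝ :=
  (1 / 4) * ∑ l, ∑ j, ∑ k, (metricMatrix F p x y)⁻¹ i l *
    (2 * metricDeriv F p j l k x y - metricDeriv F p j k l x y) * y j * y k

/-- `G^i_j = ∂G^i / ∂y^j` in the chart at `p`. -/
def connCoeff (p : M) (i j : Fin n) (x y : EuclideanSpace ℝ (Fin n)) : ℝ :=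
  lineDeriv ℝ (fun y' => spray F p i x y') y (coordVec j)

/-- The horizontal lift of `X ∈ T_xM` to `v ∈ T_xM`, `v ≠ 0`: in the coordinates of `TM` induced by
the chart of `M` at `x` it is `X^j (∂/∂x^j - G^i_j ∂/∂y^i)`. (An element of `TangentSpace` is the
list of its components in the chart at its base point.) -/
def horizontalLift (v : TangentBundle (𝓡 n) M) (X : TangentSpace (𝓡 n) v.proj) :
    TangentSpace (𝓡 n).tangent v :=
  let ξ : EuclideanSpace ℝ (Fin n) := X
  let c : EuclideanSpace ℝ (Fin n) × EuclideanSpace ℝ (Fin n) := extChartAt (𝓡 n).tangent v v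
  ((ξ, WithLp.toLp 2 fun i => -∑ j, connCoeff F v.proj i j c.1 c.2 * ξ j) :
    EuclideanSpace ℝ (Fin n) × EuclideanSpace ℝ (Fin n))

theorem horizontalLift_neg (v : TangentBundle (𝓡 n) M) (X : TangentSpace (𝓡 n) v.proj) :
    horizontalLift F v (-X) = -horizontalLift F v X := by
  have aux : ∀ (A : Fin n → ℝ) (ξ : EuclideanSpace ℝ (Fin n)),
      -∑ j, A j * (-ξ) j = -(-∑ j, A j * ξ j) := fun A ξ => by simp
  refine Prod.ext rfl ?_
  ext i
  exact aux _ _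

/-- The horizontal lift `X^h` of a vector field `X` on `M`. -/
def horizontalLiftField (X : ∀ x : M, TangentSpace (𝓡 n) x) (v : TangentBundle (𝓡 n) M) :
    TangentSpace (𝓡 n).tangent v :=
  horizontalLift F v (X v.proj)

/-! ### Indicatrices and vector fields on the indicatrix bundle -/

/-- The total space `IM ⊆ TM` of the indicatrix bundle. -/
def indicatrixBundle : Set (TangentBundle (𝓡 n) M) := {v | F v = 1}

/-- The indicatrix `I_pM`, as a subset of `TM`. -/
def indicatrix (p : M) : Set (TangentBundle (𝓡 n) M) := {v | v.proj = p ∧ F v = 1}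

/-- `X` is a smooth vector field on `M`. -/
def IsSmoothField (X : ∀ x : M, TangentSpace (𝓡 n) x) : Prop :=
  ContMDiff (𝓡 n) (𝓡 n).tangent ∞ (fun x => (⟨x, X x⟩ : TangentBundle (𝓡 n) M))

/-- `ξ` is a smooth vector field on `IM`: a smooth section of `T(TM)` over `IM` that is tangent to
the hypersurface `IM = {F = 1}`. The values of `ξ` outside `IM` are irrelevant. -/
def IsIndicatrixField (ξ : ∀ v : TangentBundle (𝓡 n) M, TangentSpace (𝓡 n).tangent v) : Prop :=
  ContMDiffOn (𝓡 n).tangent (𝓡 n).tangent.tangent ∞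
    (fun v => (⟨v, ξ v⟩ : TangentBundle (𝓡 n).tangent (TangentBundle (𝓡 n) M)))
    (indicatrixBundle F) ∧
  ∀ v ∈ indicatrixBundle F, mfderiv (𝓡 n).tangent 𝓘(ℝ, ℝ) F v (ξ v) = 0

/-- The bracket formed along a set `s` is that of arbitrary differentiable extensions of the two
fields, as soon as the fields are tangent to `s`. -/
theorem lieBracketWithin_eq_of_extension {E : Type*} [NormedAddCommGroup E] [NormedSpace ℝ E]
    {V W V' W' : E → E} {s : Set E} {x : E} (hx : x ∈ s)
    (hV : ∀ y ∈ s, V y = V' y) (hW : ∀ y ∈ s, W y = W' y)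
    (hV' : DifferentiableAt ℝ V' x) (hW' : DifferentiableAt ℝ W' x)
    (hVt : V x ∈ tangentConeAt ℝ s x) (hWt : W x ∈ tangentConeAt ℝ s x) :
    VectorField.lieBracketWithin ℝ V W s x = VectorField.lieBracket ℝ V' W' x := by
  have h1 : HasFDerivWithinAt V (fderiv ℝ V' x) s x :=
    hV'.hasFDerivAt.hasFDerivWithinAt.congr hV (hV x hx)
  have h2 : HasFDerivWithinAt W (fderiv ℝ W' x) s x :=
    hW'.hasFDerivAt.hasFDerivWithinAt.congr hW (hW x hx)
  have e1 := h1.differentiableWithinAt.hasFDerivWithinAt.unique_on h1 hWt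
  have e2 := h2.differentiableWithinAt.hasFDerivWithinAt.unique_on h2 hVt
  rw [VectorField.lieBracketWithin, VectorField.lieBracket, e1, e2, hV x hx, hW x hx]

/-- The horizontal Berwald covariant derivative `∇_X ξ = [X^h, ξ]` of a vector field `ξ` on `IM`.
Both fields are tangent to the submanifold `IM` of `TM`, and the bracket is formed along `IM`;
it is the restriction to `IM` of the bracket of any smooth extensions of the two fields. -/
def berwaldDeriv (X : ∀ x : M, TangentSpace (𝓡 n) x)
    (ξ : ∀ v : TangentBundle (𝓡 n) M, TangentSpace (𝓡 n).tangent v)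
    (v : TangentBundle (𝓡 n) M) : TangentSpace (𝓡 n).tangent v :=
  VectorField.mlieBracketWithin (𝓡 n).tangent (horizontalLiftField F X) ξ (indicatrixBundle F) v

/-! ### Parallel translation and holonomy groups -/

/-- `Y` is a parallel field of nonzero vectors along the curve `π ∘ Y` on `[0, 1]`: the velocity of
`Y` is the horizontal lift of that of `π ∘ Y`, that is, `dY^i/dt + G^i_j(c, Y) dc^j/dt = 0`. -/
def IsParallel (Y : ℝ → TangentBundle (𝓡 n) M) : Prop :=
  MDifferentiableOn 𝓘(ℝ, ℝ) (𝓡 n).tangent Y (Icc 0 1) ∧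
  ∀ t ∈ Icc (0 : ℝ) 1, (Y t).2 ≠ 0 ∧
    mfderivWithin 𝓘(ℝ, ℝ) (𝓡 n).tangent Y (Icc 0 1) t (1 : ℝ) =
      horizontalLift F (Y t)
        (mfderivWithin 𝓘(ℝ, ℝ) (𝓡 n) (fun s => (Y s).proj) (Icc 0 1) t (1 : ℝ))

/-- `τ : I_pM → I_qM` is the parallel translation along the curve `c : [0, 1] → M`. -/
def IsTranslationAlong (c : ℝ → M) {p q : M} (τ : indicatrix F p ≃ indicatrix F q) : Prop :=
  ∀ v : indicatrix F p, ∃ Y : ℝ → TangentBundle (𝓡 n) M,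
    IsParallel F Y ∧ (∀ t ∈ Icc (0 : ℝ) 1, (Y t).proj = c t) ∧ Y 0 = v ∧ Y 1 = τ v

/-- `τ : I_pM → I_qM` is the parallel translation along some piecewise `C^r` curve from `p` to `q`,
that is, along the concatenation of finitely many `C^r` arcs. -/
inductive IsTranslation (r : ℕ∞) (p : M) :
    (q : M) → (indicatrix F p ≃ indicatrix F q) → Prop
  | refl : IsTranslation r p p (Equiv.refl _)
  | append {q s : M} (τ : indicatrix F p ≃ indicatrix F q) (σ : indicatrix F q ≃ indicatrix F s)
      (c : ℝ → M) : IsTranslation r p q τ →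
      ContMDiffOn 𝓘(ℝ, ℝ) (𝓡 n) r c (Icc 0 1) → c 0 = q → c 1 = s →
      IsTranslationAlong F c σ → IsTranslation r p s (τ.trans σ)

variable {F}

theorem IsTranslation.trans {r : ℕ∞} {p q s : M} {τ : indicatrix F p ≃ indicatrix F q}
    {σ : indicatrix F q ≃ indicatrix F s} (hτ : IsTranslation F r p q τ)
    (hσ : IsTranslation F r q s σ) : IsTranslation F r p s (τ.trans σ) := by
  induction hσ with
  | refl => exact hτ
  | append σ ρ c _ hc h0 h1 hρ ih => exact IsTranslation.append (τ.trans σ) ρ c ih hc h0 h1 hρ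

theorem IsTranslationAlong.symm {c : ℝ → M} {p q : M} {τ : indicatrix F p ≃ indicatrix F q}
    (h : IsTranslationAlong F c τ) : IsTranslationAlong F (fun t => c (1 - t)) τ.symm := by
  intro w
  obtain ⟨Y, ⟨hd, hY⟩, hc, h0, h1⟩ := h (τ.symm w)
  have hmaps : MapsTo (fun t : ℝ => 1 - t) (Icc 0 1) (Icc 0 1) := fun t ht =>
    ⟨by linarith [ht.2], by linarith [ht.1]⟩
  have hr : ∀ t : ℝ, HasMFDerivWithinAt 𝓘(ℝ, ℝ) 𝓘(ℝ, ℝ) (fun t : ℝ => 1 - t) (Icc 0 1) t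
      (-(ContinuousLinearMap.id ℝ ℝ)) := fun t =>
    ((hasFDerivWithinAt_id t (Icc (0 : ℝ) 1)).const_sub 1).hasMFDerivWithinAt
  have hrd : MDifferentiableOn 𝓘(ℝ, ℝ) 𝓘(ℝ, ℝ) (fun t : ℝ => 1 - t) (Icc 0 1) := fun t _ =>
    (hr t).mdifferentiableWithinAt
  have hu : UniqueMDiffOn 𝓘(ℝ, ℝ) (Icc (0 : ℝ) 1) :=
    (uniqueDiffOn_Icc zero_lt_one).uniqueMDiffOn
  refine ⟨fun t => Y (1 - t), ⟨hd.comp hrd hmaps, fun t ht => ⟨(hY _ (hmaps ht)).1, ?_⟩⟩,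
    fun t ht => hc _ (hmaps ht), by simp [h1], by simp [h0]⟩
  have hY1 := (hd _ (hmaps ht)).hasMFDerivWithinAt
  have hP1 : HasMFDerivWithinAt 𝓘(ℝ, ℝ) (𝓡 n) (fun s => (Y s).proj) (Icc 0 1) (1 - t)
      (mfderivWithin 𝓘(ℝ, ℝ) (𝓡 n) (fun s => (Y s).proj) (Icc 0 1) (1 - t)) := by
    apply MDifferentiableWithinAt.hasMFDerivWithinAt
    exact ((Bundle.mdifferentiableAt_proj (TangentSpace (𝓡 n) : M → Type _)
      (p := Y (1 - t))).comp_mdifferentiableWithinAt (1 - t) (hd _ (hmaps ht)))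
  have e1 := (HasMFDerivWithinAt.comp t hY1 (hr t) hmaps).mfderivWithin (hu t ht)
  have e2 := (HasMFDerivWithinAt.comp t hP1 (hr t) hmaps).mfderivWithin (hu t ht)
  have key := (hY _ (hmaps ht)).2
  have e1' : mfderivWithin 𝓘(ℝ, ℝ) (𝓡 n).tangent (fun t => Y (1 - t)) (Icc 0 1) t (1 : ℝ) =
      -mfderivWithin 𝓘(ℝ, ℝ) (𝓡 n).tangent Y (Icc 0 1) (1 - t) (1 : ℝ) :=
    (congrArg (fun L => L (1 : ℝ)) e1).trans
      (map_neg (mfderivWithin 𝓘(ℝ, ℝ) (𝓡 n).tangent Y (Icc 0 1) (1 - t)) (1 : ℝ))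
  have e2' : mfderivWithin 𝓘(ℝ, ℝ) (𝓡 n) (fun s => (Y (1 - s)).proj) (Icc 0 1) t (1 : ℝ) =
      -mfderivWithin 𝓘(ℝ, ℝ) (𝓡 n) (fun s => (Y s).proj) (Icc 0 1) (1 - t) (1 : ℝ) :=
    (congrArg (fun L => L (1 : ℝ)) e2).trans
      (map_neg (mfderivWithin 𝓘(ℝ, ℝ) (𝓡 n) (fun s => (Y s).proj) (Icc 0 1) (1 - t)) (1 : ℝ))
  refine e1'.trans ((congrArg Neg.neg key).trans ?_)
  rw [e2']
  exact (horizontalLift_neg F (Y (1 - t)) _).symm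

theorem IsTranslation.symm {r : ℕ∞} {p q : M} {τ : indicatrix F p ≃ indicatrix F q}
    (h : IsTranslation F r p q τ) : IsTranslation F r q p τ.symm := by
  induction h with
  | refl => exact IsTranslation.refl
  | append τ σ c _ hc h0 h1 hσ ih =>
    refine IsTranslation.trans (σ := τ.symm) (IsTranslation.append (Equiv.refl _) σ.symm
      (fun t => c (1 - t)) IsTranslation.refl ?_ (by simp [h1]) (by simp [h0]) hσ.symm) ih
    refine hc.comp (t := Icc (0 : ℝ) 1) ?_ fun t ht => ⟨by linarith [ht.2], by linarith [ht.1]⟩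
    exact (contDiff_const.sub contDiff_id).contMDiff.contMDiffOn

variable (F)

/-- The holonomy group `Hol(p)`: the diffeomorphisms of the indicatrix `I_pM` given by parallel
translation along piecewise `C^r` closed curves starting at `p`. -/
def holonomyGroup (r : ℕ∞) (p : M) : Subgroup (diffeoGroup (𝓡 n).tangent (indicatrix F p)) where
  carrier := {φ | IsTranslation F r p p φ.1}
  one_mem' := IsTranslation.refl
  mul_mem' := fun ha hb => IsTranslation.trans hb ha
  inv_mem' := fun h => IsTranslation.symm h

/-- The fibred holonomy group `Hol_f(M)`: the diffeomorphisms `Φ` of `IM` that preserve each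
indicatrix `I_pM` and restrict on it to an element of `Hol(p)`. -/
def fibredHolonomyGroup (r : ℕ∞) :
    Subgroup (diffeoGroup (𝓡 n).tangent (indicatrixBundle F)) where
  carrier := {Φ | ∀ p : M, ∃ φ ∈ holonomyGroup F r p, ∀ v : indicatrix F p,
    (Φ.1 ⟨v, v.2.2⟩ : TangentBundle (𝓡 n) M) = φ.1 v}
  one_mem' := fun p => ⟨1, one_mem _, fun _ => rfl⟩
  mul_mem' := by
    intro a b ha hb p
    obtain ⟨φ, hφ, h⟩ := ha p
    obtain ⟨ψ, hψ, h'⟩ := hb p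
    refine ⟨φ * ψ, mul_mem hφ hψ, fun v => ?_⟩
    have e : b.1 ⟨v, v.2.2⟩ = ⟨ψ.1 v, (ψ.1 v).2.2⟩ := Subtype.ext (h' v)
    change (a.1 (b.1 ⟨v, v.2.2⟩) : TangentBundle (𝓡 n) M) = φ.1 (ψ.1 v)
    rw [e, h]
  inv_mem' := by
    intro a ha p
    obtain ⟨φ, hφ, h⟩ := ha p
    refine ⟨φ⁻¹, inv_mem hφ, fun v => ?_⟩
    change (a.1.symm ⟨v, v.2.2⟩ : TangentBundle (𝓡 n) M) = φ.1.symm v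
    have e : a.1 ⟨φ.1.symm v, (φ.1.symm v).2.2⟩ = ⟨v, v.2.2⟩ :=
      Subtype.ext (by simp [h])
    rw [← e, Equiv.symm_apply_apply]

end Finsler

end FinslerHolonomy

end

/-! Let `φ_t` be a `k`-parameter family in the fibred holonomy group whose mixed derivative is `ξ`,
and let `Fl` be the flow of `X^h`. The field `[X^h, ξ]` is realised by the `(k+1)`-parameter family
of commutators `ψ_(t,s) = Fl_{-s} ∘ φ_t ∘ Fl_s ∘ φ_t⁻¹`. This is the identity when `s = 0`, and also
when some `t_j = 0`, because then `φ_t = Id`. Flow lines of `X^h` are parallel fields along integral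
curves of `X`. So over a point `p` the commutator is a holonomy at `p`, a translation to a point
`q`, a holonomy at `q` and the translation back, that is, translation along a loop at `p`. Its
`s`-derivative at `s = 0` is `(φ_t)_* X^h - X^h`, and the mixed `t`-derivative of that is `[X^h,
ξ]`.

Mixed derivatives reduce to first order calculus. If `f` is constant on the coordinate hyperplanes,
then `f(s,…,s) = f(0) + s^k m + o(s^k)` with `m` its mixed derivative (`hasOrderDeriv_mixedDeriv`),
so only first derivatives of maps applied to `f` matter. This gives independence of the chart, the
derivative `-ξ` of the inverse family, the bracket formula (`mixedDeriv_commutator`) and the fact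
that mixed derivatives lie in tangent cones. The last point allows the bracket along `IM` to be
computed from extensions of the fields.

The flow of `X^h` need not be complete. Indicatrices near a point are uniformly compact, so there is
a smooth `δ > 0` on `M` such that on the indicatrix at `x` the flow exists, and can be undone, for
`|τ| < δ x` (`exists_safe_radius`). The time `s` is replaced by `truncatedTime (δ x) s`, which is
smaller than `δ x` and has derivative `1` at `s = 0`. It depends on the base point only, so each
fibre is still moved along a single curve.

To work on open subsets of `TM`, the maps `φ_t` are extended homogeneously to `{F > 0}`. Joint
smoothness of `(t, v) ↦ φ_t⁻¹ v` then comes from the inverse function theorem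
(`contMDiffOn_inverse_family`).

The geometry of `X^h` rests on the Euler–Lagrange form of the spray of `L = F²/2`. It determines the
spray because the vertical Hessian is nondegenerate. It yields the coordinate independence of
horizontal lifts, hence smoothness of `X^h` (`chartField_horizontalLiftField`), and together with
homogeneity it shows that horizontal vectors annihilate `F`, so that the flow preserves `IM`. Smooth
dependence of flows on initial values is obtained from the inverse function theorem in `C([-1,1],
E)`. -/

noncomputable section

namespace FinslerHolonomy

open Filter Topology Asymptotics

/-! ### Smooth local flows of vector fields on a normed space -/

section CompositionOperator

universe u

/-- Postcomposition with a continuous map, as a map between spaces of continuous functions. -/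
def postcomp (K : Type*) [TopologicalSpace K] {E F : Type*} [TopologicalSpace E]
    [TopologicalSpace F] (V : C(E, F)) (g : C(K, E)) : C(K, F) := V.comp g

variable {K : Type*} [TopologicalSpace K] [CompactSpace K]
  {E F : Type u} [NormedAddCommGroup E] [NormedSpace ℝ E] [NormedAddCommGroup F] [NormedSpace ℝ F]

/-- Pointwise application of a continuous family of linear maps to a continuous function. -/
def pointwiseApply (K : Type*) [TopologicalSpace K] [CompactSpace K] (E F : Type u)
    [NormedAddCommGroup E] [NormedSpace ℝ E] [NormedAddCommGroup F] [NormedSpace ℝ F] :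
    C(K, E →L[ℝ] F) →L[ℝ] C(K, E) →L[ℝ] C(K, F) :=
  LinearMap.mkContinuous₂
    (LinearMap.mk₂ ℝ (fun (A : C(K, E →L[ℝ] F)) (h : C(K, E)) =>
        (⟨fun x => A x (h x), A.continuous.clm_apply h.continuous⟩ : C(K, F)))
      (fun _ _ _ => by ext; simp) (fun _ _ _ => by ext; simp)
      (fun _ _ _ => by ext; simp) (fun _ _ _ => by ext; simp)) 1
    (fun A h => by
      rw [one_mul, ContinuousMap.norm_le _ (by positivity)]
      intro x
      have hA : ‖A x‖ ≤ ‖A‖ := A.norm_coe_le_norm x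
      exact ((A x).le_opNorm _).trans (mul_le_mul hA (h.norm_coe_le_norm x)
        (norm_nonneg _) ((norm_nonneg (A x)).trans hA)))

/-- The range of `g` is compact, so `fderiv ℝ V` is uniformly continuous at its points, even when
`E` is infinite dimensional. The mean value inequality on balls about `g x` then makes the first
order error small relative to `‖h‖`, uniformly in `x`. -/
theorem hasFDerivAt_postcomp {V : E → F} (hV : ContDiff ℝ 1 V) (g : C(K, E)) :
    HasFDerivAt (postcomp K ⟨V, hV.continuous⟩)
      (pointwiseApply K E F (postcomp K ⟨fderiv ℝ V, hV.continuous_fderiv one_ne_zero⟩ g)) g := by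
  rw [hasFDerivAt_iff_isLittleO_nhds_zero, Asymptotics.isLittleO_iff]
  intro c hc
  have hS : IsCompact (range g) := isCompact_range g.continuous
  have hu := hS.uniformContinuousAt_of_continuousAt (f := fderiv ℝ V)
    (fun x _ => (hV.continuous_fderiv one_ne_zero).continuousAt) (Metric.dist_mem_uniformity hc)
  obtain ⟨δ, hδ, hd⟩ := Metric.mem_uniformity_dist.1 hu
  filter_upwards [Metric.ball_mem_nhds (0 : C(K, E)) hδ] with h hh
  rw [ContinuousMap.norm_le _ (by positivity)]
  intro x
  have hx : ‖h x‖ < δ := (h.norm_coe_le_norm x).trans_lt (by simpa using hh)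
  have key := (convex_ball (g x) δ).norm_image_sub_le_of_norm_hasFDerivWithin_le'
    (f := V) (f' := fderiv ℝ V) (φ := fderiv ℝ V (g x)) (C := c) (x := g x) (y := g x + h x)
    (fun y _ => ((hV.differentiable one_ne_zero) y).hasFDerivAt.hasFDerivWithinAt)
    (fun y hy => by
      have := hd (a := g x) (b := y) (by rw [dist_comm]; exact hy) ⟨x, rfl⟩
      have h2 : dist (fderiv ℝ V (g x)) (fderiv ℝ V y) < c := this
      rw [dist_comm, dist_eq_norm] at h2
      exact h2.le)
    (Metric.mem_ball_self hδ) (by simpa using hx)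
  rw [add_sub_cancel_left] at key
  exact key.trans (mul_le_mul_of_nonneg_left (h.norm_coe_le_norm x) hc.le)

/-- The derivative of postcomposition with `V` is postcomposition with `fderiv ℝ V` followed by a
continuous linear map, so one order is gained per induction step. The target changes from `F` to `E
→L[ℝ] F`, which is why `F` is quantified inside the induction and why `E` and `F` share a universe.
-/
theorem contDiff_postcomp_nat (n : ℕ) : ∀ {F : Type u} [NormedAddCommGroup F] [NormedSpace ℝ F]
    {V : E → F} (hV : ContDiff ℝ ∞ V), ContDiff ℝ n (postcomp K ⟨V, hV.continuous⟩) := by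
  induction n with
  | zero =>
    intro F _ _ V hV
    exact contDiff_zero.2 (continuous_iff_continuousAt.2 fun g =>
      (hasFDerivAt_postcomp (hV.of_le (by exact_mod_cast le_top)) g).continuousAt)
  | succ n ih =>
    intro F _ _ V hV
    have h1 : ContDiff ℝ 1 V := hV.of_le (by exact_mod_cast le_top)
    have h2 : ContDiff ℝ ∞ (fderiv ℝ V) := (contDiff_infty_iff_fderiv.1 hV).2
    refine (contDiff_succ_iff_hasFDerivAt (n := n)).2 ⟨_, ?_, hasFDerivAt_postcomp h1⟩
    exact (pointwiseApply K E F).contDiff.comp (ih h2)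

theorem contDiff_postcomp {V : E → F} (hV : ContDiff ℝ ∞ V) :
    ContDiff ℝ ∞ (postcomp K ⟨V, hV.continuous⟩) :=
  contDiff_infty.2 fun n => contDiff_postcomp_nat n hV

end CompositionOperator

/-- The inverse function theorem with a smooth local inverse on an open set. -/
theorem exists_contDiffOn_localInverse {E F : Type*} [NormedAddCommGroup E] [NormedSpace ℝ E]
    [CompleteSpace E] [NormedAddCommGroup F] [NormedSpace ℝ F] [CompleteSpace F] {A : E → F}
    {O : Set E} (hO : IsOpen O) (hA : ContDiffOn ℝ ∞ A O) {a : E} (ha : a ∈ O) (e : E ≃L[ℝ] F)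
    (he : HasFDerivAt A (e : E →L[ℝ] F) a) :
    ∃ (N : Set F) (L : F → E), IsOpen N ∧ A a ∈ N ∧ ContDiffOn ℝ ∞ L N ∧ L (A a) = a ∧
      (∀ b ∈ N, L b ∈ O ∧ A (L b) = b) ∧ ∀ᶠ x in 𝓝 a, L (A x) = x := by
  have hAa : ContDiffAt ℝ ∞ A a := hA.contDiffAt (hO.mem_nhds ha)
  set P := hAa.toOpenPartialHomeomorph A he (by simp) with hP
  have hcoe : (P : E → F) = A := hAa.toOpenPartialHomeomorph_coe he (by simp)
  have haP : a ∈ P.source := hAa.mem_toOpenPartialHomeomorph_source he (by simp)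
  have hbP : A a ∈ P.target := hAa.image_mem_toOpenPartialHomeomorph_target he (by simp)
  have hsa : P.symm (A a) = a := by rw [← hcoe]; exact P.left_inv haP
  -- Invertibility of the derivative is an open condition. Shrinking to the points where it holds
  -- makes the local inverse smooth on a whole neighbourhood, not only at `A a`.
  have hop : IsOpen (O ∩ (fderiv ℝ A) ⁻¹' (range ((↑) : (E ≃L[ℝ] F) → E →L[ℝ] F))) :=
    (hA.continuousOn_fderiv_of_isOpen hO (by simp)).isOpen_inter_preimage hO
      (ContinuousLinearEquiv.isOpen (𝕜 := ℝ) (E := E) (F := F))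
  refine ⟨P.target ∩ P.symm ⁻¹' _, P.symm, P.isOpen_inter_preimage_symm hop, ⟨hbP, ?_⟩, ?_, hsa,
    ?_, ?_⟩
  · rw [mem_preimage, hsa]
    exact ⟨ha, e, he.fderiv.symm⟩
  · rintro b ⟨hb, hb', e', he'⟩
    have hd : HasFDerivAt P (e' : E →L[ℝ] F) (P.symm b) := by
      rw [hcoe, he']
      exact ((hA.contDiffAt (hO.mem_nhds hb')).differentiableAt (by simp)).hasFDerivAt
    exact (P.contDiffAt_symm hb hd
      (by rw [hcoe]; exact hA.contDiffAt (hO.mem_nhds hb'))).contDiffWithinAt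
  · rintro b ⟨hb, hb', -⟩
    exact ⟨hb', by rw [← hcoe]; exact P.right_inv hb⟩
  · filter_upwards [P.open_source.mem_nhds haP] with x hx
    rw [← hcoe]
    exact P.left_inv hx

/-- A smooth map on an open set coincides near a point with a globally smooth map. -/
theorem exists_contDiff_eventuallyEq {E F : Type*} [NormedAddCommGroup E] [NormedSpace ℝ E]
    [FiniteDimensional ℝ E] [NormedAddCommGroup F] [NormedSpace ℝ F] {V : E → F} {O : Set E}
    (hO : IsOpen O) (hV : ContDiffOn ℝ ∞ V O) {z : E} (hz : z ∈ O) :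
    ∃ W : E → F, ContDiff ℝ ∞ W ∧ W =ᶠ[𝓝 z] V := by
  obtain ⟨ρ, hρ, hb⟩ := Metric.isOpen_iff.1 hO z hz
  let f : ContDiffBump z := ⟨ρ / 4, ρ / 2, by positivity, by linarith⟩
  refine ⟨fun x => f x • V x, contDiff_iff_contDiffAt.2 fun x => ?_, ?_⟩
  · by_cases hx : x ∈ O
    · exact f.contDiff.contDiffAt.smul (hV.contDiffAt (hO.mem_nhds hx))
    · have hx' : x ∉ tsupport f := fun h => hx (hb (by
        rw [f.tsupport_eq] at h
        exact Metric.closedBall_subset_ball (by change ρ / 2 < ρ; linarith) h))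
      have : (fun x => f x • V x) =ᶠ[𝓝 x] fun _ => 0 := by
        filter_upwards [(isClosed_tsupport f).isOpen_compl.mem_nhds hx'] with y hy
        rw [image_eq_zero_of_notMem_tsupport hy, zero_smul]
      exact contDiffAt_const.congr_of_eventuallyEq this
  · filter_upwards [f.eventuallyEq_one] with x hx
    rw [hx]
    simp

section Flow

variable {E : Type*} [NormedAddCommGroup E] [NormedSpace ℝ E]

/-- The primitive vanishing at `0` of a continuous function on `[-1, 1]`. -/
def primitive (E : Type*) [NormedAddCommGroup E] [NormedSpace ℝ E] :
    C(Icc (-1 : ℝ) 1, E) →L[ℝ] C(Icc (-1 : ℝ) 1, E) :=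
  LinearMap.mkContinuous
    { toFun := fun g => ⟨fun u => ∫ r in (0 : ℝ)..u, IccExtend (by norm_num) g r,
        (intervalIntegral.continuous_primitive
          (fun a b => (g.continuous.Icc_extend' (h := by norm_num)).intervalIntegrable a b)
          0).comp continuous_subtype_val⟩
      map_add' := fun f g => by
        ext u
        exact intervalIntegral.integral_add
          ((f.continuous.Icc_extend' (h := by norm_num)).intervalIntegrable _ _)
          ((g.continuous.Icc_extend' (h := by norm_num)).intervalIntegrable _ _)
      map_smul' := fun c g => by
        ext u
        exact intervalIntegral.integral_smul c _ } 1
    (fun g => by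
      rw [one_mul, ContinuousMap.norm_le _ (norm_nonneg _)]
      intro u
      refine (intervalIntegral.norm_integral_le_of_norm_le_const (C := ‖g‖)
        fun x _ => g.norm_coe_le_norm _).trans ?_
      rw [sub_zero]
      exact mul_le_of_le_one_right (norm_nonneg _) (abs_le.2 u.2))

/-- The constant functions, as a continuous linear map. -/
def constMap (E : Type*) [NormedAddCommGroup E] [NormedSpace ℝ E] :
    E →L[ℝ] C(Icc (-1 : ℝ) 1, E) :=
  LinearMap.mkContinuous
    { toFun := fun z => ContinuousMap.const _ z
      map_add' := fun _ _ => rfl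
      map_smul' := fun _ _ => rfl } 1
    (fun z => by
      rw [one_mul, ContinuousMap.norm_le _ (norm_nonneg _)]
      exact fun _ => le_rfl)

/-- `(τ, z, g) ↦ (τ, z, g - z - τ ∫ V ∘ g)`; the zeros of the last component are the reparametrized
integral curves of `V` starting at `z`. -/
def flowMap (V : C(E, E)) (a : ℝ × E × C(Icc (-1 : ℝ) 1, E)) : ℝ × E × C(Icc (-1 : ℝ) 1, E) :=
  (a.1, a.2.1, a.2.2 - constMap E a.2.1 - a.1 • primitive E (postcomp _ V a.2.2))

theorem contDiff_flowMap {V : E → E} (hV : ContDiff ℝ ∞ V) :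
    ContDiff ℝ ∞ (flowMap ⟨V, hV.continuous⟩) := by
  have h := (primitive E).contDiff.comp
    ((contDiff_postcomp (K := Icc (-1 : ℝ) 1) hV).comp (contDiff_snd.comp contDiff_snd :
      ContDiff ℝ ∞ fun a : ℝ × E × C(Icc (-1 : ℝ) 1, E) => a.2.2))
  exact contDiff_fst.prodMk ((contDiff_fst.comp contDiff_snd).prodMk
    (((contDiff_snd.comp contDiff_snd).sub
      ((constMap E).contDiff.comp (contDiff_fst.comp contDiff_snd))).sub (contDiff_fst.smul h)))

/-- The shear `(τ, z, h) ↦ (τ, z, h - z - τ w)`. -/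
def shear (w : C(Icc (-1 : ℝ) 1, E)) :
    (ℝ × E × C(Icc (-1 : ℝ) 1, E)) ≃L[ℝ] (ℝ × E × C(Icc (-1 : ℝ) 1, E)) :=
  ContinuousLinearEquiv.equivOfInverse
    ((ContinuousLinearMap.fst ℝ _ _).prod
      (((ContinuousLinearMap.fst ℝ _ _).comp (ContinuousLinearMap.snd ℝ _ _)).prod
      ((ContinuousLinearMap.snd ℝ _ _).comp (ContinuousLinearMap.snd ℝ _ _) -
        (constMap E).comp ((ContinuousLinearMap.fst ℝ _ _).comp (ContinuousLinearMap.snd ℝ _ _)) -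
        (ContinuousLinearMap.fst ℝ _ _).smulRight w)))
    ((ContinuousLinearMap.fst ℝ _ _).prod
      (((ContinuousLinearMap.fst ℝ _ _).comp (ContinuousLinearMap.snd ℝ _ _)).prod
      ((ContinuousLinearMap.snd ℝ _ _).comp (ContinuousLinearMap.snd ℝ _ _) +
        (constMap E).comp ((ContinuousLinearMap.fst ℝ _ _).comp (ContinuousLinearMap.snd ℝ _ _)) +
        (ContinuousLinearMap.fst ℝ _ _).smulRight w)))
    (fun a => Prod.ext rfl (Prod.ext rfl (by simp; abel)))
    (fun a => Prod.ext rfl (Prod.ext rfl (by simp; abel)))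

/-- At `τ = 0` the derivative of the nonlinear term is multiplied by `τ` and disappears; only its
value times `dτ` remains. The derivative is therefore a shear, invertible without any smallness
assumption on `V`. -/
theorem hasFDerivAt_flowMap {V : E → E} (hV : ContDiff ℝ ∞ V) (z : E) :
    HasFDerivAt (flowMap ⟨V, hV.continuous⟩)
      (shear (primitive E (postcomp _ ⟨V, hV.continuous⟩ (constMap E z))) :
        (ℝ × E × C(Icc (-1 : ℝ) 1, E)) →L[ℝ] (ℝ × E × C(Icc (-1 : ℝ) 1, E)))
      (0, z, constMap E z) := by
  have h1 : HasFDerivAt (fun a : ℝ × E × C(Icc (-1 : ℝ) 1, E) =>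
      primitive E (postcomp _ ⟨V, hV.continuous⟩ a.2.2)) _ (0, z, constMap E z) :=
    (((primitive E).contDiff.comp
    ((contDiff_postcomp (K := Icc (-1 : ℝ) 1) hV).comp (contDiff_snd.comp contDiff_snd :
      ContDiff ℝ ∞ fun a : ℝ × E × C(Icc (-1 : ℝ) 1, E) => a.2.2))).differentiable
        (by simp) _).hasFDerivAt
  have hf : HasFDerivAt (fun a : ℝ × E × C(Icc (-1 : ℝ) 1, E) => a.1)
    (ContinuousLinearMap.fst ℝ _ _) (0, z, constMap E z) := hasFDerivAt_fst
  have hs : HasFDerivAt (fun a : ℝ × E × C(Icc (-1 : ℝ) 1, E) => a.2)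
    (ContinuousLinearMap.snd ℝ _ _) (0, z, constMap E z) := hasFDerivAt_snd
  have hz := hs.fst
  have hg := hs.snd
  have := hf.prodMk (hz.prodMk ((hg.sub ((constMap E).hasFDerivAt.comp _ hz)).sub (hf.smul h1)))
  refine this.congr_fderiv ?_
  ext a <;> simp [shear]

/-- Existence of smooth local flows. -/
theorem exists_contDiffOn_localFlow {E : Type*} [NormedAddCommGroup E] [NormedSpace ℝ E]
    [FiniteDimensional ℝ E]
    {V : E → E} {O : Set E} (hO : IsOpen O) (hV : ContDiffOn ℝ ∞ V O) {z₀ : E} (hz₀ : z₀ ∈ O) :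
    ∃ δ > 0, ∃ B : Set E, IsOpen B ∧ z₀ ∈ B ∧ ∃ fl : ℝ × E → E,
      ContDiffOn ℝ ∞ fl (Ioo (-δ) δ ×ˢ B) ∧ ∀ z ∈ B, fl (0, z) = z ∧
        ∀ t ∈ Ioo (-δ) δ, fl (t, z) ∈ O ∧
          HasDerivAt (fun s => fl (s, z)) (V (fl (t, z))) t := by
  have : CompleteSpace E := FiniteDimensional.complete ℝ E
  obtain ⟨W, hW, hWV⟩ := exists_contDiff_eventuallyEq hO hV hz₀
  obtain ⟨ρ₀, hρ₀, hball⟩ := Metric.eventually_nhds_iff_ball.1 (hWV.and (hO.mem_nhds hz₀))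
  set Wc : C(E, E) := ⟨W, hW.continuous⟩ with hWc
  obtain ⟨N, L, hN, haN, hL, hLa, hLN, hLe⟩ := exists_contDiffOn_localInverse isOpen_univ
    (contDiff_flowMap hW).contDiffOn (mem_univ (0, z₀, constMap E z₀)) _ (hasFDerivAt_flowMap hW z₀)
  rw [← hWc] at haN hLa hLN hLe
  have hA0 : flowMap Wc (0, z₀, constMap E z₀) = (0, z₀, 0) := by simp [flowMap]
  rw [hA0] at haN hLa
  obtain ⟨ρ₁, hρ₁, hLe⟩ := Metric.eventually_nhds_iff_ball.1 hLe
  set ρ := min ρ₀ ρ₁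
  have hρ : 0 < ρ := lt_min hρ₀ hρ₁
  let ι : ℝ × E → ℝ × E × C(Icc (-1 : ℝ) 1, E) := fun p => (p.1, p.2, 0)
  have hι : ContDiff ℝ ∞ ι := contDiff_fst.prodMk (contDiff_snd.prodMk contDiff_const)
  have hev : ∀ᶠ p in 𝓝 ((0 : ℝ), z₀), ι p ∈ N ∧ L (ι p) ∈ Metric.ball (0, z₀, constMap E z₀) ρ := by
    have h1 : ∀ᶠ p in 𝓝 ((0 : ℝ), z₀), ι p ∈ N :=
      hι.continuous.continuousAt.eventually (hN.mem_nhds haN)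
    have h2 : ContinuousAt (fun p => L (ι p)) ((0 : ℝ), z₀) :=
      ((hL.continuousOn.continuousAt (hN.mem_nhds haN)).comp (f := ι) (x := ((0 : ℝ), z₀))
        hι.continuous.continuousAt)
    refine h1.and (h2.eventually ?_)
    change Metric.ball _ ρ ∈ 𝓝 (L (0, z₀, 0))
    rw [hLa]
    exact Metric.ball_mem_nhds _ hρ
  obtain ⟨d, hd, hev⟩ := Metric.eventually_nhds_iff_ball.1 hev
  have hmem : ∀ t z, |t| < d → dist z z₀ < d → ((t, z) : ℝ × E) ∈ Metric.ball (0, z₀) d := by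
    intro t z ht hz
    rw [Metric.mem_ball, Prod.dist_eq, max_lt_iff]
    exact ⟨by simpa using ht, hz⟩
  -- The local inverse at `(t, z, 0)` is the solution `g` of `g(u) = z + t ∫₀ᵘ W ∘ g`, that is, the
  -- integral curve with time multiplied by `t`.
  have hΓ : ∀ t z, |t| < d → dist z z₀ < d → ∃ g : C(Icc (-1 : ℝ) 1, E),
      L (ι (t, z)) = (t, z, g) ∧ (∀ u, dist (g u) z₀ < ρ) ∧
      ∀ u, g u = z + t • ∫ r in (0 : ℝ)..u, IccExtend (by norm_num) (W ∘ g) r := by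
    intro t z ht hz
    obtain ⟨h1, h2⟩ := hev _ (hmem t z ht hz)
    have h3 := (hLN _ h1).2
    rw [Metric.mem_ball, Prod.dist_eq, Prod.dist_eq, max_lt_iff, max_lt_iff] at h2
    have e1 : (L (ι (t, z))).1 = t := congrArg Prod.fst h3
    have e2 : (L (ι (t, z))).2.1 = z := congrArg (fun a => a.2.1) h3
    have e3 := congrArg (fun a => a.2.2) h3
    refine ⟨(L (ι (t, z))).2.2, Prod.ext e1 (Prod.ext e2 rfl), fun u => ?_, fun u => ?_⟩
    · exact (ContinuousMap.dist_apply_le_dist (g := constMap E z₀) u).trans_lt h2.2.2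
    · have e4 := congrArg (fun f : C(Icc (-1 : ℝ) 1, E) => f u) e3
      simp only [flowMap, e1, e2] at e4
      have e5 : (L (ι (t, z))).2.2 u - z - t • ∫ r in (0 : ℝ)..u,
        IccExtend (by norm_num) (W ∘ (L (ι (t, z))).2.2) r = 0 := e4
      rw [sub_sub, sub_eq_zero] at e5
      exact e5
  -- The function `u ↦ g(su)` solves the equation with `t` replaced by `st`. By local injectivity of
  -- `flowMap` it is the solution found there, so evaluation at `1` for the time `st` is `g(s)`.
  have hscale : ∀ t z, ∀ s : Icc (-1 : ℝ) 1, |t| < d → |t| < ρ → dist z z₀ < d → dist z z₀ < ρ →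
      (L (ι (s * t, z))).2.2 ⟨1, by norm_num⟩ = (L (ι (t, z))).2.2 s := by
    intro t z s ht ht' hz hz'
    obtain ⟨g, hg, hgρ, hge⟩ := hΓ t z ht hz
    have hm : ∀ u : Icc (-1 : ℝ) 1, (s : ℝ) * u ∈ Icc (-1 : ℝ) 1 := fun u => by
      rw [mem_Icc, ← abs_le, abs_mul]
      exact mul_le_one₀ (abs_le.2 s.2) (abs_nonneg _) (abs_le.2 u.2)
    let g' : C(Icc (-1 : ℝ) 1, E) := ⟨fun u => g ⟨s * u, hm u⟩, by fun_prop⟩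
    have hst : |s * t| ≤ |t| := by
      rw [abs_mul]
      exact mul_le_of_le_one_left (abs_nonneg _) (abs_le.2 s.2)
    have hfm : flowMap Wc (s * t, z, g') = ι (s * t, z) := by
      refine Prod.ext rfl (Prod.ext rfl ?_)
      ext u
      change g' u - z - ((s : ℝ) * t) • ∫ r in (0 : ℝ)..u, IccExtend _ (W ∘ g') r = 0
      have e1 : ∫ r in (0 : ℝ)..u, IccExtend (by norm_num) (W ∘ g') r =
          ∫ r in (0 : ℝ)..u, IccExtend (by norm_num) (W ∘ g) (s * r) := by
        refine intervalIntegral.integral_congr fun r hr => ?_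
        have hr' : r ∈ Icc (-1 : ℝ) 1 :=
          (uIcc_subset_Icc (by norm_num : (0 : ℝ) ∈ Icc (-1 : ℝ) 1) u.2) hr
        change IccExtend _ (W ∘ g') r = IccExtend _ (W ∘ g) (s * r)
        rw [IccExtend_of_mem _ _ hr', IccExtend_of_mem _ _ (hm ⟨r, hr'⟩)]
        rfl
      have e2 := intervalIntegral.smul_integral_comp_mul_left
        (IccExtend (by norm_num) (W ∘ g)) (s : ℝ) (a := 0) (b := u)
      rw [mul_zero] at e2
      rw [e1, mul_comm, mul_smul, e2]
      change g ⟨s * u, hm u⟩ - z - _ = 0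
      rw [hge]
      abel
    have hL' : L (flowMap Wc (s * t, z, g')) = (s * t, z, g') := by
      refine hLe _ ?_
      rw [Metric.mem_ball, Prod.dist_eq, Prod.dist_eq, max_lt_iff, max_lt_iff]
      refine ⟨?_, hz'.trans_le (min_le_right _ _), ?_⟩
      · rw [dist_zero_right, Real.norm_eq_abs]
        exact hst.trans_lt (ht'.trans_le (min_le_right _ _))
      · refine lt_of_lt_of_le ?_ (min_le_right ρ₀ ρ₁)
        rw [ContinuousMap.dist_lt_iff hρ]
        exact fun u => hgρ _
    rw [hfm] at hL'
    rw [hL', hg]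
    change g ⟨s * 1, _⟩ = g s
    congr 1
    ext
    simp
  -- The flow on `[-δ, δ]` is read from the single curve `g` with parameter `δ`, as `t ↦ g(t/δ)`.
  -- Hence `δ` itself has to lie strictly inside the admissible range.
  set δ := min d ρ / 2 with hδ
  have hδ0 : 0 < δ := by have := lt_min hd hρ; positivity
  have hδd : δ < min d ρ := by have := lt_min hd hρ; linarith
  refine ⟨δ, hδ0, Metric.ball z₀ (min d ρ), Metric.isOpen_ball,
    Metric.mem_ball_self (lt_min hd hρ), fun p => (L (ι p)).2.2 ⟨1, by norm_num⟩, ?_, ?_⟩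
  · have : ContDiffOn ℝ ∞ (fun p => L (ι p)) (Ioo (-δ) δ ×ˢ Metric.ball z₀ (min d ρ)) := by
      refine hL.comp hι.contDiffOn fun p hp => (hev _ ?_).1
      exact hmem p.1 p.2 ((abs_lt.2 hp.1).trans (hδd.trans_le (min_le_left _ _)))
        (lt_of_lt_of_le hp.2 (min_le_left _ _))
    exact (ContinuousMap.evalCLM ℝ (⟨1, by norm_num⟩ : Icc (-1 : ℝ) 1)).contDiff.comp_contDiffOn
      (contDiff_snd.comp_contDiffOn (contDiff_snd.comp_contDiffOn this))
  · intro z hz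
    have hz1 : dist z z₀ < d := lt_of_lt_of_le hz (min_le_left _ _)
    have hz2 : dist z z₀ < ρ := lt_of_lt_of_le hz (min_le_right _ _)
    have hδa : |δ| < min d ρ := by rwa [abs_of_pos hδ0]
    obtain ⟨g, hg, hgρ, hge⟩ := hΓ δ z (hδa.trans_le (min_le_left _ _)) hz1
    have hfl : ∀ t ∈ Icc (-δ) δ, ∃ hs : t / δ ∈ Icc (-1 : ℝ) 1,
        (L (ι (t, z))).2.2 ⟨1, by norm_num⟩ = g ⟨t / δ, hs⟩ := by
      intro t ht
      have hs : t / δ ∈ Icc (-1 : ℝ) 1 := by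
        rw [mem_Icc, ← abs_le, abs_div, abs_of_pos hδ0, div_le_one hδ0]
        exact abs_le.2 ht
      refine ⟨hs, ?_⟩
      have := hscale δ z ⟨t / δ, hs⟩ (hδa.trans_le (min_le_left _ _))
        (hδa.trans_le (min_le_right _ _)) hz1 hz2
      rw [hg] at this
      simpa [div_mul_cancel₀ _ hδ0.ne'] using this
    refine ⟨?_, fun t ht => ?_⟩
    · obtain ⟨hs, h⟩ := hfl 0 ⟨by linarith, hδ0.le⟩
      refine h.trans ?_
      rw [hge]
      simp
    · obtain ⟨hs, h⟩ := hfl t ⟨ht.1.le, ht.2.le⟩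
      have hin := hball (g ⟨t / δ, hs⟩) (lt_of_lt_of_le (hgρ _) (min_le_left _ _))
      change (L (ι (t, z))).2.2 ⟨1, by norm_num⟩ ∈ O ∧ HasDerivAt _ (V ((L (ι (t, z))).2.2
        ⟨1, by norm_num⟩)) t
      rw [h]
      refine ⟨hin.2, ?_⟩
      rw [← hin.1]
      have hc : Continuous (IccExtend (by norm_num : (-1 : ℝ) ≤ 1) (W ∘ g)) :=
        (hW.continuous.comp g.continuous).Icc_extend'
      have h1 := intervalIntegral.integral_hasDerivAt_right (hc.intervalIntegrable 0 (t / δ))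
        (hc.stronglyMeasurableAtFilter _ _) hc.continuousAt
      have h2 : HasDerivAt (fun s : ℝ => s / δ) (1 / δ) t := (hasDerivAt_id t).div_const δ
      have h3 := ((h1.scomp t h2).const_smul δ).const_add z
      rw [smul_smul, mul_one_div_cancel hδ0.ne', one_smul, IccExtend_of_mem _ _ hs] at h3
      refine h3.congr_of_eventuallyEq ?_
      filter_upwards [Ioo_mem_nhds ht.1 ht.2] with s hs'
      obtain ⟨hs'', h'⟩ := hfl s ⟨hs'.1.le, hs'.2.le⟩
      rw [h', hge]
      rfl

end Flow

/-! ### Vector fields and curves in charts -/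

section Charts

variable {E : Type*} [NormedAddCommGroup E] [NormedSpace ℝ E]
  {H : Type*} [TopologicalSpace H] {J : ModelWithCorners ℝ E H}
  {N : Type*} [TopologicalSpace N] [ChartedSpace H N] [IsManifold J ∞ N]

variable (J) in
/-- The components in the chart at `p` of the vector field `V`. -/
def chartField (V : ∀ v : N, TangentSpace J v) (p : N) (z : E) : E :=
  let q := (extChartAt J p).symm z
  tangentCoordChange J q p q (V q)

theorem contMDiffWithinAt_field_iff {V : ∀ v : N, TangentSpace J v} {s : Set N} {p : N} :
    ContMDiffWithinAt J J.tangent ∞ (fun v => (⟨v, V v⟩ : TangentBundle J N)) s p ↔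
      ContMDiffWithinAt J 𝓘(ℝ, E) ∞ (fun q => (tangentCoordChange J q p q (V q) : E)) s p :=
  Bundle.contMDiffWithinAt_section (F := E) (E := (TangentSpace J : N → Type _))

theorem contMDiffAt_field_iff {V : ∀ v : N, TangentSpace J v} {p : N} :
    ContMDiffAt J J.tangent ∞ (fun v => (⟨v, V v⟩ : TangentBundle J N)) p ↔
      ContMDiffAt J 𝓘(ℝ, E) ∞ (fun q => (tangentCoordChange J q p q (V q) : E)) p :=
  Bundle.contMDiffAt_section (F := E) (E := (TangentSpace J : N → Type _)) _

theorem contMDiffOn_field_chart {V : ∀ v : N, TangentSpace J v} {s : Set N}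
    (hV : ContMDiffOn J J.tangent ∞ (fun v => (⟨v, V v⟩ : TangentBundle J N)) s) (p : N) :
    ContMDiffOn J 𝓘(ℝ, E) ∞ (fun q => (tangentCoordChange J q p q (V q) : E))
      (s ∩ (extChartAt J p).source) := by
  have h := (Bundle.Trivialization.contMDiffOn_iff (n := ∞) (IB := J) (IM := J)
    (e := trivializationAt E (TangentSpace J : N → Type _) p)
    (f := fun v => (⟨v, V v⟩ : TangentBundle J N)) (s := s ∩ (extChartAt J p).source)
    (fun q hq => by
      have := hq.2
      rw [extChartAt_source] at this
      exact (Bundle.Trivialization.mem_source _).2 this)).1 (hV.mono inter_subset_left)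
  exact h.2

theorem contDiffOn_chartField [J.Boundaryless] {V : ∀ v : N, TangentSpace J v} {U : Set N}
    (hV : ContMDiffOn J J.tangent ∞ (fun v => (⟨v, V v⟩ : TangentBundle J N)) U)
    (p : N) : ContDiffOn ℝ ∞ (chartField J V p)
      ((extChartAt J p).target ∩ (extChartAt J p).symm ⁻¹' U) := by
  rw [← contMDiffOn_iff_contDiffOn]
  refine (contMDiffOn_field_chart hV p).comp
    ((contMDiffOn_extChartAt_symm (I := J) (n := ∞) p).mono inter_subset_left) fun z hz => ?_
  exact ⟨hz.2, (extChartAt J p).map_target hz.1⟩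

theorem tangentCoordChange_tangentCoordChange_self {p q : N} (hq : q ∈ (extChartAt J p).source)
    (w : E) : tangentCoordChange J p q q (tangentCoordChange J q p q w) = w := by
  have : IsManifold J 1 N := .of_le (n := ∞) (by simp)
  rw [tangentCoordChange_comp ⟨⟨mem_extChartAt_source _, hq⟩, mem_extChartAt_source _⟩,
    tangentCoordChange_self (mem_extChartAt_source _)]

/-- A tangent vector at `q` is stored by its components in the chart at `q`, so the derivative of
the chart at `p` is the coordinate change from `q` to `p`. -/
theorem hasMFDerivAt_extChartAt_tangentCoordChange [J.Boundaryless] {p q : N}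
    (hq : q ∈ (extChartAt J p).source) :
    HasMFDerivAt J 𝓘(ℝ, E) (extChartAt J p) q (tangentCoordChange J q p q : E →L[ℝ] E) := by
  have : IsManifold J 1 N := .of_le (n := ∞) (by simp)
  have h := hasFDerivWithinAt_tangentCoordChange (I := J) (x := q) (y := p)
    ⟨mem_extChartAt_source q, hq⟩
  exact ⟨continuousAt_extChartAt' hq, h⟩

theorem hasMFDerivAt_extChartAt_symm [J.Boundaryless] {p : N} {z : E}
    (hz : z ∈ (extChartAt J p).target) :
    HasMFDerivAt 𝓘(ℝ, E) J (extChartAt J p).symm z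
      (tangentCoordChange J p ((extChartAt J p).symm z) ((extChartAt J p).symm z) : E →L[ℝ] E) := by
  have : IsManifold J 1 N := .of_le (n := ∞) (by simp)
  have h := hasFDerivWithinAt_tangentCoordChange (I := J) (x := p)
    (y := (extChartAt J p).symm z) ⟨(extChartAt J p).map_target hz, mem_extChartAt_source _⟩
  rw [J.range_eq_univ, (extChartAt J p).right_inv hz] at h
  refine ⟨continuousAt_extChartAt_symm'' hz, ?_⟩
  have e : range 𝓘(ℝ, E) = univ := ModelWithCorners.Boundaryless.range_eq_univ
  rw [e]
  exact h

theorem hasMFDerivAt_symm_comp [J.Boundaryless] {p : N} {f : ℝ → E} {t : ℝ} {w : E}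
    (hf : HasDerivAt f w t) (ht : f t ∈ (extChartAt J p).target) :
    HasMFDerivAt 𝓘(ℝ, ℝ) J (fun s => (extChartAt J p).symm (f s)) t
      ((1 : ℝ →L[ℝ] ℝ).smulRight (tangentCoordChange J p ((extChartAt J p).symm (f t))
        ((extChartAt J p).symm (f t)) w)) := by
  refine ((hasMFDerivAt_extChartAt_symm ht).comp t hf.hasFDerivAt.hasMFDerivAt).congr_mfderiv ?_
  ext
  change tangentCoordChange J p _ _ ((1 : ℝ) • w) = (1 : ℝ) • tangentCoordChange J p _ _ w
  rw [one_smul, one_smul]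

theorem hasDerivAt_extChartAt_comp [J.Boundaryless] {p : N} {γ : ℝ → N} {t : ℝ}
    {w : TangentSpace J (γ t)}
    (hγ : HasMFDerivAt 𝓘(ℝ, ℝ) J γ t ((1 : ℝ →L[ℝ] ℝ).smulRight w))
    (ht : γ t ∈ (extChartAt J p).source) :
    HasDerivAt (fun s => extChartAt J p (γ s)) (tangentCoordChange J (γ t) p (γ t) w : E) t := by
  have h2 : HasFDerivAt (fun s => extChartAt J p (γ s))
      (((1 : ℝ →L[ℝ] ℝ).smulRight (tangentCoordChange J (γ t) p (γ t) w : E))) t := by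
    refine (((hasMFDerivAt_extChartAt_tangentCoordChange ht).comp t hγ).congr_mfderiv ?_).hasFDerivAt
    ext
    change tangentCoordChange J (γ t) p (γ t) ((1 : ℝ) • (w : E)) =
      (1 : ℝ) • (tangentCoordChange J (γ t) p (γ t) w : E)
    rw [one_smul, one_smul]
  simpa using h2.hasDerivAt

end Charts

/-! ### The flow of a smooth vector field on an open subset of a manifold -/

section Flow

variable {E : Type*} [NormedAddCommGroup E] [NormedSpace ℝ E]
  {H : Type*} [TopologicalSpace H] {J : ModelWithCorners ℝ E H}
  {N : Type*} [TopologicalSpace N] [ChartedSpace H N]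

/-- `fl` is a smooth flow of `V` in `U` for times in `(-δ, δ)` and initial points in `B`. -/
structure IsLocalFlow (V : ∀ v : N, TangentSpace J v) (U : Set N) (δ : ℝ) (B : Set N)
    (fl : ℝ × N → N) : Prop where
  smooth : ContMDiffOn (𝓘(ℝ, ℝ).prod J) J ∞ fl (Ioo (-δ) δ ×ˢ B)
  init : ∀ w ∈ B, fl (0, w) = w
  mem : ∀ w ∈ B, ∀ t ∈ Ioo (-δ) δ, fl (t, w) ∈ U
  curve : ∀ w ∈ B, ∀ t ∈ Ioo (-δ) δ, HasMFDerivAt 𝓘(ℝ, ℝ) J (fun s => fl (s, w)) t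
    ((1 : ℝ →L[ℝ] ℝ).smulRight (V (fl (t, w))))

/-- Times and initial points for which there is a smooth local flow. -/
def flowDomain (V : ∀ v : N, TangentSpace J v) (U : Set N) : Set (ℝ × N) :=
  {p | ∃ (δ : ℝ) (B : Set N) (fl : ℝ × N → N), |p.1| < δ ∧ IsOpen B ∧ p.2 ∈ B ∧
    IsLocalFlow V U δ B fl}

open Classical in
/-- The flow of `V` in `U`. -/
def flow (V : ∀ v : N, TangentSpace J v) (U : Set N) (p : ℝ × N) : N :=
  if h : p ∈ flowDomain V U then h.choose_spec.choose_spec.choose p else p.2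

variable {V : ∀ v : N, TangentSpace J v} {U : Set N}

theorem isOpen_flowDomain : IsOpen (flowDomain V U) := by
  rw [isOpen_iff_mem_nhds]
  rintro ⟨t, v⟩ ⟨δ, B, fl, ht, hB, hv, h⟩
  have h1 : {p : ℝ × N | |p.1| < δ ∧ p.2 ∈ B} ∈ 𝓝 (t, v) :=
    ((isOpen_lt (continuous_abs.comp continuous_fst) continuous_const).inter
      (hB.preimage continuous_snd)).mem_nhds ⟨ht, hv⟩
  exact mem_of_superset h1 fun p hp => ⟨δ, B, fl, hp.1, hB, hp.2, h⟩

theorem flowDomain_mono {t s : ℝ} {v : N} (h : (t, v) ∈ flowDomain V U) (hs : |s| ≤ |t|) :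
    (s, v) ∈ flowDomain V U := by
  obtain ⟨δ, B, fl, ht, h⟩ := h
  exact ⟨δ, B, fl, hs.trans_lt ht, h⟩

variable [IsManifold J ∞ N] [J.Boundaryless]

theorem zero_mem_flowDomain [FiniteDimensional ℝ E] (hU : IsOpen U)
    (hV : ContMDiffOn J J.tangent ∞ (fun v => (⟨v, V v⟩ : TangentBundle J N)) U) {v : N}
    (hv : v ∈ U) : (0, v) ∈ flowDomain V U := by
  have hO : IsOpen ((extChartAt J v).target ∩ (extChartAt J v).symm ⁻¹' U) :=
    (continuousOn_extChartAt_symm v).isOpen_inter_preimage (isOpen_extChartAt_target v) hU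
  obtain ⟨δ, hδ, B, hB, hvB, fl, hfl, h⟩ := exists_contDiffOn_localFlow hO
    (contDiffOn_chartField hV v) (z₀ := extChartAt J v v) ⟨mem_extChartAt_target v, by
      rwa [mem_preimage, extChartAt_to_inv]⟩
  refine ⟨δ, (extChartAt J v).source ∩ extChartAt J v ⁻¹' B,
    fun p => (extChartAt J v).symm (fl (p.1, extChartAt J v p.2)), by simpa using hδ,
    (continuousOn_extChartAt v).isOpen_inter_preimage (isOpen_extChartAt_source v) hB,
    ⟨mem_extChartAt_source v, hvB⟩, ?_, ?_, ?_, ?_⟩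
  · have h1 : ContMDiffOn (𝓘(ℝ, ℝ).prod J) 𝓘(ℝ, ℝ × E) ∞
        (fun p : ℝ × N => (p.1, extChartAt J v p.2))
        (Ioo (-δ) δ ×ˢ ((extChartAt J v).source ∩ extChartAt J v ⁻¹' B)) := by
      refine ContMDiffOn.prodMk_space contMDiffOn_fst ?_
      refine (contMDiffOn_extChartAt (I := J) (n := ∞) (x := v)).comp contMDiffOn_snd fun p hp => ?_
      have := hp.2.1
      rwa [extChartAt_source] at this
    have h2 := (contMDiffOn_iff_contDiffOn.2 hfl).comp h1 fun p hp => ⟨hp.1, hp.2.2⟩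
    exact (contMDiffOn_extChartAt_symm v).comp h2 fun p hp => ((h _ hp.2.2).2 _ hp.1).1.1
  · intro w hw
    change (extChartAt J v).symm (fl (0, extChartAt J v w)) = w
    rw [(h _ hw.2).1, (extChartAt J v).left_inv hw.1]
  · intro w hw t ht
    exact ((h _ hw.2).2 _ ht).1.2
  · intro w hw t ht
    obtain ⟨h1, h2⟩ := (h _ hw.2).2 _ ht
    have h3 := hasMFDerivAt_symm_comp h2 h1.1
    exact h3.congr_mfderiv (congrArg (ContinuousLinearMap.smulRight (1 : ℝ →L[ℝ] ℝ))
      (tangentCoordChange_tangentCoordChange_self ((extChartAt J v).map_target h1.1) _))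

/-- The coincidence set is closed since `N` is Hausdorff, and open by local uniqueness at the common
value; the interval is connected. Only one of the curves is required to stay in `U`, as the field is
examined only where the two meet. -/
theorem eqOn_Ioo_of_integralCurve [T2Space N] {a b t₀ : ℝ} {γ γ' : ℝ → N}
    (hU : IsOpen U)
    (hV : ContMDiffOn J J.tangent ∞ (fun v => (⟨v, V v⟩ : TangentBundle J N)) U)
    (ht₀ : t₀ ∈ Ioo a b) (hγU : ∀ t ∈ Ioo a b, γ t ∈ U)
    (hγ : ∀ t ∈ Ioo a b, HasMFDerivAt 𝓘(ℝ, ℝ) J γ t ((1 : ℝ →L[ℝ] ℝ).smulRight (V (γ t))))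
    (hγ' : ∀ t ∈ Ioo a b, HasMFDerivAt 𝓘(ℝ, ℝ) J γ' t ((1 : ℝ →L[ℝ] ℝ).smulRight (V (γ' t))))
    (h : γ t₀ = γ' t₀) : EqOn γ γ' (Ioo a b) := by
  have : IsManifold J 1 N := .of_le (n := ∞) (by simp)
  set s := {t | γ t = γ' t} ∩ Ioo a b with hs
  suffices hsub : Ioo a b ⊆ s from fun t ht => (hsub ht).1
  apply isPreconnected_Ioo.subset_of_closure_inter_subset (s := Ioo a b) (u := s) _
    ⟨t₀, ⟨ht₀, ⟨h, ht₀⟩⟩⟩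
  · rintro t ⟨ht, ht'⟩
    refine ⟨?_, ht'⟩
    have hmem : (t : ℝ) ∈ closure s := ht
    have hne : (𝓝[s] t).NeBot := mem_closure_iff_nhdsWithin_neBot.1 hmem
    have h1 : Tendsto γ (𝓝[s] t) (𝓝 (γ t)) := (hγ t ht').continuousAt.mono_left nhdsWithin_le_nhds
    have h2 : Tendsto γ' (𝓝[s] t) (𝓝 (γ' t)) :=
      (hγ' t ht').continuousAt.mono_left nhdsWithin_le_nhds
    refine tendsto_nhds_unique h1 (h2.congr' ?_)
    filter_upwards [self_mem_nhdsWithin] with r hr using hr.1.symm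
  · rw [isOpen_iff_mem_nhds]
    intro t₁ ht₁
    have hmem := Ioo_mem_nhds ht₁.2.1 ht₁.2.2
    have hv : ContMDiffAt J J.tangent 1 (fun v => (⟨v, V v⟩ : TangentBundle J N)) (γ t₁) :=
      (hV.contMDiffAt (hU.mem_nhds (hγU _ ht₁.2))).of_le (by simp)
    have heq : γ =ᶠ[𝓝 t₁] γ' := isMIntegralCurveAt_eventuallyEq_of_contMDiffAt
      BoundarylessManifold.isInteriorPoint hv
      (by filter_upwards [hmem] with t ht using hγ t ht)
      (by filter_upwards [hmem] with t ht using hγ' t ht) ht₁.1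
    filter_upwards [heq, hmem] with t h1 h2 using ⟨h1, h2⟩

variable [T2Space N] (hU : IsOpen U)
  (hV : ContMDiffOn J J.tangent ∞ (fun v => (⟨v, V v⟩ : TangentBundle J N)) U)
include hU hV

theorem IsLocalFlow.eq {δ δ' : ℝ} {B B' : Set N} {fl fl' : ℝ × N → N} {t : ℝ} {w : N}
    (h : IsLocalFlow V U δ B fl) (h' : IsLocalFlow V U δ' B' fl') (ht : |t| < δ) (ht' : |t| < δ')
    (hw : w ∈ B) (hw' : w ∈ B') : fl (t, w) = fl' (t, w) := by
  have hm : 0 < min δ δ' := lt_min ((abs_nonneg t).trans_lt ht) ((abs_nonneg t).trans_lt ht')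
  have h1 : Ioo (-min δ δ') (min δ δ') ⊆ Ioo (-δ) δ :=
    Ioo_subset_Ioo (neg_le_neg (min_le_left _ _)) (min_le_left _ _)
  have h2 : Ioo (-min δ δ') (min δ δ') ⊆ Ioo (-δ') δ' :=
    Ioo_subset_Ioo (neg_le_neg (min_le_right _ _)) (min_le_right _ _)
  exact eqOn_Ioo_of_integralCurve hU hV (t₀ := 0) (γ := fun s => fl (s, w))
    (γ' := fun s => fl' (s, w)) ⟨by linarith, hm⟩
    (fun s hs => h.mem w hw s (h1 hs)) (fun s hs => h.curve w hw s (h1 hs))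
    (fun s hs => h'.curve w hw' s (h2 hs))
    ((h.init w hw).trans (h'.init w hw').symm) (abs_lt.1 (lt_min ht ht'))

/-- The arbitrary choice in the definition of `flow` is harmless, since two local flows agree by
uniqueness of integral curves. Every property of `flow` is transferred from a local flow through
this equality. -/
theorem flow_eq {δ : ℝ} {B : Set N} {fl : ℝ × N → N} {t : ℝ} {w : N} (hB : IsOpen B)
    (h : IsLocalFlow V U δ B fl) (ht : |t| < δ) (hw : w ∈ B) : flow V U (t, w) = fl (t, w) := by
  have hmem : (t, w) ∈ flowDomain V U := ⟨δ, B, fl, ht, hB, hw, h⟩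
  rw [flow, dif_pos hmem]
  obtain ⟨h1, h2, h3, h4⟩ := hmem.choose_spec.choose_spec.choose_spec
  exact IsLocalFlow.eq hU hV h4 h h1 ht h3 hw

theorem contMDiffOn_flow :
    ContMDiffOn (𝓘(ℝ, ℝ).prod J) J ∞ (flow V U) (flowDomain V U) := by
  rintro ⟨t, v⟩ ⟨δ, B, fl, ht, hB, hv, h⟩
  have ho : IsOpen (Ioo (-δ) δ ×ˢ B) := isOpen_Ioo.prod hB
  have hm : (t, v) ∈ Ioo (-δ) δ ×ˢ B := ⟨abs_lt.1 ht, hv⟩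
  refine ((h.smooth.contMDiffAt (ho.mem_nhds hm)).congr_of_eventuallyEq ?_).contMDiffWithinAt
  filter_upwards [ho.mem_nhds hm] with p hp
  exact flow_eq hU hV hB h (abs_lt.2 hp.1) hp.2

theorem flow_mem {p : ℝ × N} (hp : p ∈ flowDomain V U) : flow V U p ∈ U := by
  obtain ⟨δ, B, fl, ht, hB, hv, h⟩ := hp
  rw [← Prod.eta p, flow_eq hU hV hB h ht hv]
  exact h.mem _ hv _ (abs_lt.1 ht)

theorem hasMFDerivAt_flow {t : ℝ} {v : N} (hp : (t, v) ∈ flowDomain V U) :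
    HasMFDerivAt 𝓘(ℝ, ℝ) J (fun s => flow V U (s, v)) t
      ((1 : ℝ →L[ℝ] ℝ).smulRight (V (flow V U (t, v)))) := by
  obtain ⟨δ, B, fl, ht, hB, hv, h⟩ := hp
  rw [flow_eq hU hV hB h ht hv]
  refine (h.curve _ hv _ (abs_lt.1 ht)).congr_of_eventuallyEq ?_
  filter_upwards [Ioo_mem_nhds (abs_lt.1 ht).1 (abs_lt.1 ht).2] with s hs
  exact flow_eq hU hV hB h (abs_lt.2 hs) hv

omit [IsManifold J ∞ N] [J.Boundaryless] [T2Space N] hU hV in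
theorem exists_Ioo_flowDomain {t : ℝ} {v : N} (hp : (t, v) ∈ flowDomain V U) :
    ∃ δ, |t| < δ ∧ ∀ s ∈ Ioo (-δ) δ, (s, v) ∈ flowDomain V U := by
  obtain ⟨δ, B, fl, ht, hB, hv, h⟩ := hp
  exact ⟨δ, ht, fun s hs => ⟨δ, B, fl, abs_lt.2 hs, hB, hv, h⟩⟩

theorem flow_zero [FiniteDimensional ℝ E] {v : N} (hv : v ∈ U) : flow V U (0, v) = v := by
  obtain ⟨δ, B, fl, ht, hB, hv, h⟩ := zero_mem_flowDomain hU hV hv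
  rw [flow_eq hU hV hB h ht hv]
  exact h.init _ hv

/-- The curves `s ↦ Fl(s + t, v)` and `s ↦ Fl(s, Fl(t, v))` are integral curves which agree at `s =
0`; evaluation at `s = -t` gives the claim. The interval in the proof is the common domain of the
two, and it contains both `0` and `-t`. -/
theorem flow_neg_flow [FiniteDimensional ℝ E] {t : ℝ} {v : N} (hv : v ∈ U)
    (hp : (t, v) ∈ flowDomain V U) (hp' : (-t, flow V U (t, v)) ∈ flowDomain V U) :
    flow V U (-t, flow V U (t, v)) = v := by
  obtain ⟨δ, hδ, h⟩ := exists_Ioo_flowDomain hp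
  obtain ⟨δ', hδ', h'⟩ := exists_Ioo_flowDomain hp'
  rw [abs_neg] at hδ'
  have hd := abs_lt.1 hδ
  have hd' := abs_lt.1 hδ'
  have hsub : Ioo (max (-δ - t) (-δ')) (min (δ - t) δ') ⊆ {s | s + t ∈ Ioo (-δ) δ} := by
    intro s hs
    rw [mem_Ioo, max_lt_iff, lt_min_iff] at hs
    exact ⟨by linarith, by linarith⟩
  have hsub' : Ioo (max (-δ - t) (-δ')) (min (δ - t) δ') ⊆ Ioo (-δ') δ' :=
    Ioo_subset_Ioo (le_max_right _ _) (min_le_right _ _)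
  have key := eqOn_Ioo_of_integralCurve hU hV (t₀ := 0) (γ := fun s => flow V U (s + t, v))
    (γ' := fun s => flow V U (s, flow V U (t, v))) (a := max (-δ - t) (-δ'))
    (b := min (δ - t) δ')
    ⟨max_lt (by linarith) (by linarith), lt_min (by linarith) (by linarith)⟩
    (fun s hs => flow_mem hU hV (h _ (hsub hs)))
    (fun s hs => by
      have h1 := hasMFDerivAt_flow hU hV (h _ (hsub hs))
      have h2 : HasMFDerivAt 𝓘(ℝ, ℝ) 𝓘(ℝ, ℝ) (fun s : ℝ => s + t) s
        (ContinuousLinearMap.id ℝ ℝ) := ((hasFDerivAt_id s).add_const t).hasMFDerivAt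
      have h3 := HasMFDerivAt.comp s h1 h2
      exact h3)
    (fun s hs => hasMFDerivAt_flow hU hV (h' _ (hsub' hs)))
    (by
      rw [zero_add, flow_zero hU hV (flow_mem hU hV hp)])
  have := key (x := -t) ⟨max_lt (by linarith) (by linarith), lt_min (by linarith) (by linarith)⟩
  change flow V U (-t + t, v) = flow V U (-t, flow V U (t, v)) at this
  rw [← this, neg_add_cancel, flow_zero hU hV hv]

end Flow

/-- Vectors over different points are separated in the base; vectors over the same point lie in one
trivialization and are separated there. This is what uniqueness of integral curves in the tangent
bundle requires. -/
instance tangentBundle_t2Space {E : Type*} [NormedAddCommGroup E] [NormedSpace ℝ E]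
    {H : Type*} [TopologicalSpace H] (J : ModelWithCorners ℝ E H)
    {N : Type*} [TopologicalSpace N] [ChartedSpace H N] [IsManifold J 1 N] [T2Space N] :
    T2Space (TangentBundle J N) := by
  refine ⟨fun a b hab => ?_⟩
  by_cases h : a.proj = b.proj
  · set e := trivializationAt E (TangentSpace J : N → Type _) b.proj
    have hb : b ∈ e.source := FiberBundle.mem_trivializationAt_proj_source
    have ha : a ∈ e.source := by
      rw [e.mem_source, h]
      exact FiberBundle.mem_baseSet_trivializationAt' _
    obtain ⟨u, v, hu, hv, hau, hbv, huv⟩ :=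
      t2_separation fun hh => hab (e.injOn ha hb hh)
    refine ⟨e.source ∩ e ⁻¹' u, e.source ∩ e ⁻¹' v,
      e.continuousOn.isOpen_inter_preimage e.open_source hu,
      e.continuousOn.isOpen_inter_preimage e.open_source hv, ⟨ha, hau⟩, ⟨hb, hbv⟩, ?_⟩
    exact (huv.preimage e).mono inter_subset_right inter_subset_right
  · exact separated_by_continuous (FiberBundle.continuous_proj E _) h

/-! ### Mixed derivatives of commutator-like families -/

section Mixed

variable {E F : Type*} [NormedAddCommGroup E] [NormedSpace ℝ E] [NormedAddCommGroup F]
  [NormedSpace ℝ F]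

/-- Appending a last coordinate `0`. -/
def snocZero (k : ℕ) : (Fin k → ℝ) →L[ℝ] (Fin (k + 1) → ℝ) :=
  LinearMap.toContinuousLinearMap
    { toFun := fun t => Fin.snoc (α := fun _ => ℝ) t 0
      map_add' := fun s t => by
        ext i
        refine Fin.lastCases ?_ (fun j => ?_) i <;> simp
      map_smul' := fun c t => by
        ext i
        refine Fin.lastCases ?_ (fun j => ?_) i <;> simp }

theorem snocZero_apply {k : ℕ} (t : Fin k → ℝ) :
    snocZero k t = Fin.snoc (α := fun _ => ℝ) t 0 := rfl

theorem snocZero_single {k : ℕ} (i : Fin k) :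
    snocZero k (Pi.single i 1) = Pi.single i.castSucc 1 := by
  ext j
  rw [snocZero_apply]
  refine Fin.lastCases ?_ (fun j => ?_) j
  · rw [Fin.snoc_last, Pi.single_eq_of_ne (Fin.castSucc_lt_last i).ne']
  · rw [Fin.snoc_castSucc]
    by_cases h : j = i
    · subst h; simp
    · rw [Pi.single_eq_of_ne h, Pi.single_eq_of_ne (fun hh => h (Fin.castSucc_injective _ hh))]

theorem snoc_eq_snocZero_add {k : ℕ} (t : Fin k → ℝ) (s : ℝ) :
    Fin.snoc (α := fun _ => ℝ) t s = snocZero k t + s • Pi.single (Fin.last k) 1 := by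
  ext j
  rw [snocZero_apply]
  refine Fin.lastCases ?_ (fun j => ?_) j
  · simp
  · simp

/-- Splitting off the derivative in the last variable lowers the order of a mixed derivative by one.
It drives the induction on `k`, and later lets the flow time be differentiated before the other
parameters. -/
theorem iteratedFDeriv_single_snoc {k : ℕ} {f : (Fin (k + 1) → ℝ) → F} (hf : ContDiff ℝ ∞ f)
    (t : Fin k → ℝ) (s : ℝ) :
    iteratedFDeriv ℝ (k + 1) f (Fin.snoc (α := fun _ => ℝ) t s) (fun i => Pi.single i 1) =
      iteratedFDeriv ℝ k (fun t' => fderiv ℝ f (Fin.snoc (α := fun _ => ℝ) t' s)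
        (Pi.single (Fin.last k) 1)) t (fun i => Pi.single i 1) := by
  have h1 : ContDiff ℝ ∞ (fun y => fderiv ℝ f y (Pi.single (Fin.last k) 1)) :=
    ((contDiff_infty_iff_fderiv.1 hf).2).clm_apply contDiff_const
  rw [iteratedFDeriv_succ_apply_right, ← iteratedFDeriv_clm_apply_const_apply
    ((contDiff_infty_iff_fderiv.1 hf).2) (by exact_mod_cast le_top)]
  have e : (fun t' => fderiv ℝ f (Fin.snoc (α := fun _ => ℝ) t' s) (Pi.single (Fin.last k) 1)) =
      (fun y => fderiv ℝ f (y + s • Pi.single (Fin.last k) 1) (Pi.single (Fin.last k) 1)) ∘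
        snocZero k := by
    ext t'
    simp only [Function.comp, snoc_eq_snocZero_add t']
  have h2 : ContDiff ℝ ∞ (fun y => fderiv ℝ f (y + s • Pi.single (Fin.last k) 1)
      (Pi.single (Fin.last k) 1)) := h1.comp (contDiff_id.add contDiff_const)
  rw [e, (snocZero k).iteratedFDeriv_comp_right h2 t (i := k) (by exact_mod_cast le_top)]
  rw [ContinuousMultilinearMap.compContinuousLinearMap_apply,
    iteratedFDeriv_comp_add_right (f := fun y => fderiv ℝ f y (Pi.single (Fin.last k) 1)),
    ← snoc_eq_snocZero_add]
  congr 1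
  ext1 i
  rw [snocZero_single]
  rfl

/-- A function vanishing whenever some coordinate vanishes is comparable to the product of the
coordinates. -/
theorem norm_sub_prod_smul_le {k : ℕ} : ∀ {f : (Fin k → ℝ) → F} (_ : ContDiff ℝ ∞ f) {r C : ℝ}
    {m : F} (_ : ∀ t : Fin k → ℝ, (∀ i, |t i| < r) → (∃ j, t j = 0) → f t = 0)
    (_ : ∀ t : Fin k → ℝ, (∀ i, |t i| < r) →
      ‖iteratedFDeriv ℝ k f t (fun i => Pi.single i 1) - m‖ ≤ C)
    (t : Fin k → ℝ) (_ : ∀ i, |t i| < r), ‖f t - (∏ i, t i) • m‖ ≤ C * |∏ i, t i| := by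
  induction k with
  | zero =>
    intro f hf r C m h0 hC t ht
    simpa using hC t ht
  | succ k ih =>
    intro f hf r C m h0 hC T hT
    obtain ⟨t, s, rfl⟩ : ∃ (t : Fin k → ℝ) (s : ℝ), T = Fin.snoc (α := fun _ => ℝ) t s :=
      ⟨Fin.init T, T (Fin.last k), (Fin.snoc_init_self T).symm⟩
    have hmem : ∀ (t : Fin k → ℝ) (s : ℝ), (∀ i, |t i| < r) → |s| < r →
        ∀ i, |Fin.snoc (α := fun _ => ℝ) t s i| < r := by
      intro t s ht hs i
      refine Fin.lastCases ?_ (fun j => ?_) i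
      · simpa using hs
      · simpa using ht j
    have ht : ∀ i, |t i| < r := fun i => by simpa using hT i.castSucc
    have hs : |s| < r := by simpa using hT (Fin.last k)
    have hr : 0 < r := (abs_nonneg s).trans_lt hs
    have hder : ∀ (t : Fin k → ℝ) (s : ℝ), HasDerivAt (fun s => f (Fin.snoc (α := fun _ => ℝ) t s))
        (fderiv ℝ f (Fin.snoc (α := fun _ => ℝ) t s) (Pi.single (Fin.last k) 1)) s := by
      intro t s
      have h1 := ((hf.differentiable (by simp)) (Fin.snoc (α := fun _ => ℝ) t s)).hasFDerivAt
      have h2 : HasDerivAt (fun s : ℝ => Fin.snoc (α := fun _ => ℝ) t s)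
          (Pi.single (Fin.last k) 1) s := by
        have h3 := ((hasDerivAt_id s).smul_const
          (Pi.single (Fin.last k) 1 : Fin (k + 1) → ℝ)).const_add (snocZero k t)
        rw [one_smul] at h3
        refine h3.congr_of_eventuallyEq (Eventually.of_forall fun s => ?_)
        exact snoc_eq_snocZero_add t s
      exact h1.comp_hasDerivAt s h2
    -- For fixed `s` the partial derivative in the last variable again vanishes on the hyperplanes
    -- of the first `k` coordinates, so the induction hypothesis applies with the same `m` and `C`.
    have key : ∀ s, |s| < r → ‖fderiv ℝ f (Fin.snoc (α := fun _ => ℝ) t s)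
        (Pi.single (Fin.last k) 1) - (∏ i, t i) • m‖ ≤ C * |∏ i, t i| := by
      intro s hs
      refine ih (f := fun t => fderiv ℝ f (Fin.snoc (α := fun _ => ℝ) t s)
        (Pi.single (Fin.last k) 1)) ?_ ?_ ?_ t ht
      · refine ContDiff.clm_apply ?_ contDiff_const
        refine (contDiff_infty_iff_fderiv.1 hf).2.comp ?_
        rw [show (fun t => Fin.snoc (α := fun _ => ℝ) t s) =
          fun t => snocZero k t + s • Pi.single (Fin.last k) 1 from
          funext fun t => snoc_eq_snocZero_add t s]
        exact (snocZero k).contDiff.add contDiff_const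
      · rintro t' ht' ⟨j, hj⟩
        refine (hder t' s).unique ?_
        refine (hasDerivAt_const s (0 : F)).congr_of_eventuallyEq ?_
        filter_upwards [(isOpen_lt continuous_abs continuous_const).mem_nhds hs] with s' hs'
        exact h0 _ (hmem t' s' ht' hs') ⟨j.castSucc, by simpa using hj⟩
      · intro t' ht'
        rw [← iteratedFDeriv_single_snoc hf]
        exact hC _ (hmem t' s ht' hs)
    have hz : f (Fin.snoc (α := fun _ => ℝ) t 0) = 0 :=
      h0 _ (hmem t 0 ht (by simpa using hr)) ⟨Fin.last k, by simp⟩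
    -- Integrating that estimate in the last variable from `0`, where `f` vanishes, supplies the
    -- missing factor `s` of the product.
    have mv := (convex_Ioo (-r) r).norm_image_sub_le_of_norm_hasDerivWithin_le
      (f := fun s => f (Fin.snoc (α := fun _ => ℝ) t s) - s • (∏ i, t i) • m)
      (f' := fun s => fderiv ℝ f (Fin.snoc (α := fun _ => ℝ) t s) (Pi.single (Fin.last k) 1) -
        (∏ i, t i) • m) (C := C * |∏ i, t i|) (x := 0) (y := s)
      (fun s _ => by
        have := (hder t s).sub ((hasDerivAt_id s).smul_const ((∏ i, t i) • m))
        rw [one_smul] at this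
        exact this.hasDerivWithinAt)
      (fun s hs => key s (abs_lt.2 hs)) ⟨by linarith, hr⟩ (abs_lt.1 hs)
    rw [hz, zero_smul, sub_zero, sub_zero, sub_zero] at mv
    rw [Fin.prod_univ_castSucc]
    simp only [Fin.snoc_castSucc, Fin.snoc_last]
    rw [mul_comm, mul_smul, abs_mul]
    calc _ ≤ _ := mv
      _ = _ := by rw [Real.norm_eq_abs]; ring

variable (k : ℕ)

/-- The derivative `∂^k f / ∂t_1 ⋯ ∂t_k` at `0`. -/
def mixedDeriv (f : (Fin k → ℝ) → F) : F :=
  iteratedFDeriv ℝ k f 0 (fun i => Pi.single i 1)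

/-- `c s = c 0 + s^k m + o(s^k)`. -/
def HasOrderDeriv (c : ℝ → F) (m : F) : Prop :=
  (fun s : ℝ => c s - c 0 - s ^ k • m) =o[𝓝 0] fun s : ℝ => s ^ k

/-- `f` is constant on the union of the coordinate hyperplanes, near `0`. -/
def IsConstOnAxes (f : (Fin k → ℝ) → F) : Prop :=
  ∀ᶠ t in 𝓝 (0 : Fin k → ℝ), (∃ j, t j = 0) → f t = f 0

variable {k}

theorem mixedDeriv_congr {f g : (Fin k → ℝ) → F} (h : f =ᶠ[𝓝 0] g) :
    mixedDeriv k f = mixedDeriv k g := by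
  rw [mixedDeriv, h.iteratedFDeriv ℝ k |>.self_of_nhds, mixedDeriv]

theorem HasOrderDeriv.unique {c : ℝ → F} {m m' : F} (h : HasOrderDeriv k c m)
    (h' : HasOrderDeriv k c m') : m = m' := by
  have h1 := h.sub h'
  have h2 : (fun s : ℝ => s ^ k • (m' - m)) =o[𝓝[≠] 0] fun s : ℝ => s ^ k := by
    refine (h1.mono nhdsWithin_le_nhds).congr_left fun s => ?_
    rw [smul_sub]
    abel
  by_contra hne
  have hpos : 0 < ‖m' - m‖ := norm_pos_iff.2 (sub_ne_zero.2 (Ne.symm hne))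
  have h3 := (isLittleO_iff.1 h2 (half_pos hpos)).and self_mem_nhdsWithin
  obtain ⟨s, hs, hs0⟩ := h3.exists
  have hs' : (0 : ℝ) < ‖s ^ k‖ := norm_pos_iff.2 (pow_ne_zero k hs0)
  rw [norm_smul] at hs
  nlinarith

theorem HasOrderDeriv.isBigO {c : ℝ → F} {m : F} (h : HasOrderDeriv k c m) :
    (fun s => c s - c 0) =O[𝓝 0] fun s : ℝ => s ^ k := by
  have h1 : (fun s : ℝ => s ^ k • m) =O[𝓝 0] fun s : ℝ => s ^ k := by
    refine IsBigO.of_bound ‖m‖ (Eventually.of_forall fun s => ?_)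
    rw [norm_smul, mul_comm]
  exact ((IsLittleO.isBigO h).add h1).congr_left fun s => by abel

theorem HasOrderDeriv.tendsto {c : ℝ → F} {m : F} (hk : 1 ≤ k) (h : HasOrderDeriv k c m) :
    Tendsto c (𝓝 0) (𝓝 (c 0)) := by
  have h1 : Tendsto (fun s : ℝ => s ^ k) (𝓝 0) (𝓝 0) := by
    have : Tendsto (fun s : ℝ => s ^ k) (𝓝 0) (𝓝 (0 ^ k)) :=
      (continuous_pow (M := ℝ) k).tendsto 0
    rwa [zero_pow (by omega)] at this
  exact tendsto_sub_nhds_zero_iff.1 (h.isBigO.trans_tendsto h1)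

/-- The increment of `c` is `O(s^k)`, so the error of the linear approximation of `G` is `o(s^k)`:
only the first derivative of `G` is seen at order `k`, although `k` may be large. -/
theorem HasOrderDeriv.comp {c : ℝ → E} {m : E} (hk : 1 ≤ k) (h : HasOrderDeriv k c m) {G : E → F}
    {G' : E →L[ℝ] F} (hG : HasFDerivAt G G' (c 0)) : HasOrderDeriv k (fun s => G (c s)) (G' m) := by
  have h1 := (hG.isLittleO.comp_tendsto (h.tendsto hk)).trans_isBigO h.isBigO
  have h2 := (G'.isBigO_comp (fun s => c s - c 0 - s ^ k • m) (𝓝 0)).trans_isLittleO h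
  refine (h1.add h2).congr_left fun s => ?_
  simp only [Function.comp, map_sub, map_smul]
  abel

theorem HasOrderDeriv.add {c d : ℝ → F} {m m' : F} (h : HasOrderDeriv k c m)
    (h' : HasOrderDeriv k d m') : HasOrderDeriv k (fun s => c s + d s) (m + m') := by
  refine (IsLittleO.add h h').congr_left fun s => ?_
  change _ = c s + d s - (c 0 + d 0) - s ^ k • (m + m')
  rw [smul_add]
  abel

/-- `f` is smooth on a neighbourhood of `x`. -/
def SmoothNear (f : E → F) (x : E) : Prop := ∀ᶠ y in 𝓝 x, ContDiffAt ℝ ∞ f y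

theorem SmoothNear.exists_contDiff [FiniteDimensional ℝ E] {f : E → F} {x : E}
    (h : SmoothNear f x) : ∃ g : E → F, ContDiff ℝ ∞ g ∧ g =ᶠ[𝓝 x] f := by
  obtain ⟨O, hO, ho, hx⟩ := eventually_nhds_iff.1 h
  exact exists_contDiff_eventuallyEq ho (fun y hy => (hO y hy).contDiffWithinAt) hx

theorem SmoothNear.contDiffAt {f : E → F} {x : E} (h : SmoothNear f x) : ContDiffAt ℝ ∞ f x :=
  h.self_of_nhds

theorem SmoothNear.continuousAt {f : E → F} {x : E} (h : SmoothNear f x) : ContinuousAt f x :=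
  h.contDiffAt.continuousAt

theorem ContDiffOn.smoothNear {f : E → F} {x : E} {O : Set E} (hf : ContDiffOn ℝ ∞ f O)
    (hO : O ∈ 𝓝 x) : SmoothNear f x := by
  filter_upwards [eventually_mem_nhds_iff.2 hO] with y hy using hf.contDiffAt hy

theorem ContDiff.smoothNear {f : E → F} (hf : ContDiff ℝ ∞ f) (x : E) : SmoothNear f x :=
  Eventually.of_forall fun _ => hf.contDiffAt

theorem SmoothNear.congr {f g : E → F} {x : E} (hf : SmoothNear f x) (h : g =ᶠ[𝓝 x] f) :
    SmoothNear g x := by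
  filter_upwards [hf, h.eventuallyEq_nhds] with y hy hy' using hy.congr_of_eventuallyEq hy'

theorem SmoothNear.comp {G : Type*} [NormedAddCommGroup G] [NormedSpace ℝ G] {g : F → G}
    {f : E → F} {x : E} (hg : SmoothNear g (f x)) (hf : SmoothNear f x) :
    SmoothNear (fun y => g (f y)) x := by
  filter_upwards [hf, hf.continuousAt.eventually hg] with y h1 h2 using
    ContDiffAt.comp y h2 h1

theorem SmoothNear.prodMk {G : Type*} [NormedAddCommGroup G] [NormedSpace ℝ G] {f : E → F}
    {g : E → G} {x : E} (hf : SmoothNear f x) (hg : SmoothNear g x) :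
    SmoothNear (fun y => (f y, g y)) x := by
  filter_upwards [hf, hg] with y h1 h2 using h1.prodMk h2

theorem SmoothNear.fderiv [FiniteDimensional ℝ E] {f : E → F} {x : E} (hf : SmoothNear f x) :
    SmoothNear (fderiv ℝ f) x := by
  obtain ⟨g, hg, hgf⟩ := hf.exists_contDiff
  exact (ContDiff.smoothNear (contDiff_infty_iff_fderiv.1 hg).2 x).congr hgf.symm.fderiv

theorem SmoothNear.differentiableAt {f : E → F} {x : E} (hf : SmoothNear f x) :
    DifferentiableAt ℝ f x := hf.contDiffAt.differentiableAt (by simp)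

theorem iteratedFDeriv_sub_const_apply {k : ℕ} (hk : 1 ≤ k) (f : E → F) (c : F) (x : E)
    (v : Fin k → E) : iteratedFDeriv ℝ k (fun y => f y - c) x v = iteratedFDeriv ℝ k f x v := by
  obtain ⟨k, rfl⟩ : ∃ j, k = j + 1 := ⟨k - 1, by omega⟩
  rw [iteratedFDeriv_succ_apply_right, iteratedFDeriv_succ_apply_right]
  simp only [fderiv_sub_const]

/-- On the diagonal the product of the coordinates is `s^k`, and continuity of the `k`-th derivative
makes the constant in `norm_sub_prod_smul_le` as small as desired. By `HasOrderDeriv.unique`, mixed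
derivatives can then be compared through curves in one variable. -/
theorem hasOrderDeriv_mixedDeriv (hk : 1 ≤ k) {f : (Fin k → ℝ) → F} (hf : SmoothNear f 0)
    (h0 : IsConstOnAxes k f) : HasOrderDeriv k (fun s => f fun _ => s) (mixedDeriv k f) := by
  obtain ⟨g, hg, hgf⟩ := hf.exists_contDiff
  have hg0 : g 0 = f 0 := hgf.self_of_nhds
  rw [← mixedDeriv_congr hgf]
  have hcont : Continuous fun t : Fin k → ℝ => iteratedFDeriv ℝ k g t (fun i => Pi.single i 1) :=
    ((hg.continuous_iteratedFDeriv (m := k) (by exact_mod_cast le_top))).eval_const _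
  rw [HasOrderDeriv, isLittleO_iff]
  intro c hc
  have hev : ∀ᶠ t in 𝓝 (0 : Fin k → ℝ), ((∃ j, t j = 0) → g t - g 0 = 0) ∧ g t = f t ∧
      ‖iteratedFDeriv ℝ k g t (fun i => Pi.single i 1) - mixedDeriv k g‖ ≤ c := by
    have h3 : ∀ᶠ t in 𝓝 (0 : Fin k → ℝ),
        dist (iteratedFDeriv ℝ k g t (fun i => Pi.single i 1)) (mixedDeriv k g) < c :=
      hcont.continuousAt.eventually (Metric.ball_mem_nhds _ hc)
    filter_upwards [h0, hgf, h3] with t h1 h2 h3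
    refine ⟨fun h => ?_, h2, by rw [← dist_eq_norm]; exact h3.le⟩
    rw [h2, h1 h, hg0, sub_self]
  obtain ⟨r, hr, hball⟩ := Metric.eventually_nhds_iff_ball.1 hev
  have hmem : ∀ t : Fin k → ℝ, (∀ i, |t i| < r) → t ∈ Metric.ball 0 r := by
    intro t ht
    rw [mem_ball_zero_iff, pi_norm_lt_iff hr]
    exact ht
  have key := norm_sub_prod_smul_le (hg.sub contDiff_const) (r := r) (C := c) (m := mixedDeriv k g)
    (fun t ht hj => (hball t (hmem t ht)).1 hj)
    (fun t ht => by
      rw [iteratedFDeriv_sub_const_apply hk]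
      exact (hball t (hmem t ht)).2.2)
  filter_upwards [(isOpen_lt continuous_abs continuous_const).mem_nhds
    (by simpa using hr : |(0 : ℝ)| < r)] with s hs
  have h1 := key (fun _ => s) fun _ => hs
  rw [Finset.prod_const, Finset.card_univ, Fintype.card_fin] at h1
  have h2 := (hball _ (hmem (fun _ => s) fun _ => hs)).2.1
  rw [h2, hg0] at h1
  exact h1

/-- The mixed derivative of a commutator-like family transforms as a tangent vector. -/
theorem mixedDeriv_comp (hk : 1 ≤ k) {f : (Fin k → ℝ) → E} (hf : SmoothNear f 0)
    (h0 : IsConstOnAxes k f) {G : E → F} (hG : SmoothNear G (f 0)) :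
    mixedDeriv k (fun t => G (f t)) = fderiv ℝ G (f 0) (mixedDeriv k f) := by
  refine HasOrderDeriv.unique (hasOrderDeriv_mixedDeriv hk (hG.comp hf) ?_)
    ((hasOrderDeriv_mixedDeriv hk hf h0).comp hk hG.differentiableAt.hasFDerivAt)
  filter_upwards [h0] with t ht hj
  rw [ht hj]

theorem mixedDeriv_snoc {f : (Fin (k + 1) → ℝ) → F} (hf : SmoothNear f 0) :
    mixedDeriv (k + 1) f = mixedDeriv k fun t => fderiv ℝ f (Fin.snoc (α := fun _ => ℝ) t 0)
      (Pi.single (Fin.last k) 1) := by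
  obtain ⟨g, hg, hgf⟩ := hf.exists_contDiff
  have h := iteratedFDeriv_single_snoc hg (0 : Fin k → ℝ) 0
  have h0 : (Fin.snoc (α := fun _ => ℝ) (0 : Fin k → ℝ) 0) = (0 : Fin (k + 1) → ℝ) :=
    map_zero (snocZero k)
  rw [h0] at h
  rw [← mixedDeriv_congr hgf]
  refine h.trans (mixedDeriv_congr ?_)
  have h1 : ∀ᶠ t in 𝓝 (0 : Fin k → ℝ), fderiv ℝ g (snocZero k t) = fderiv ℝ f (snocZero k t) := by
    have h3 : Tendsto (snocZero k) (𝓝 0) (𝓝 0) := by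
      simpa using (snocZero k).continuous.tendsto 0
    have h4 : ∀ᶠ y in 𝓝 0, fderiv ℝ g y = fderiv ℝ f y := hgf.fderiv
    exact h3.eventually h4
  filter_upwards [h1] with t ht
  exact congrArg (fun L : (Fin (k + 1) → ℝ) →L[ℝ] F => L (Pi.single (Fin.last k) 1)) ht

/-- Symmetry of second derivatives, applied once for each of the `k` directions. -/
theorem fderiv_iteratedFDeriv_comm {f : E → F} (hf : ContDiff ℝ ∞ f) (u : E) :
    ∀ (k : ℕ) (v : Fin k → E) (x : E), fderiv ℝ (fun y => iteratedFDeriv ℝ k f y v) x u =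
      iteratedFDeriv ℝ k (fun y => fderiv ℝ f y u) x v := by
  intro k
  induction k with
  | zero => intro v x; simp
  | succ k ih =>
    intro v x
    have hs : ∀ g : E → F, ContDiff ℝ ∞ g → ∀ (k : ℕ) (v : Fin k → E),
        ContDiff ℝ ∞ fun y => iteratedFDeriv ℝ k g y v := by
      intro g hg k v
      exact (ContinuousMultilinearMap.apply ℝ (fun _ : Fin k => E) F v).contDiff.comp
        (hg.iteratedFDeriv_right (m := ∞) (i := k) (by
          exact_mod_cast (le_of_eq (by simp))))
    have hu : ContDiff ℝ ∞ fun y => fderiv ℝ f y u :=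
      (contDiff_infty_iff_fderiv.1 hf).2.clm_apply contDiff_const
    have hsucc : ∀ g : E → F, ContDiff ℝ ∞ g → ∀ y, iteratedFDeriv ℝ (k + 1) g y v =
        fderiv ℝ (fun z => iteratedFDeriv ℝ k g z (Fin.tail v)) y (v 0) := fun g hg y =>
      DifferentiableAt.iteratedFDeriv_succ_apply_left'
        ((hg.differentiable_iteratedFDeriv (m := k) (by exact_mod_cast ENat.natCast_lt_top k)) y)
    rw [hsucc _ hu, funext (hsucc f hf)]
    simp only [← ih]
    set h := fun z => iteratedFDeriv ℝ k f z (Fin.tail v)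
    have hh : ContDiff ℝ ∞ h := hs f hf k _
    have hd : DifferentiableAt ℝ (fderiv ℝ h) x :=
      ((contDiff_infty_iff_fderiv.1 hh).2.differentiable (by simp)) x
    have e1 : ∀ a b : E, fderiv ℝ (fun y => fderiv ℝ h y a) x b =
        fderiv ℝ (fderiv ℝ h) x b a := fun a b => by
      rw [fderiv_clm_apply hd (differentiableAt_const a)]
      simp
    rw [e1, e1]
    exact ((hh.contDiffAt (x := x)).isSymmSndFDerivAt (by
      rw [minSmoothness_of_isRCLikeNormedField]
      exact WithTop.coe_le_coe.2 (le_top : ((2 : ℕ) : ℕ∞) ≤ ⊤))).eq u (v 0)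

theorem iteratedFDeriv_inl {P : Type*} [NormedAddCommGroup P] [NormedSpace ℝ P]
    {f : P × E → F} (hf : ContDiff ℝ ∞ f) (w : E) (v : Fin k → P) (x : P) :
    iteratedFDeriv ℝ k (fun t => f (t, w)) x v =
      iteratedFDeriv ℝ k f (x, w) fun i => (v i, 0) := by
  have e : (fun t => f (t, w)) = (fun z => f (z + (0, w))) ∘ ContinuousLinearMap.inl ℝ P E := by
    ext t; simp
  have h2 : ContDiff ℝ ∞ (fun z : P × E => f (z + (0, w))) :=
    hf.comp (contDiff_id.add contDiff_const)
  rw [e, ContinuousLinearMap.iteratedFDeriv_comp_right _ h2 x (i := k) (by exact_mod_cast le_top),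
    ContinuousMultilinearMap.compContinuousLinearMap_apply, iteratedFDeriv_comp_add_right]
  simp

theorem SmoothNear.mixedDeriv_param [FiniteDimensional ℝ E] {f : (Fin k → ℝ) × E → F} {v : E}
    (hf : SmoothNear f (0, v)) : SmoothNear (fun w => mixedDeriv k fun t => f (t, w)) v := by
  obtain ⟨g, hg, hgf⟩ := hf.exists_contDiff
  have h1 : ContDiff ℝ ∞ fun w => mixedDeriv k fun t => g (t, w) := by
    simp only [mixedDeriv, iteratedFDeriv_inl hg]
    exact ((ContinuousMultilinearMap.apply ℝ (fun _ : Fin k => (Fin k → ℝ) × E) F _).contDiff.comp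
      (hg.iteratedFDeriv_right (m := ∞) (i := k) (by
          exact_mod_cast (le_of_eq (by simp))))).comp (contDiff_const.prodMk contDiff_id)
  refine (ContDiff.smoothNear h1 v).congr ?_
  have h2 : ∀ᶠ w in 𝓝 v, ∀ᶠ z in 𝓝 ((0 : Fin k → ℝ), w), g z = f z :=
    (Continuous.prodMk_right (0 : Fin k → ℝ)).continuousAt.eventually hgf.eventually_nhds
  filter_upwards [h2] with w hw
  refine mixedDeriv_congr ?_
  exact ((Continuous.prodMk_left w).continuousAt.eventually hw).mono fun t ht => ht.symm

/-- Differentiation in space commutes with the mixed derivative in the parameters. For the family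
`Φ(t, w)` this identifies the term `Dξ(V)` of the Lie bracket. -/
theorem fderiv_mixedDeriv_param [FiniteDimensional ℝ E] {f : (Fin k → ℝ) × E → F} {v : E}
    (hf : SmoothNear f (0, v)) (u : E) :
    fderiv ℝ (fun w => mixedDeriv k fun t => f (t, w)) v u =
      mixedDeriv k fun t => fderiv ℝ (fun w => f (t, w)) v u := by
  obtain ⟨g, hg, hgf⟩ := hf.exists_contDiff
  have h2 : ∀ᶠ w in 𝓝 v, ∀ᶠ z in 𝓝 ((0 : Fin k → ℝ), w), g z = f z :=
    (Continuous.prodMk_right (0 : Fin k → ℝ)).continuousAt.eventually hgf.eventually_nhds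
  have h3 : (fun w => mixedDeriv k fun t => f (t, w)) =ᶠ[𝓝 v]
      fun w => mixedDeriv k fun t => g (t, w) := by
    filter_upwards [h2] with w hw
    refine mixedDeriv_congr ?_
    exact ((Continuous.prodMk_left w).continuousAt.eventually hw).mono fun t ht => ht.symm
  have h4 : ∀ᶠ t in 𝓝 (0 : Fin k → ℝ), ∀ᶠ z in 𝓝 (t, v), g z = f z :=
    (Continuous.prodMk_left v).continuousAt.eventually hgf.eventually_nhds
  have h5 : (fun t => fderiv ℝ (fun w => f (t, w)) v u) =ᶠ[𝓝 (0 : Fin k → ℝ)]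
      fun t => fderiv ℝ g (t, v) (0, u) := by
    filter_upwards [h4] with t ht
    have : (fun w => f (t, w)) =ᶠ[𝓝 v] fun w => g (t, w) :=
      ((Continuous.prodMk_right t).continuousAt.eventually ht).mono fun t ht => ht.symm
    rw [this.fderiv_eq]
    have h6 : HasFDerivAt (fun w => g (t, w)) _ v :=
      ((hg.differentiable (by simp)) (t, v)).hasFDerivAt.comp v
        ((hasFDerivAt_const t v).prodMk (hasFDerivAt_id v))
    rw [h6.fderiv]
    rfl
  rw [h3.fderiv_eq, mixedDeriv_congr h5]
  simp only [mixedDeriv]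
  have hu : ContDiff ℝ ∞ fun y => fderiv ℝ g y (0, u) :=
      (contDiff_infty_iff_fderiv.1 hg).2.clm_apply contDiff_const
  rw [iteratedFDeriv_inl hu, ← fderiv_iteratedFDeriv_comm hg]
  simp only [iteratedFDeriv_inl hg]
  have hd : ContDiff ℝ ∞ fun y => iteratedFDeriv ℝ k g y
      (fun i => ((Pi.single i 1 : Fin k → ℝ), (0 : E))) :=
    (ContinuousMultilinearMap.apply ℝ (fun _ : Fin k => (Fin k → ℝ) × E) F _).contDiff.comp
      (hg.iteratedFDeriv_right (m := ∞) (i := k) (by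
          exact_mod_cast (le_of_eq (by simp))))
  have h6 : HasFDerivAt (fun w => iteratedFDeriv ℝ k g (0, w)
      (fun i => ((Pi.single i 1 : Fin k → ℝ), (0 : E)))) _ v :=
    ((hd.differentiable (by simp)) (0, v)).hasFDerivAt.comp v
      ((hasFDerivAt_const (0 : Fin k → ℝ) v).prodMk (hasFDerivAt_id v))
  rw [h6.fderiv]
  rfl

end Mixed

/-! ### Sprays of Lagrangians -/

section Spray

variable {E : Type*} [NormedAddCommGroup E] [NormedSpace ℝ E] [FiniteDimensional ℝ E]

/-- The Hessian of `L`. -/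
def hess {F : Type*} [NormedAddCommGroup F] [NormedSpace ℝ F] (L : F → ℝ) (z a b : F) : ℝ :=
  fderiv ℝ (fderiv ℝ L) z a b

section Hess

variable {F G : Type*} [NormedAddCommGroup F] [NormedSpace ℝ F] [FiniteDimensional ℝ F]
  [NormedAddCommGroup G] [NormedSpace ℝ G] [FiniteDimensional ℝ G]
  {L : F → ℝ} {z : F}

omit [FiniteDimensional ℝ F] in
theorem hess_add_left (L : F → ℝ) (z a b c : F) :
    hess L z (a + b) c = hess L z a c + hess L z b c := by simp [hess]

omit [FiniteDimensional ℝ F] in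
theorem hess_smul_left (L : F → ℝ) (z a c : F) (r : ℝ) :
    hess L z (r • a) c = r * hess L z a c := by simp [hess]

omit [FiniteDimensional ℝ F] in
theorem hess_sub_left (L : F → ℝ) (z a b c : F) :
    hess L z (a - b) c = hess L z a c - hess L z b c := by simp [hess]

omit [FiniteDimensional ℝ F] in
theorem hess_comm (hL : SmoothNear L z) (a b : F) : hess L z a b = hess L z b a :=
  (hL.contDiffAt.isSymmSndFDerivAt (by
    rw [minSmoothness_of_isRCLikeNormedField]
    exact WithTop.coe_le_coe.2 (le_top : ((2 : ℕ) : ℕ∞) ≤ ⊤))).eq a b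

omit [FiniteDimensional ℝ G] in
/-- Differentiation of `z ↦ DL(φ z)(ψ z)`. -/
theorem hasFDerivAt_fderiv_comp {φ ψ : G → F} {φ' ψ' : G →L[ℝ] F} {y : G}
    (hL : SmoothNear L (φ y)) (hφ : HasFDerivAt φ φ' y) (hψ : HasFDerivAt ψ ψ' y) :
    HasFDerivAt (fun y => fderiv ℝ L (φ y) (ψ y))
      ((fderiv ℝ L (φ y)).comp ψ' +
        ((fderiv ℝ (fderiv ℝ L) (φ y)).comp φ').flip (ψ y)) y :=
  (hL.fderiv.differentiableAt.hasFDerivAt.comp y hφ).clm_apply hψ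

omit [FiniteDimensional ℝ G] in
theorem fderiv_fderiv_comp_apply {φ ψ : G → F} {φ' ψ' : G →L[ℝ] F} {y : G}
    (hL : SmoothNear L (φ y)) (hφ : HasFDerivAt φ φ' y) (hψ : HasFDerivAt ψ ψ' y) (a : G) :
    fderiv ℝ (fun y => fderiv ℝ L (φ y) (ψ y)) y a =
      fderiv ℝ L (φ y) (ψ' a) + hess L (φ y) (φ' a) (ψ y) := by
  rw [(hasFDerivAt_fderiv_comp hL hφ hψ).fderiv]
  rfl

end Hess

/-- `G` are the spray coefficients of the regular Lagrangian `L`, in the form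
`D²L(z)((y, -2G), (0, u)) = DL(z)(u, 0)`. -/
structure IsSpray (L : E × E → ℝ) (O : Set (E × E)) (G : E × E → E) : Prop where
  isOpen : IsOpen O
  smooth : ContDiffOn ℝ ∞ L O
  smooth_coeff : ContDiffOn ℝ ∞ G O
  nondeg : ∀ z ∈ O, ∀ w, (∀ u, hess L z (0, w) (0, u) = 0) → w = 0
  euler_lagrange : ∀ z ∈ O, ∀ u, hess L z (z.2, (-2 : ℝ) • G z) (0, u) = fderiv ℝ L z (u, 0)

variable {L L' : E × E → ℝ} {O O' : Set (E × E)} {G G' : E × E → E}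

omit [FiniteDimensional ℝ E] in
theorem IsSpray.smoothNear (h : IsSpray L O G) {z : E × E} (hz : z ∈ O) : SmoothNear L z :=
  ContDiffOn.smoothNear h.smooth (h.isOpen.mem_nhds hz)

omit [FiniteDimensional ℝ E] in
theorem IsSpray.smoothNear_coeff (h : IsSpray L O G) {z : E × E} (hz : z ∈ O) : SmoothNear G z :=
  ContDiffOn.smoothNear h.smooth_coeff (h.isOpen.mem_nhds hz)

/-- Horizontal vectors annihilate a Lagrangian which is quadratically homogeneous. -/
theorem IsSpray.fderiv_horizontal (h : IsSpray L O G)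
    (h1 : ∀ z ∈ O, ∀ u, hess L z (0, u) (0, z.2) = fderiv ℝ L z (0, u))
    (h2 : ∀ z ∈ O, ∀ a, hess L z (a, 0) (0, z.2) = 2 * fderiv ℝ L z (a, 0))
    {z : E × E} (hz : z ∈ O) (u : E) : fderiv ℝ L z (u, -fderiv ℝ G z (0, u)) = 0 := by
  -- The spray direction annihilates `L` (conservation of energy): this is the Euler–Lagrange
  -- equation tested on `u = y`, after the homogeneity relations have replaced both Hessians by
  -- first derivatives.
  have h0 : ∀ z ∈ O, fderiv ℝ L z (z.2, (-2 : ℝ) • G z) = 0 := by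
    intro z hz
    have e1 := h.euler_lagrange z hz z.2
    have e2 : (z.2, (-2 : ℝ) • G z) = (z.2, (0 : E)) + (-2 : ℝ) • ((0 : E), G z) := by simp
    have e3 : hess L z ((z.2, (0 : E)) + (-2 : ℝ) • ((0 : E), G z)) (0, z.2) =
        hess L z (z.2, 0) (0, z.2) + (-2 : ℝ) * hess L z (0, G z) (0, z.2) := by
      rw [hess_add_left, hess_smul_left]
    rw [e2, e3, h2 z hz, h1 z hz] at e1
    rw [e2, map_add, map_smul, smul_eq_mul]
    linarith
  have hS : HasFDerivAt (fun z : E × E => (z.2, (-2 : ℝ) • G z))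
      ((ContinuousLinearMap.snd ℝ E E).prod ((-2 : ℝ) • fderiv ℝ G z)) z :=
    hasFDerivAt_snd.prodMk ((h.smoothNear_coeff hz).differentiableAt.hasFDerivAt.const_smul _)
  -- The identity `DL(y, -2G) = 0` is differentiated in the vertical direction `(0, u)`. Symmetry of
  -- the Hessian and the Euler–Lagrange equation turn the second order term into `DL(u, 0)`, leaving
  -- twice the desired expression.
  have e := fderiv_fderiv_comp_apply (h.smoothNear hz) (hasFDerivAt_id z) hS (0, u)
  have e' : (fun y => fderiv ℝ L (id y) (y.2, (-2 : ℝ) • G y)) =ᶠ[𝓝 z] fun _ => 0 := by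
    filter_upwards [h.isOpen.mem_nhds hz] with y hy using h0 y hy
  rw [e'.fderiv_eq] at e
  have e4 : hess L z (0, u) (z.2, (-2 : ℝ) • G z) = fderiv ℝ L z (u, 0) := by
    rw [hess_comm (h.smoothNear hz)]
    exact h.euler_lagrange z hz u
  have e5 : fderiv ℝ L z (u, (-2 : ℝ) • fderiv ℝ G z (0, u)) =
      2 * fderiv ℝ L z (u, -fderiv ℝ G z (0, u)) - fderiv ℝ L z (u, 0) := by
    have e7 : (u, (-2 : ℝ) • fderiv ℝ G z (0, u)) =
        (2 : ℝ) • (u, -fderiv ℝ G z (0, u)) - (u, (0 : E)) := by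
      refine Prod.ext ?_ ?_
      · change u = (2 : ℝ) • u - u; rw [two_smul]; abel
      · simp
    rw [e7, map_sub, map_smul, smul_eq_mul]
  have e6 : (0 : ℝ) = fderiv ℝ L z (u, (-2 : ℝ) • fderiv ℝ G z (0, u)) +
    hess L z (0, u) (z.2, (-2 : ℝ) • G z) := by simpa using e
  rw [e4, e5] at e6
  linarith

/-- The tangent map of `θ`. -/
def tangentLift (θ : E → E) (z : E × E) : E × E := (θ z.1, fderiv ℝ θ z.1 z.2)

theorem hasFDerivAt_tangentLift {θ : E → E} {z : E × E} (hθ : SmoothNear θ z.1) :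
    HasFDerivAt (tangentLift θ)
      (((fderiv ℝ θ z.1).comp (ContinuousLinearMap.fst ℝ E E)).prod
        ((fderiv ℝ θ z.1).comp (ContinuousLinearMap.snd ℝ E E) +
          ((fderiv ℝ (fderiv ℝ θ) z.1).comp (ContinuousLinearMap.fst ℝ E E)).flip z.2)) z :=
  (hθ.differentiableAt.hasFDerivAt.comp z hasFDerivAt_fst).prodMk
    ((hθ.fderiv.differentiableAt.hasFDerivAt.comp z hasFDerivAt_fst).clm_apply hasFDerivAt_snd)

theorem fderiv_tangentLift {θ : E → E} {z : E × E} (hθ : SmoothNear θ z.1) (a : E × E) :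
    fderiv ℝ (tangentLift θ) z a =
      (fderiv ℝ θ z.1 a.1, fderiv ℝ θ z.1 a.2 + fderiv ℝ (fderiv ℝ θ) z.1 a.1 z.2) := by
  rw [(hasFDerivAt_tangentLift hθ).fderiv]
  rfl

/-- The spray coefficients transform under changes of coordinates as a second order vector field. -/
theorem IsSpray.coeff_transform (h : IsSpray L O G) (h' : IsSpray L' O' G') {θ : E → E}
    {z : E × E} (hz : z ∈ O) (hz' : tangentLift θ z ∈ O') (hθ : SmoothNear θ z.1)
    (hsurj : Function.Surjective (fderiv ℝ θ z.1))
    (hLL : L =ᶠ[𝓝 z] fun z => L' (tangentLift θ z)) :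
    (-2 : ℝ) • G' (tangentLift θ z) = fderiv ℝ θ z.1 ((-2 : ℝ) • G z) +
      fderiv ℝ (fderiv ℝ θ) z.1 z.2 z.2 := by
  have hθ2 : ∀ a b, fderiv ℝ (fderiv ℝ θ) z.1 a b = fderiv ℝ (fderiv ℝ θ) z.1 b a := fun a b =>
    (hθ.contDiffAt.isSymmSndFDerivAt (by
      rw [minSmoothness_of_isRCLikeNormedField]
      exact WithTop.coe_le_coe.2 (le_top : ((2 : ℕ) : ℕ∞) ≤ ⊤))).eq a b
  have hθz : ∀ᶠ y in 𝓝 z, SmoothNear θ y.1 := continuous_fst.continuousAt.eventually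
    (hθ.eventually_nhds)
  have hTc : ContinuousAt (tangentLift θ) z := (hasFDerivAt_tangentLift hθ).continuousAt
  have hL'z : SmoothNear L' (tangentLift θ z) := h'.smoothNear hz'
  have hchain : ∀ᶠ y in 𝓝 z, ∀ a, fderiv ℝ L y a = fderiv ℝ L' (tangentLift θ y)
      (fderiv ℝ θ y.1 a.1, fderiv ℝ θ y.1 a.2 + fderiv ℝ (fderiv ℝ θ) y.1 a.1 y.2) := by
    have hLL' : ∀ᶠ y in 𝓝 z, fderiv ℝ L y = fderiv ℝ (fun z => L' (tangentLift θ z)) y :=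
      hLL.fderiv
    filter_upwards [hLL', hθz, hTc.eventually hL'z] with y hy hθy hL'y a
    rw [hy, ← fderiv_tangentLift hθy]
    have := (hL'y.differentiableAt (by simp)).hasFDerivAt.comp y
      (hasFDerivAt_tangentLift hθy).differentiableAt.hasFDerivAt
    exact congrArg (fun A : E × E →L[ℝ] ℝ => A a) this.fderiv
  set S : E × E := (z.2, (-2 : ℝ) • G z) with hSdef
  -- The chain rule for the vertical derivative, `DL(0, u) = DL'(0, Dθ u)`, is differentiated along
  -- the spray direction of `L`.
  have key : ∀ u, hess L z S (0, u) =
      fderiv ℝ L' (tangentLift θ z) (0, fderiv ℝ (fderiv ℝ θ) z.1 z.2 u) +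
      hess L' (tangentLift θ z) (fderiv ℝ θ z.1 z.2, fderiv ℝ θ z.1 ((-2 : ℝ) • G z) +
        fderiv ℝ (fderiv ℝ θ) z.1 z.2 z.2) (0, fderiv ℝ θ z.1 u) := by
    intro u
    have e1 : fderiv ℝ (fun y => fderiv ℝ L y (0, u)) z S = hess L z S (0, u) := by
      have := fderiv_fderiv_comp_apply (h.smoothNear hz) (hasFDerivAt_id z)
        (hasFDerivAt_const ((0 : E), u) z) S
      simpa using this
    have e2 : (fun y => fderiv ℝ L y (0, u)) =ᶠ[𝓝 z] fun y =>
        fderiv ℝ L' (tangentLift θ y) (0, fderiv ℝ θ y.1 u) := by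
      filter_upwards [hchain] with y hy
      rw [hy]
      simp
    have hψ : HasFDerivAt (fun y : E × E => ((0 : E), fderiv ℝ θ y.1 u))
        ((0 : E × E →L[ℝ] E).prod
          (((fderiv ℝ (fderiv ℝ θ) z.1).comp (ContinuousLinearMap.fst ℝ E E)).flip u)) z := by
      refine (hasFDerivAt_const (0 : E) z).prodMk ?_
      have := (hθ.fderiv.differentiableAt.hasFDerivAt.comp z
        (hasFDerivAt_fst (𝕜 := ℝ) (E := E) (F := E))).clm_apply (hasFDerivAt_const u z)
      simpa using! this
    rw [← e1, e2.fderiv_eq, fderiv_fderiv_comp_apply hL'z (hasFDerivAt_tangentLift hθ) hψ]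
    rfl
  have hz1 := hchain.self_of_nhds
  -- The transformed spray direction and the spray direction of `L'` have the same horizontal part.
  -- Both satisfy the Euler–Lagrange equation of `L'`, so their vertical difference is in the kernel
  -- of the vertical Hessian. Surjectivity of `Dθ` provides all test vectors.
  have hw : ∀ u', hess L' (tangentLift θ z) (0, fderiv ℝ θ z.1 ((-2 : ℝ) • G z) +
      fderiv ℝ (fderiv ℝ θ) z.1 z.2 z.2 - (-2 : ℝ) • G' (tangentLift θ z)) (0, u') = 0 := by
    intro u'
    obtain ⟨u, rfl⟩ := hsurj u'
    have e1 := h.euler_lagrange z hz u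
    have e2 := h'.euler_lagrange _ hz' (fderiv ℝ θ z.1 u)
    rw [hz1, ← hSdef, key] at e1
    have e3 : fderiv ℝ L' (tangentLift θ z) (fderiv ℝ θ z.1 u, fderiv ℝ θ z.1 0 +
        fderiv ℝ (fderiv ℝ θ) z.1 u z.2) = fderiv ℝ L' (tangentLift θ z) (fderiv ℝ θ z.1 u, 0) +
        fderiv ℝ L' (tangentLift θ z) (0, fderiv ℝ (fderiv ℝ θ) z.1 z.2 u) := by
      rw [← map_add, hθ2 z.2 u]
      simp
    rw [e3] at e1
    have e4 : ((0 : E), fderiv ℝ θ z.1 ((-2 : ℝ) • G z) +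
      fderiv ℝ (fderiv ℝ θ) z.1 z.2 z.2 - (-2 : ℝ) • G' (tangentLift θ z)) =
      (fderiv ℝ θ z.1 z.2, fderiv ℝ θ z.1 ((-2 : ℝ) • G z) +
        fderiv ℝ (fderiv ℝ θ) z.1 z.2 z.2) -
      ((tangentLift θ z).2, (-2 : ℝ) • G' (tangentLift θ z)) := by
      simp [tangentLift]
    rw [e4, hess_sub_left, e2]
    linarith
  exact (sub_eq_zero.1 (h'.nondeg _ hz' _ hw)).symm

/-- Horizontal lifts do not depend on the coordinates. -/
theorem IsSpray.horizontal_transform (h : IsSpray L O G) (h' : IsSpray L' O' G') {θ : E → E}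
    {z : E × E} (hz : z ∈ O) (hz' : tangentLift θ z ∈ O') (hθ : SmoothNear θ z.1)
    (hsurj : ∀ᶠ x in 𝓝 z.1, Function.Surjective (fderiv ℝ θ x))
    (hLL : L =ᶠ[𝓝 z] fun z => L' (tangentLift θ z)) (u : E) :
    fderiv ℝ (tangentLift θ) z (u, -fderiv ℝ G z (0, u)) =
      (fderiv ℝ θ z.1 u, -fderiv ℝ G' (tangentLift θ z) (0, fderiv ℝ θ z.1 u)) := by
  have hθ2 : ∀ a b, fderiv ℝ (fderiv ℝ θ) z.1 a b = fderiv ℝ (fderiv ℝ θ) z.1 b a := fun a b =>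
    (hθ.contDiffAt.isSymmSndFDerivAt (by
      rw [minSmoothness_of_isRCLikeNormedField]
      exact WithTop.coe_le_coe.2 (le_top : ((2 : ℕ) : ℕ∞) ≤ ⊤))).eq a b
  have hT := hasFDerivAt_tangentLift hθ
  -- The transformation law of the spray is applied along the vertical line through `z`. The base
  -- point is fixed there, so differentiation at `s = 0` meets only `G`, `G'` and the quadratic term
  -- `D²θ(y, y)`.
  have hev : ∀ᶠ s : ℝ in 𝓝 0, (-2 : ℝ) • G' (tangentLift θ (z + s • (0, u))) =
      fderiv ℝ θ z.1 ((-2 : ℝ) • G (z + s • (0, u))) +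
      fderiv ℝ (fderiv ℝ θ) z.1 (z.2 + s • u) (z.2 + s • u) := by
    have hc : Tendsto (fun s : ℝ => z + s • ((0 : E), u)) (𝓝 0) (𝓝 z) := by
      have : Continuous fun s : ℝ => z + s • ((0 : E), u) := by fun_prop
      simpa using this.tendsto 0
    have h1 : ∀ᶠ y in 𝓝 z, y ∈ O ∧ tangentLift θ y ∈ O' ∧ SmoothNear θ y.1 ∧
        Function.Surjective (fderiv ℝ θ y.1) ∧ L =ᶠ[𝓝 y] fun z => L' (tangentLift θ z) :=
      (show ∀ᶠ y in 𝓝 z, y ∈ O from h.isOpen.mem_nhds hz).and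
        ((hT.continuousAt.eventually (h'.isOpen.mem_nhds hz')).and
        ((continuous_fst.continuousAt.eventually hθ.eventually_nhds).and
        ((continuous_fst.continuousAt.eventually hsurj).and hLL.eventually_nhds)))
    filter_upwards [hc.eventually h1] with s hs
    have := h.coeff_transform h' hs.1 hs.2.1 hs.2.2.1 hs.2.2.2.1 hs.2.2.2.2
    simpa using this
  have hl : HasDerivAt (fun s : ℝ => z + s • ((0 : E), u)) ((0 : E), u) 0 := by
    have := ((hasDerivAt_id (0 : ℝ)).smul_const ((0 : E), u)).const_add z
    rwa [one_smul] at this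
  have hl2 : HasDerivAt (fun s : ℝ => z.2 + s • u) u 0 := by
    have := ((hasDerivAt_id (0 : ℝ)).smul_const u).const_add z.2
    rwa [one_smul] at this
  have hz0 : z + (0 : ℝ) • ((0 : E), u) = z := by simp
  have d1 : HasDerivAt (fun s : ℝ => (-2 : ℝ) • G' (tangentLift θ (z + s • (0, u))))
      ((-2 : ℝ) • fderiv ℝ G' (tangentLift θ z) (0, fderiv ℝ θ z.1 u)) 0 := by
    have hg := ((h'.smoothNear_coeff hz').differentiableAt.hasFDerivAt.comp z hT)
    rw [← hz0] at hg
    have := (hg.comp_hasDerivAt (0 : ℝ) hl).const_smul (-2 : ℝ)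
    refine this.congr_deriv ?_
    rw [hz0]
    simp
  have d2 : HasDerivAt (fun s : ℝ => fderiv ℝ θ z.1 ((-2 : ℝ) • G (z + s • (0, u))) +
      fderiv ℝ (fderiv ℝ θ) z.1 (z.2 + s • u) (z.2 + s • u))
      (fderiv ℝ θ z.1 ((-2 : ℝ) • fderiv ℝ G z (0, u)) +
        (fderiv ℝ (fderiv ℝ θ) z.1 u z.2 + fderiv ℝ (fderiv ℝ θ) z.1 z.2 u)) 0 := by
    have hg := (h.smoothNear_coeff hz).differentiableAt.hasFDerivAt
    rw [← hz0] at hg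
    have e1 := (fderiv ℝ θ z.1).hasFDerivAt.comp_hasDerivAt (0 : ℝ)
      ((hg.comp_hasDerivAt (0 : ℝ) hl).const_smul (-2 : ℝ))
    have e2 := ((fderiv ℝ (fderiv ℝ θ) z.1).hasFDerivAt.comp_hasDerivAt (0 : ℝ) hl2).clm_apply hl2
    refine (e1.add e2).congr_deriv ?_
    rw [hz0]
    simp
  have d3 := d1.unique (d2.congr_of_eventuallyEq hev)
  rw [fderiv_tangentLift hθ]
  refine Prod.ext rfl ?_
  change fderiv ℝ θ z.1 (-fderiv ℝ G z (0, u)) + fderiv ℝ (fderiv ℝ θ) z.1 u z.2 = _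
  rw [hθ2 z.2 u, ← two_smul ℝ (fderiv ℝ (fderiv ℝ θ) z.1 u z.2), map_smul] at d3
  have e : (-2 : ℝ) • (fderiv ℝ G' (tangentLift θ z) (0, fderiv ℝ θ z.1 u)) =
      (-2 : ℝ) • (fderiv ℝ θ z.1 (fderiv ℝ G z (0, u)) - fderiv ℝ (fderiv ℝ θ) z.1 u z.2) := by
    rw [d3, smul_sub, neg_smul 2 (fderiv ℝ (fderiv ℝ θ) z.1 u z.2)]
    abel
  rw [smul_right_injective E (by norm_num : (-2 : ℝ) ≠ 0) e, map_neg, neg_sub,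
    neg_add_eq_sub]

end Spray

/-! ### The spray of a Finsler function in coordinates -/

section LocalFinsler

variable {n : ℕ}

/-- The nonzero vectors over `T`. -/
def slit (T : Set (EuclideanSpace ℝ (Fin n))) :
    Set (EuclideanSpace ℝ (Fin n) × EuclideanSpace ℝ (Fin n)) := {z | z.1 ∈ T ∧ z.2 ≠ 0}

/-- `f` is a Finsler function on the open set `T`. -/
structure IsLocalFinsler (f : EuclideanSpace ℝ (Fin n) → EuclideanSpace ℝ (Fin n) → ℝ)
    (T : Set (EuclideanSpace ℝ (Fin n))) : Prop where
  isOpen : IsOpen T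
  smooth : ContDiffOn ℝ ∞ (fun z : EuclideanSpace ℝ (Fin n) × EuclideanSpace ℝ (Fin n) =>
    f z.1 z.2) (slit T)
  homogeneous : ∀ x ∈ T, ∀ y, ∀ a : ℝ, 0 < a → f x (a • y) = a * f x y
  posDef : ∀ x ∈ T, ∀ y u, y ≠ 0 → u ≠ 0 → 0 < fundamentalForm (f x) y u u

/-- Half the square of `f`. -/
def energy (f : EuclideanSpace ℝ (Fin n) → EuclideanSpace ℝ (Fin n) → ℝ)
    (z : EuclideanSpace ℝ (Fin n) × EuclideanSpace ℝ (Fin n)) : ℝ := (1 / 2) * f z.1 z.2 ^ 2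

variable {f : EuclideanSpace ℝ (Fin n) → EuclideanSpace ℝ (Fin n) → ℝ}
  {T : Set (EuclideanSpace ℝ (Fin n))} (hf : IsLocalFinsler f T)
include hf

theorem IsLocalFinsler.isOpen_slit : IsOpen (slit T) :=
  (hf.isOpen.preimage continuous_fst).inter (isOpen_ne.preimage continuous_snd)

theorem IsLocalFinsler.contDiffOn_energy : ContDiffOn ℝ ∞ (energy f) (slit T) :=
  contDiffOn_const.mul (hf.smooth.pow 2)

theorem IsLocalFinsler.smoothNear_energy {z : EuclideanSpace ℝ (Fin n) × EuclideanSpace ℝ (Fin n)}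
    (hz : z ∈ slit T) : SmoothNear (energy f) z :=
  ContDiffOn.smoothNear hf.contDiffOn_energy (hf.isOpen_slit.mem_nhds hz)

omit hf in
theorem hasDerivAt_line {G : Type*} [NormedAddCommGroup G] [NormedSpace ℝ G]
    {g : EuclideanSpace ℝ (Fin n) × EuclideanSpace ℝ (Fin n) → G}
    {x y : EuclideanSpace ℝ (Fin n)} (hg : DifferentiableAt ℝ g (x, y))
    (u : EuclideanSpace ℝ (Fin n)) :
    HasDerivAt (fun s : ℝ => g (x, y + s • u)) (fderiv ℝ g (x, y) (0, u)) 0 := by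
  have hl : HasDerivAt (fun t : ℝ => (x, y + t • u)) (0, u) (0 : ℝ) := by
    have := ((hasDerivAt_id (0 : ℝ)).smul_const u).const_add y
    rw [one_smul] at this
    exact (hasDerivAt_const 0 x).prodMk this
  exact HasFDerivAt.comp_hasDerivAt_of_eq (f := fun t : ℝ => (x, y + t • u)) (0 : ℝ)
    hg.hasFDerivAt hl (by simp)

theorem IsLocalFinsler.fundamentalForm_eq {x y : EuclideanSpace ℝ (Fin n)}
    (hz : (x, y) ∈ slit T) (u v : EuclideanSpace ℝ (Fin n)) :
    fundamentalForm (f x) y u v = hess (energy f) (x, y) (0, u) (0, v) := by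
  have h1 : ∀ w, (x, w) ∈ slit T → deriv (fun t : ℝ => f x (w + t • v) ^ 2) 0 =
      2 * fderiv ℝ (energy f) (x, w) (0, v) := by
    intro w hw
    rw [← ((hasDerivAt_line (hf.smoothNear_energy hw).differentiableAt v).const_mul 2).deriv]
    congr 1
    ext t
    simp [energy]
  have h2 : (fun s : ℝ => deriv (fun t : ℝ => f x (y + s • u + t • v) ^ 2) 0) =ᶠ[𝓝 0]
      fun s => 2 * fderiv ℝ (energy f) (x, y + s • u) (0, v) := by
    have hc : Tendsto (fun s : ℝ => (x, y + s • u)) (𝓝 0) (𝓝 (x, y)) := by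
      have : Continuous fun s : ℝ => (x, y + s • u) := by fun_prop
      simpa using this.tendsto 0
    filter_upwards [hc.eventually (hf.isOpen_slit.mem_nhds hz)] with s hs using h1 _ hs
  have h3 : HasDerivAt (fun s : ℝ => 2 * fderiv ℝ (energy f) (x, y + s • u) (0, v))
      (2 * hess (energy f) (x, y) (0, u) (0, v)) 0 := by
    have h4 := hasDerivAt_line (hf.smoothNear_energy hz).fderiv.differentiableAt u
    exact ((ContinuousLinearMap.apply ℝ ℝ ((0 : EuclideanSpace ℝ (Fin n)), v)).hasFDerivAt.comp_hasDerivAt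
      (0 : ℝ) h4).const_mul 2
  rw [fundamentalForm, h2.deriv_eq, h3.deriv]
  ring

/-- Euler's relation in degree two, from differentiating `L(x, (1+s)y) = (1+s)² L(x, y)` at `s = 0`.
Positive homogeneity suffices because `1 + s > 0` near `0`. -/
theorem IsLocalFinsler.fderiv_energy_self
    {z : EuclideanSpace ℝ (Fin n) × EuclideanSpace ℝ (Fin n)} (hz : z ∈ slit T) :
    fderiv ℝ (energy f) z (0, z.2) = 2 * energy f z := by
  have hl : HasDerivAt (fun s : ℝ => (z.1, (1 + s) • z.2)) (0, z.2) (0 : ℝ) := by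
    have := ((hasDerivAt_id (0 : ℝ)).const_add 1).smul_const z.2
    rw [one_smul] at this
    exact (hasDerivAt_const 0 z.1).prodMk this
  have hg := (hf.smoothNear_energy hz).differentiableAt.hasFDerivAt
  have e : z = (z.1, (1 + (0 : ℝ)) • z.2) := by simp
  nth_rw 2 [e] at hg
  have h1 := hg.comp_hasDerivAt (0 : ℝ) hl
  have h2 : HasDerivAt (fun s : ℝ => (1 + s) ^ 2 * energy f z) (2 * energy f z) 0 := by
    have := ((((hasDerivAt_id (0 : ℝ)).const_add 1).pow 2)).mul_const (energy f z)
    simpa using! this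
  refine h1.unique (h2.congr_of_eventuallyEq ?_)
  filter_upwards [Ioi_mem_nhds (show (-1 : ℝ) < 0 by norm_num)] with s hs
  have hs' : 0 < 1 + s := by have : -1 < s := hs; linarith
  change (1 / 2) * f z.1 ((1 + s) • z.2) ^ 2 = (1 + s) ^ 2 * ((1 / 2) * f z.1 z.2 ^ 2)
  rw [hf.homogeneous _ hz.1 _ _ hs']
  ring

/-- Euler's relation differentiated in an arbitrary direction `a`. Vertical `a` and horizontal `a`
give the two homogeneity hypotheses of `IsSpray.fderiv_horizontal`. -/
theorem IsLocalFinsler.hess_self {z : EuclideanSpace ℝ (Fin n) × EuclideanSpace ℝ (Fin n)}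
    (hz : z ∈ slit T) (a : EuclideanSpace ℝ (Fin n) × EuclideanSpace ℝ (Fin n)) :
    hess (energy f) z a (0, z.2) =
      2 * fderiv ℝ (energy f) z a - fderiv ℝ (energy f) z (0, a.2) := by
  have hψ : HasFDerivAt (fun z : EuclideanSpace ℝ (Fin n) × EuclideanSpace ℝ (Fin n) =>
      ((0 : EuclideanSpace ℝ (Fin n)), z.2))
      ((0 : _ →L[ℝ] EuclideanSpace ℝ (Fin n)).prod (ContinuousLinearMap.snd ℝ _ _)) z :=
    (hasFDerivAt_const (0 : EuclideanSpace ℝ (Fin n)) z).prodMk hasFDerivAt_snd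
  have e := fderiv_fderiv_comp_apply (hf.smoothNear_energy hz) (hasFDerivAt_id z) hψ a
  have e' : (fun y => fderiv ℝ (energy f) (id y) (0, y.2)) =ᶠ[𝓝 z] fun y => 2 * energy f y := by
    filter_upwards [hf.isOpen_slit.mem_nhds hz] with y hy using hf.fderiv_energy_self hy
  rw [e'.fderiv_eq, fderiv_const_mul (hf.smoothNear_energy hz).differentiableAt] at e
  have e2 : 2 * fderiv ℝ (energy f) z a =
    fderiv ℝ (energy f) z (0, a.2) + hess (energy f) z a (0, z.2) := e
  linarith

theorem IsLocalFinsler.nondeg {z : EuclideanSpace ℝ (Fin n) × EuclideanSpace ℝ (Fin n)}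
    (hz : z ∈ slit T) {w : EuclideanSpace ℝ (Fin n)}
    (hw : hess (energy f) z (0, w) (0, w) = 0) : w = 0 := by
  by_contra hne
  have := hf.posDef z.1 hz.1 z.2 w hz.2 hne
  rw [hf.fundamentalForm_eq hz] at this
  exact this.ne' hw

end LocalFinsler

/-! ### Smooth dependence of the inverse matrix on its entries. -/

section MatrixInverse

theorem contDiffAt_det {F ι : Type*} [NormedAddCommGroup F] [NormedSpace ℝ F] [Fintype ι]
    [DecidableEq ι] {A : F → Matrix ι ι ℝ} {x : F} (h : ∀ i j, ContDiffAt ℝ ∞ (fun y => A y i j) x) :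
    ContDiffAt ℝ ∞ (fun y => (A y).det) x := by
  simp only [Matrix.det_apply]
  exact ContDiffAt.sum fun σ _ => ContDiffAt.const_smul _ (contDiffAt_prod fun i _ => h _ _)

theorem contDiffAt_matrix_inv {F ι : Type*} [NormedAddCommGroup F] [NormedSpace ℝ F] [Fintype ι]
    [DecidableEq ι] {A : F → Matrix ι ι ℝ} {x : F} (h : ∀ i j, ContDiffAt ℝ ∞ (fun y => A y i j) x)
    (hd : (A x).det ≠ 0) (i j : ι) : ContDiffAt ℝ ∞ (fun y => (A y)⁻¹ i j) x := by
  simp only [Matrix.inv_def, Matrix.smul_apply, Ring.inverse_eq_inv', smul_eq_mul,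
    Matrix.adjugate_apply]
  refine ((contDiffAt_det h).inv hd).mul (contDiffAt_det fun a b => ?_)
  by_cases hab : a = j
  · subst hab
    simp only [Matrix.updateRow_self]
    exact contDiffAt_const
  · simp only [Matrix.updateRow_ne hab]
    exact h a b

end MatrixInverse

/-! ### The classical coordinate formula for the spray and its Euler–Lagrange form. -/

section Spray

variable {n : ℕ} {M : Type*} [TopologicalSpace M] [ChartedSpace (EuclideanSpace ℝ (Fin n)) M]
  [IsManifold (𝓡 n) ∞ M] (F : TangentBundle (𝓡 n) M → ℝ)

/-- The vector of spray coefficients. -/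
def sprayVec (p : M) (z : EuclideanSpace ℝ (Fin n) × EuclideanSpace ℝ (Fin n)) :
    EuclideanSpace ℝ (Fin n) := WithLp.toLp 2 fun i => spray F p i z.1 z.2

theorem sum_smul_coordVec (y : EuclideanSpace ℝ (Fin n)) : ∑ j, y j • coordVec j = y := by
  ext i
  simp [coordVec, Pi.single_apply]

theorem sum_map_coordVec {G : Type*} [AddCommGroup G] [Module ℝ G]
    (A : EuclideanSpace ℝ (Fin n) →ₗ[ℝ] G) (y : EuclideanSpace ℝ (Fin n)) :
    ∑ j, y j • A (coordVec j) = A y := by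
  conv_rhs => rw [← sum_smul_coordVec y]
  simp

variable {F} {p : M} {T : Set (EuclideanSpace ℝ (Fin n))} (hf : IsLocalFinsler (localF F p) T)
include hf

theorem metricMatrix_eq {x y : EuclideanSpace ℝ (Fin n)} (hz : (x, y) ∈ slit T) (i j : Fin n) :
    metricMatrix F p x y i j =
      hess (energy (localF F p)) (x, y) (0, coordVec i) (0, coordVec j) :=
  hf.fundamentalForm_eq hz _ _

theorem metricMatrix_mulVec {x y : EuclideanSpace ℝ (Fin n)} (hz : (x, y) ∈ slit T)
    (w : EuclideanSpace ℝ (Fin n)) (i : Fin n) :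
    (metricMatrix F p x y).mulVec w i =
      hess (energy (localF F p)) (x, y) (0, w) (0, coordVec i) := by
  have := sum_map_coordVec ((((fderiv ℝ (fderiv ℝ (energy (localF F p))) (x, y)).flip
    (0, coordVec i)).comp (ContinuousLinearMap.inr ℝ (EuclideanSpace ℝ (Fin n))
      (EuclideanSpace ℝ (Fin n)))) : EuclideanSpace ℝ (Fin n) →ₗ[ℝ] ℝ) w
  refine Eq.trans ?_ this
  rw [Matrix.mulVec, dotProduct]
  refine Finset.sum_congr rfl fun j _ => ?_
  rw [metricMatrix_eq hf hz, hess_comm (hf.smoothNear_energy hz), mul_comm]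
  rfl

theorem metricMatrix_det_ne_zero {x y : EuclideanSpace ℝ (Fin n)} (hz : (x, y) ∈ slit T) :
    (metricMatrix F p x y).det ≠ 0 := by
  intro h0
  obtain ⟨w, hw, hw0⟩ := Matrix.exists_mulVec_eq_zero_iff.2 h0
  refine hw ?_
  have h1 : ∀ i, hess (energy (localF F p)) (x, y) (0, WithLp.toLp 2 w) (0, coordVec i) = 0 := by
    intro i
    rw [← metricMatrix_mulVec hf hz]
    exact congrFun hw0 i
  have h2 : hess (energy (localF F p)) (x, y) (0, WithLp.toLp 2 w) (0, WithLp.toLp 2 w) = 0 := by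
    have := sum_map_coordVec ((((fderiv ℝ (fderiv ℝ (energy (localF F p))) (x, y)
      (0, WithLp.toLp 2 w))).comp (ContinuousLinearMap.inr ℝ (EuclideanSpace ℝ (Fin n))
      (EuclideanSpace ℝ (Fin n)))) : EuclideanSpace ℝ (Fin n) →ₗ[ℝ] ℝ) (WithLp.toLp 2 w)
    refine this.symm.trans (Finset.sum_eq_zero fun i _ => ?_)
    exact (congrArg _ (h1 i)).trans (smul_zero _)
  have := hf.nondeg hz h2
  exact congrArg WithLp.ofLp this

theorem metricDeriv_eq {x y : EuclideanSpace ℝ (Fin n)} (hz : (x, y) ∈ slit T) (i j k : Fin n) :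
    metricDeriv F p i j k x y = fderiv ℝ (fun x' => fderiv ℝ (fderiv ℝ (energy (localF F p)))
      (x', y)) x (coordVec k) (0, coordVec i) (0, coordVec j) := by
  have hd : HasFDerivAt (fun x' => fderiv ℝ (fderiv ℝ (energy (localF F p))) (x', y)) _ x :=
    ((hf.smoothNear_energy hz).fderiv.fderiv.differentiableAt.comp x
      (f := fun x' => (x', y)) (by fun_prop)).hasFDerivAt
  have hd2 := (hd.clm_apply (hasFDerivAt_const ((0 : EuclideanSpace ℝ (Fin n)), coordVec i) x)).clm_apply
    (hasFDerivAt_const ((0 : EuclideanSpace ℝ (Fin n)), coordVec j) x)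
  have hev : (fun x' => metricMatrix F p x' y i j) =ᶠ[𝓝 x]
      fun x' => fderiv ℝ (fderiv ℝ (energy (localF F p))) (x', y) (0, coordVec i)
        (0, coordVec j) := by
    filter_upwards [hf.isOpen.mem_nhds hz.1] with x' hx'
    exact metricMatrix_eq hf ⟨hx', hz.2⟩ i j
  have hd3 := hd2.congr_of_eventuallyEq hev
  rw [metricDeriv, hd3.differentiableAt.lineDeriv_eq_fderiv, hd3.fderiv]
  simp
  rfl

/-- The relation `L_{yy} y = L_y` holds at every `x` with `y` fixed, so it may be differentiated in
`x`. A third derivative contracted with `y` thereby becomes a second one. -/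
theorem fderiv_hess_self {x y : EuclideanSpace ℝ (Fin n)} (hz : (x, y) ∈ slit T)
    (a b : EuclideanSpace ℝ (Fin n)) :
    fderiv ℝ (fun x' => fderiv ℝ (fderiv ℝ (energy (localF F p))) (x', y)) x a (0, y) (0, b) =
      hess (energy (localF F p)) (x, y) (a, 0) (0, b) := by
  have hd : HasFDerivAt (fun x' => fderiv ℝ (fderiv ℝ (energy (localF F p))) (x', y)) _ x :=
    ((hf.smoothNear_energy hz).fderiv.fderiv.differentiableAt.comp x
      (f := fun x' => (x', y)) (by fun_prop)).hasFDerivAt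
  have hd2 := (hd.clm_apply (hasFDerivAt_const ((0 : EuclideanSpace ℝ (Fin n)), y) x)).clm_apply
    (hasFDerivAt_const ((0 : EuclideanSpace ℝ (Fin n)), b) x)
  have hev : (fun x' => fderiv ℝ (fderiv ℝ (energy (localF F p))) (x', y) (0, y) (0, b))
      =ᶠ[𝓝 x] fun x' => fderiv ℝ (energy (localF F p)) (x', y) (0, b) := by
    filter_upwards [hf.isOpen.mem_nhds hz.1] with x' hx'
    have hz' : (x', y) ∈ slit T := ⟨hx', hz.2⟩
    have := hf.hess_self hz' (0, b)
    rw [hess_comm (hf.smoothNear_energy hz')] at this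
    refine this.trans ?_
    ring
  have e1 := fderiv_fderiv_comp_apply (φ := fun x' => (x', y))
    (ψ := fun _ => ((0 : EuclideanSpace ℝ (Fin n)), b)) (hf.smoothNear_energy hz)
    ((hasFDerivAt_id x).prodMk (hasFDerivAt_const y x))
    (hasFDerivAt_const ((0 : EuclideanSpace ℝ (Fin n)), b) x) a
  have e2 := hd2.fderiv
  rw [hev.fderiv_eq] at e2
  have e3 := congrArg (fun A : EuclideanSpace ℝ (Fin n) →L[ℝ] ℝ => A a) e2
  have e4 := e3.symm.trans e1
  simpa using! e4

/-- Of the two contractions with `y ⊗ y`, the first collapses to `L_{xy}(y, e_l)` and the second to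
`L_{xy}(e_l, y) = 2 L_x(e_l)`. This turns the factor `1/4` into `1/2` and removes the third
derivatives. -/
theorem spray_eq {x y : EuclideanSpace ℝ (Fin n)} (hz : (x, y) ∈ slit T) (i : Fin n) :
    spray F p i x y = ∑ l, (metricMatrix F p x y)⁻¹ i l * ((1 / 2) *
      (hess (energy (localF F p)) (x, y) (y, 0) (0, coordVec l) -
        fderiv ℝ (energy (localF F p)) (x, y) (coordVec l, 0))) := by
  rw [spray, Finset.mul_sum]
  refine Finset.sum_congr rfl fun l _ => ?_
  set B := fderiv ℝ (fun x' => fderiv ℝ (fderiv ℝ (energy (localF F p))) (x', y)) x with hB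
  set ι := ContinuousLinearMap.inr ℝ (EuclideanSpace ℝ (Fin n)) (EuclideanSpace ℝ (Fin n))
  have s1 : ∑ j, ∑ k, B (coordVec k) (0, coordVec j) (0, coordVec l) * y j * y k =
      B y (0, y) (0, coordVec l) := by
    have h1 : ∀ j, ∑ k, B (coordVec k) (0, coordVec j) (0, coordVec l) * y j * y k =
        y j * B y (0, coordVec j) (0, coordVec l) := by
      intro j
      have := sum_map_coordVec ((B.flip (0, coordVec j)).flip (0, coordVec l) :
        EuclideanSpace ℝ (Fin n) →ₗ[ℝ] ℝ) y
      refine Eq.trans ?_ (congrArg (y j * ·) this)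
      dsimp only
      rw [Finset.mul_sum]
      refine Finset.sum_congr rfl fun k _ => ?_
      change _ = y j * (y k * B (coordVec k) (0, coordVec j) (0, coordVec l))
      ring
    simp only [h1]
    exact sum_map_coordVec (((B y).flip (0, coordVec l)).comp ι :
        EuclideanSpace ℝ (Fin n) →ₗ[ℝ] ℝ) y
  have s2 : ∑ j, ∑ k, B (coordVec l) (0, coordVec j) (0, coordVec k) * y j * y k =
      B (coordVec l) (0, y) (0, y) := by
    have h1 : ∀ j, ∑ k, B (coordVec l) (0, coordVec j) (0, coordVec k) * y j * y k =
        y j * B (coordVec l) (0, coordVec j) (0, y) := by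
      intro j
      have := sum_map_coordVec ((B (coordVec l) (0, coordVec j)).comp ι :
        EuclideanSpace ℝ (Fin n) →ₗ[ℝ] ℝ) y
      refine Eq.trans ?_ (congrArg (y j * ·) this)
      dsimp only
      rw [Finset.mul_sum]
      refine Finset.sum_congr rfl fun k _ => ?_
      change _ = y j * (y k * B (coordVec l) (0, coordVec j) (0, coordVec k))
      ring
    simp only [h1]
    exact sum_map_coordVec (((B (coordVec l)).flip (0, y)).comp ι :
        EuclideanSpace ℝ (Fin n) →ₗ[ℝ] ℝ) y
  rw [hB, fderiv_hess_self hf hz] at s1 s2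
  have e2 := hf.hess_self hz (coordVec l, 0)
  have e3 : fderiv ℝ (energy (localF F p)) (x, y) (0, (coordVec l, (0 : EuclideanSpace ℝ (Fin n))).2)
    = 0 := map_zero (fderiv ℝ (energy (localF F p)) (x, y))
  rw [e3] at e2
  simp only [metricDeriv_eq hf hz]
  have e4 : ∀ c : ℝ, ∀ (a b : Fin n → Fin n → ℝ), (1 / 4) * ∑ j, ∑ k, c * (2 * a j k - b j k) *
      y j * y k = c * ((1 / 4) * (2 * ∑ j, ∑ k, a j k * y j * y k - ∑ j, ∑ k, b j k * y j * y k)) := by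
    intro c a b
    simp only [Finset.mul_sum, ← Finset.sum_sub_distrib]
    refine Finset.sum_congr rfl fun j _ => Finset.sum_congr rfl fun k _ => ?_
    ring
  rw [e4, s1, s2, e2]
  ring

theorem contDiffAt_hess_energy {z : EuclideanSpace ℝ (Fin n) × EuclideanSpace ℝ (Fin n)}
    (hz : z ∈ slit T)
    {a b : EuclideanSpace ℝ (Fin n) × EuclideanSpace ℝ (Fin n) →
      EuclideanSpace ℝ (Fin n) × EuclideanSpace ℝ (Fin n)} (ha : ContDiffAt ℝ ∞ a z)
    (hb : ContDiffAt ℝ ∞ b z) :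
    ContDiffAt ℝ ∞ (fun z => hess (energy (localF F p)) z (a z) (b z)) z :=
  ((hf.smoothNear_energy hz).fderiv.fderiv.contDiffAt.clm_apply ha).clm_apply hb

theorem contDiffOn_sprayVec : ContDiffOn ℝ ∞ (sprayVec F p) (slit T) := by
  rw [contDiffOn_euclidean]
  intro i
  have h1 : ContDiffOn ℝ ∞ (fun z : EuclideanSpace ℝ (Fin n) × EuclideanSpace ℝ (Fin n) =>
      ∑ l, (metricMatrix F p z.1 z.2)⁻¹ i l * ((1 / 2) *
      (hess (energy (localF F p)) z (z.2, 0) (0, coordVec l) -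
        fderiv ℝ (energy (localF F p)) z (coordVec l, 0)))) (slit T) := by
    intro z hz
    refine ContDiffAt.contDiffWithinAt (ContDiffAt.sum fun l _ => ContDiffAt.mul ?_
      (contDiffAt_const.mul (ContDiffAt.sub ?_ ?_)))
    · refine contDiffAt_matrix_inv (A := fun z : EuclideanSpace ℝ (Fin n) × EuclideanSpace ℝ (Fin n) =>
        metricMatrix F p z.1 z.2) (fun a b => ?_) (metricMatrix_det_ne_zero hf hz) i l
      refine (contDiffAt_hess_energy hf hz (a := fun _ => (0, coordVec a))
        (b := fun _ => (0, coordVec b)) contDiffAt_const contDiffAt_const).congr_of_eventuallyEq ?_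
      filter_upwards [hf.isOpen_slit.mem_nhds hz] with w hw using metricMatrix_eq hf hw a b
    · exact contDiffAt_hess_energy hf hz (contDiffAt_snd.prodMk contDiffAt_const) contDiffAt_const
    · exact (hf.smoothNear_energy hz).fderiv.contDiffAt.clm_apply contDiffAt_const
  exact h1.congr fun z hz => spray_eq hf hz i

/-- Multiplying `spray_eq` by the metric matrix cancels the inverse and gives the Euler–Lagrange
equation on coordinate vectors; both sides are linear in `u`. -/
theorem isSpray : IsSpray (energy (localF F p)) (slit T) (sprayVec F p) where
  isOpen := hf.isOpen_slit
  smooth := hf.contDiffOn_energy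
  smooth_coeff := contDiffOn_sprayVec hf
  nondeg z hz w hw := hf.nondeg hz (hw w)
  euler_lagrange z hz u := by
    have hz' : (z.1, z.2) ∈ slit T := hz
    have h1 : ∀ l, hess (energy (localF F p)) z (0, sprayVec F p z) (0, coordVec l) = (1 / 2) *
      (hess (energy (localF F p)) z (z.2, 0) (0, coordVec l) -
        fderiv ℝ (energy (localF F p)) z (coordVec l, 0)) := by
      intro l
      have e1 := metricMatrix_mulVec hf hz' (sprayVec F p z) l
      have e2 : (sprayVec F p z : Fin n → ℝ) = (metricMatrix F p z.1 z.2)⁻¹.mulVec fun l => (1 / 2) *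
        (hess (energy (localF F p)) z (z.2, 0) (0, coordVec l) -
        fderiv ℝ (energy (localF F p)) z (coordVec l, 0)) := funext fun i => spray_eq hf hz' i
      rw [e2, Matrix.mulVec_mulVec, Matrix.mul_nonsing_inv _
        (isUnit_iff_ne_zero.2 (metricMatrix_det_ne_zero hf hz')), Matrix.one_mulVec] at e1
      exact e1.symm
    have h2 : ∀ l, hess (energy (localF F p)) z (z.2, (-2 : ℝ) • sprayVec F p z) (0, coordVec l) =
        fderiv ℝ (energy (localF F p)) z (coordVec l, 0) := by
      intro l
      have e : (z.2, (-2 : ℝ) • sprayVec F p z) =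
        (z.2, (0 : EuclideanSpace ℝ (Fin n))) + (-2 : ℝ) • (0, sprayVec F p z) := by simp
      rw [e, hess_add_left, hess_smul_left, h1]
      ring
    have e1 := sum_map_coordVec ((fderiv ℝ (fderiv ℝ (energy (localF F p))) z
      (z.2, (-2 : ℝ) • sprayVec F p z)).comp (ContinuousLinearMap.inr ℝ _ _) :
        EuclideanSpace ℝ (Fin n) →ₗ[ℝ] ℝ) u
    have e2 := sum_map_coordVec ((fderiv ℝ (energy (localF F p)) z).comp
      (ContinuousLinearMap.inl ℝ _ _) : EuclideanSpace ℝ (Fin n) →ₗ[ℝ] ℝ) u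
    refine e1.symm.trans (Eq.trans (Finset.sum_congr rfl fun l _ => ?_) e2)
    exact congrArg (u l * ·) (h2 l)

theorem connCoeff_eq {z : EuclideanSpace ℝ (Fin n) × EuclideanSpace ℝ (Fin n)} (hz : z ∈ slit T)
    (u : EuclideanSpace ℝ (Fin n)) :
    (WithLp.toLp 2 fun i => -∑ j, connCoeff F p i j z.1 z.2 * u j : EuclideanSpace ℝ (Fin n)) =
      -fderiv ℝ (sprayVec F p) z (0, u) := by
  have hd := ((isSpray hf).smoothNear_coeff hz).differentiableAt.hasFDerivAt
  ext i
  change -∑ j, connCoeff F p i j z.1 z.2 * u j = -(fderiv ℝ (sprayVec F p) z (0, u) i)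
  have hi : HasFDerivAt (fun w => sprayVec F p w i) ((EuclideanSpace.proj i : EuclideanSpace ℝ (Fin n) →L[ℝ] ℝ).comp
    (fderiv ℝ (sprayVec F p) z)) z :=
    (EuclideanSpace.proj i : EuclideanSpace ℝ (Fin n) →L[ℝ] ℝ).hasFDerivAt.comp z hd
  have h1 : ∀ j, connCoeff F p i j z.1 z.2 = fderiv ℝ (sprayVec F p) z (0, coordVec j) i := by
    intro j
    have h2 : HasFDerivAt (fun y' => spray F p i z.1 y') _ z.2 :=
      HasFDerivAt.comp (f := fun y => (z.1, y)) z.2 hi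
        ((hasFDerivAt_const z.1 z.2).prodMk (hasFDerivAt_id z.2))
    rw [connCoeff, h2.differentiableAt.lineDeriv_eq_fderiv, h2.fderiv]
    rfl
  have e1 := sum_map_coordVec (((EuclideanSpace.proj i : EuclideanSpace ℝ (Fin n) →L[ℝ] ℝ).comp
    (fderiv ℝ (sprayVec F p) z)).comp (ContinuousLinearMap.inr ℝ _ _) :
        EuclideanSpace ℝ (Fin n) →ₗ[ℝ] ℝ) u
  refine congrArg Neg.neg (Eq.trans (Finset.sum_congr rfl fun j _ => ?_) e1)
  rw [h1, mul_comm]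
  rfl

end Spray

/-! ### Charts of the tangent bundle -/

section TangentCharts

variable {E : Type*} [NormedAddCommGroup E] [NormedSpace ℝ E]
  {H : Type*} [TopologicalSpace H] {I : ModelWithCorners ℝ E H}
  {M : Type*} [TopologicalSpace M] [ChartedSpace H M] [IsManifold I ∞ M]

theorem extChartAt_tangent_apply (v w : TangentBundle I M) :
    extChartAt I.tangent v w =
      ((extChartAt I v.proj w.proj, tangentCoordChange I w.proj v.proj w.proj w.2) : E × E) := rfl

theorem extChartAt_tangent_source (v : TangentBundle I M) :
    (extChartAt I.tangent v).source = {w | w.proj ∈ (extChartAt I v.proj).source} := by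
  ext w
  rw [extChartAt_source, extChartAt_source]
  exact TangentBundle.mem_chart_source_iff w v

theorem extChartAt_tangent_target (v : TangentBundle I M) :
    (extChartAt I.tangent v).target = (extChartAt I v.proj).target ×ˢ univ := by
  refine (FiberBundle.extChartAt_target (IB := I) (F := E) v).trans ?_
  congr 1
  refine inter_eq_left.2 fun z hz => ?_
  have := (extChartAt I v.proj).map_target hz
  rwa [extChartAt_source] at this

theorem extChartAt_tangent_symm (v : TangentBundle I M) {z : E × E}
    (hz : z.1 ∈ (extChartAt I v.proj).target) :
    (extChartAt I.tangent v).symm z = (⟨(extChartAt I v.proj).symm z.1,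
      (tangentCoordChange I v.proj ((extChartAt I v.proj).symm z.1)
        ((extChartAt I v.proj).symm z.1) z.2 : E)⟩ : TangentBundle I M) := by
  have hq := (extChartAt I v.proj).map_target hz
  refine (extChartAt I.tangent v).injOn
    ((extChartAt I.tangent v).map_target (by rw [extChartAt_tangent_target]; exact ⟨hz, trivial⟩))
    (by rw [extChartAt_tangent_source]; exact hq) ?_
  rw [(extChartAt I.tangent v).right_inv (by rw [extChartAt_tangent_target]; exact ⟨hz, trivial⟩),
    extChartAt_tangent_apply]
  refine Prod.ext ((extChartAt I v.proj).right_inv hz).symm ?_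
  change z.2 = tangentCoordChange I _ v.proj _ (tangentCoordChange I v.proj _ _ z.2)
  rw [tangentCoordChange_comp ⟨⟨hq, mem_extChartAt_source _⟩, hq⟩, tangentCoordChange_self hq]

theorem smoothNear_extChartAt_symm [I.Boundaryless] {p q : M} {x : E}
    (hx : x ∈ (extChartAt I q).target)
    (hp : (extChartAt I q).symm x ∈ (extChartAt I p).source) :
    SmoothNear (extChartAt I p ∘ (extChartAt I q).symm) x := by
  have ho : IsOpen ((extChartAt I q).symm.trans (extChartAt I p)).source := by
    rw [PartialEquiv.trans_source]
    exact (continuousOn_extChartAt_symm q).isOpen_inter_preimage (isOpen_extChartAt_target q)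
      (isOpen_extChartAt_source p)
  exact ContDiffOn.smoothNear (contDiffOn_ext_coord_change p q) (ho.mem_nhds ⟨hx, hp⟩)

theorem fderiv_extChartAt_symm [I.Boundaryless] {p q : M} {x : E}
    (hx : x ∈ (extChartAt I q).target) :
    fderiv ℝ (extChartAt I p ∘ (extChartAt I q).symm) x =
      (tangentCoordChange I q p ((extChartAt I q).symm x) : E →L[ℝ] E) := by
  rw [tangentCoordChange_def, I.range_eq_univ, fderivWithin_univ, (extChartAt I q).right_inv hx]

/-- Coordinate changes of `TM` are tangent maps of coordinate changes of `M`, which is the situation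
treated by `IsSpray.horizontal_transform`. -/
theorem extChartAt_tangent_coordChange [I.Boundaryless] {v w : TangentBundle I M} {z : E × E}
    (hz : z.1 ∈ (extChartAt I w.proj).target)
    (hv : (extChartAt I w.proj).symm z.1 ∈ (extChartAt I v.proj).source) :
    extChartAt I.tangent v ((extChartAt I.tangent w).symm z) =
      tangentLift (extChartAt I v.proj ∘ (extChartAt I w.proj).symm) z := by
  rw [extChartAt_tangent_symm w hz, extChartAt_tangent_apply]
  refine Prod.ext rfl ?_
  change tangentCoordChange I _ v.proj _ (tangentCoordChange I w.proj _ _ z.2) =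
    fderiv ℝ (extChartAt I v.proj ∘ (extChartAt I w.proj).symm) z.1 z.2
  rw [tangentCoordChange_comp ⟨⟨(extChartAt I w.proj).map_target hz, mem_extChartAt_source _⟩, hv⟩,
    fderiv_extChartAt_symm hz]

theorem tangentCoordChange_injective {p q : M} (hq : q ∈ (extChartAt I p).source) :
    Function.Injective (tangentCoordChange I p q q : E →L[ℝ] E) := by
  refine Function.LeftInverse.injective (g := (tangentCoordChange I q p q : E → E)) fun y => ?_
  rw [tangentCoordChange_comp ⟨⟨hq, mem_extChartAt_source _⟩, hq⟩, tangentCoordChange_self hq]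

theorem surjective_tangentCoordChange {p q x : M} (hq : x ∈ (extChartAt I p).source)
    (hp : x ∈ (extChartAt I q).source) :
    Function.Surjective (tangentCoordChange I p q x : E →L[ℝ] E) := by
  refine Function.RightInverse.surjective (g := (tangentCoordChange I q p x : E → E)) fun y => ?_
  rw [tangentCoordChange_comp ⟨⟨hp, hq⟩, hp⟩, tangentCoordChange_self hp]

end TangentCharts

/-! ### Finsler functions on a manifold seen in charts. -/

section Finsler

variable {n : ℕ} {M : Type*} [TopologicalSpace M] [ChartedSpace (EuclideanSpace ℝ (Fin n)) M]
  [IsManifold (𝓡 n) ∞ M] {F : TangentBundle (𝓡 n) M → ℝ}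

/-- The open set of nonzero tangent vectors. -/
def nonzeroVectors (n : ℕ) (M : Type*) [TopologicalSpace M]
    [ChartedSpace (EuclideanSpace ℝ (Fin n)) M] [IsManifold (𝓡 n) ∞ M] :
    Set (TangentBundle (𝓡 n) M) := {v | v.2 ≠ 0}

theorem symm_mem_nonzeroVectors {v : TangentBundle (𝓡 n) M}
    {z : EuclideanSpace ℝ (Fin n) × EuclideanSpace ℝ (Fin n)}
    (hz : z.1 ∈ (extChartAt (𝓡 n) v.proj).target) :
    (extChartAt (𝓡 n).tangent v).symm z ∈ nonzeroVectors n M ↔ z.2 ≠ 0 := by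
  rw [extChartAt_tangent_symm v hz]
  refine not_congr ⟨fun h => ?_, fun h => ?_⟩
  · exact tangentCoordChange_injective ((extChartAt (𝓡 n) v.proj).map_target hz)
      (h.trans (map_zero _).symm)
  · exact (congrArg (tangentCoordChange (𝓡 n) v.proj _ _) h).trans (map_zero _)

theorem extChartAt_mem_slit {v w : TangentBundle (𝓡 n) M}
    (hw : w.proj ∈ (extChartAt (𝓡 n) v.proj).source) (h0 : w ∈ nonzeroVectors n M) :
    extChartAt (𝓡 n).tangent v w ∈ slit (extChartAt (𝓡 n) v.proj).target := by
  have h1 := (extChartAt (𝓡 n) v.proj).map_source hw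
  refine ⟨h1, ?_⟩
  rw [← symm_mem_nonzeroVectors (v := v) (z := extChartAt (𝓡 n).tangent v w) h1,
    (extChartAt (𝓡 n).tangent v).left_inv (by rw [extChartAt_tangent_source]; exact hw)]
  exact h0

theorem isOpen_nonzeroVectors : IsOpen (nonzeroVectors n M) := by
  rw [isOpen_iff_mem_nhds]
  intro v hv
  have h1 : extChartAt (𝓡 n).tangent v v ∈ slit (extChartAt (𝓡 n) v.proj).target :=
    extChartAt_mem_slit (mem_extChartAt_source _) hv
  have h2 : IsOpen (slit (extChartAt (𝓡 n) v.proj).target) :=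
    ((isOpen_extChartAt_target v.proj).preimage continuous_fst).inter
      (isOpen_ne.preimage continuous_snd)
  filter_upwards [(continuousAt_extChartAt (I := (𝓡 n).tangent) v).preimage_mem_nhds
    (h2.mem_nhds h1), extChartAt_source_mem_nhds (I := (𝓡 n).tangent) v] with w hw hw'
  have := (symm_mem_nonzeroVectors (v := v) hw.1).2 hw.2
  rwa [(extChartAt (𝓡 n).tangent v).left_inv hw'] at this

/-- The chart of `TM` at a vector depends only on its base point, so replacing `⟨p, 0⟩` by `v` is
definitional. -/
theorem localF_eq (v : TangentBundle (𝓡 n) M) (x y : EuclideanSpace ℝ (Fin n)) :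
    localF F v.proj x y = F ((extChartAt (𝓡 n).tangent v).symm (x, y)) := rfl

theorem localF_eq_of_mem (F : TangentBundle (𝓡 n) M → ℝ) {p : M} {x : EuclideanSpace ℝ (Fin n)}
    (hx : x ∈ (extChartAt (𝓡 n) p).target) (y : EuclideanSpace ℝ (Fin n)) :
    localF F p x y = F (⟨(extChartAt (𝓡 n) p).symm x,
      (tangentCoordChange (𝓡 n) p ((extChartAt (𝓡 n) p).symm x)
        ((extChartAt (𝓡 n) p).symm x) y : EuclideanSpace ℝ (Fin n))⟩ : TangentBundle (𝓡 n) M) :=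
  congrArg F (extChartAt_tangent_symm (⟨p, 0⟩ : TangentBundle (𝓡 n) M) (z := (x, y)) hx)

theorem isLocalFinsler (hF : IsFinsler F) (p : M) :
    IsLocalFinsler (localF F p) (extChartAt (𝓡 n) p).target where
  isOpen := isOpen_extChartAt_target p
  smooth := by
    have h0 : ContMDiffOn 𝓘(ℝ, EuclideanSpace ℝ (Fin n) × EuclideanSpace ℝ (Fin n)) (𝓡 n).tangent ∞
        (extChartAt (𝓡 n).tangent (⟨p, 0⟩ : TangentBundle (𝓡 n) M)).symm
        (slit (extChartAt (𝓡 n) p).target) :=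
      (contMDiffOn_extChartAt_symm (I := (𝓡 n).tangent) (n := ∞)
      (⟨p, 0⟩ : TangentBundle (𝓡 n) M)).mono fun z hz => by
        rw [extChartAt_tangent_target]; exact ⟨hz.1, trivial⟩
    exact contMDiffOn_iff_contDiffOn.1 (hF.smooth.comp h0
      fun z hz => (symm_mem_nonzeroVectors (v := (⟨p, 0⟩ : TangentBundle (𝓡 n) M)) hz.1).2 hz.2)
  homogeneous x hx y a ha := by
    have key : ∀ A : EuclideanSpace ℝ (Fin n) →L[ℝ] EuclideanSpace ℝ (Fin n),
        F ⟨(extChartAt (𝓡 n) p).symm x, A (a • y)⟩ =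
          a * F ⟨(extChartAt (𝓡 n) p).symm x, A y⟩ := fun A => by
      rw [A.map_smul]
      exact hF.homogeneous ((extChartAt (𝓡 n) p).symm x) (A y) a ha
    rw [localF_eq_of_mem F hx, localF_eq_of_mem F hx]
    exact key (tangentCoordChange (𝓡 n) p ((extChartAt (𝓡 n) p).symm x)
      ((extChartAt (𝓡 n) p).symm x))
  posDef x hx y u hy hu := by
    set q := (extChartAt (𝓡 n) p).symm x with hq
    have hqs : q ∈ (extChartAt (𝓡 n) p).source := (extChartAt (𝓡 n) p).map_target hx
    let A : EuclideanSpace ℝ (Fin n) →L[ℝ] EuclideanSpace ℝ (Fin n) :=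
      tangentCoordChange (𝓡 n) p q q
    have hA : Function.Injective A := tangentCoordChange_injective hqs
    have e : localF F p x = fun w => F ⟨q, A w⟩ := by
      funext w
      exact localF_eq_of_mem F hx w
    have := hF.posDef q (A y) (A u) (fun h => hy (hA (h.trans (map_zero A).symm)))
      (fun h => hu (hA (h.trans (map_zero A).symm)))
    refine this.trans_eq ?_
    rw [e]
    have key : ∀ s t : ℝ, A (y + s • u + t • u) = A y + s • A u + t • A u := by
      intro s t; simp
    simp only [fundamentalForm, key]
    rfl

end Finsler

theorem chartField_extChartAt {E : Type*} [NormedAddCommGroup E] [NormedSpace ℝ E]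
    {H : Type*} [TopologicalSpace H] {J : ModelWithCorners ℝ E H}
    {N : Type*} [TopologicalSpace N] [ChartedSpace H N] [IsManifold J ∞ N]
    (V : ∀ v : N, TangentSpace J v) {p q : N} (hq : q ∈ (extChartAt J p).source) :
    chartField J V p (extChartAt J p q) = (tangentCoordChange J q p q (V q) : E) := by
  -- The type of `V q'` depends on `q'`, so the equality of points is eliminated by substitution
  -- rather than by rewriting.
  have key : ∀ q', q' = q → (tangentCoordChange J q' p q' (V q') : E) =
      tangentCoordChange J q p q (V q) := by
    rintro _ rfl
    rfl
  exact key _ ((extChartAt J p).left_inv hq)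

/-! ### The horizontal distribution -/

section Horizontal

variable {n : ℕ} {M : Type*} [TopologicalSpace M] [ChartedSpace (EuclideanSpace ℝ (Fin n)) M]
  [IsManifold (𝓡 n) ∞ M] {F : TangentBundle (𝓡 n) M → ℝ}

theorem horizontalLift_eq (hF : IsFinsler F) {v : TangentBundle (𝓡 n) M}
    (hv : v ∈ nonzeroVectors n M) (ξ : EuclideanSpace ℝ (Fin n)) :
    horizontalLift F v ξ =
      ((ξ, -fderiv ℝ (sprayVec F v.proj) (extChartAt (𝓡 n).tangent v v) (0, ξ)) :
        EuclideanSpace ℝ (Fin n) × EuclideanSpace ℝ (Fin n)) :=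
  Prod.ext rfl (connCoeff_eq (isLocalFinsler hF v.proj)
    (extChartAt_mem_slit (mem_extChartAt_source _) hv) ξ)

theorem fderiv_energy_horizontal (hF : IsFinsler F) (p : M)
    {z : EuclideanSpace ℝ (Fin n) × EuclideanSpace ℝ (Fin n)}
    (hz : z ∈ slit (extChartAt (𝓡 n) p).target) (u : EuclideanSpace ℝ (Fin n)) :
    fderiv ℝ (energy (localF F p)) z (u, -fderiv ℝ (sprayVec F p) z (0, u)) = 0 := by
  have hf := isLocalFinsler hF p
  refine (isSpray hf).fderiv_horizontal (fun z hz u => ?_) (fun z hz a => ?_) hz u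
  · rw [hf.hess_self hz]
    ring
  · rw [hf.hess_self hz]
    have : fderiv ℝ (energy (localF F p)) z ((0 : EuclideanSpace ℝ (Fin n)),
      (a, (0 : EuclideanSpace ℝ (Fin n))).2) = 0 := map_zero (fderiv ℝ (energy (localF F p)) z)
    rw [this, sub_zero]

/-- The lift at a vector `q` is defined in the chart at the base point of `q`, a chart that varies
with `q`. The transformation law of horizontal vectors expresses all nearby lifts in the single
chart at `v`, where the formula is visibly smooth. -/
theorem chartField_horizontalLiftField (hF : IsFinsler F) (X : ∀ x : M, TangentSpace (𝓡 n) x)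
    (v : TangentBundle (𝓡 n) M) {z : EuclideanSpace ℝ (Fin n) × EuclideanSpace ℝ (Fin n)}
    (hz : z ∈ slit (extChartAt (𝓡 n) v.proj).target) :
    chartField (𝓡 n).tangent (horizontalLiftField F X) v z =
      (chartField (𝓡 n) X v.proj z.1,
        -fderiv ℝ (sprayVec F v.proj) z (0, chartField (𝓡 n) X v.proj z.1)) := by
  have hzt : z ∈ (extChartAt (𝓡 n).tangent v).target := by
    rw [extChartAt_tangent_target]; exact ⟨hz.1, trivial⟩
  set q := (extChartAt (𝓡 n).tangent v).symm z with hq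
  have hqs : q.proj ∈ (extChartAt (𝓡 n) v.proj).source := (extChartAt (𝓡 n) v.proj).map_target hz.1
  have hq0 : q ∈ nonzeroVectors n M := (symm_mem_nonzeroVectors hz.1).2 hz.2
  set w := extChartAt (𝓡 n).tangent q q with hw
  have hw1 : w.1 ∈ (extChartAt (𝓡 n) q.proj).target := mem_extChartAt_target q.proj
  have hwq : (extChartAt (𝓡 n) q.proj).symm w.1 = q.proj := extChartAt_to_inv q.proj
  have hwz : w ∈ slit (extChartAt (𝓡 n) q.proj).target :=
    extChartAt_mem_slit (mem_extChartAt_source _) hq0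
  set θ := extChartAt (𝓡 n) v.proj ∘ (extChartAt (𝓡 n) q.proj).symm with hθ
  have hs : ∀ᶠ x in 𝓝 w.1, x ∈ (extChartAt (𝓡 n) q.proj).target ∧
      (extChartAt (𝓡 n) q.proj).symm x ∈ (extChartAt (𝓡 n) v.proj).source := by
    refine ((continuousOn_extChartAt_symm q.proj).isOpen_inter_preimage
      (isOpen_extChartAt_target q.proj) (isOpen_extChartAt_source v.proj)).mem_nhds ⟨hw1, ?_⟩
    rw [mem_preimage, hwq]
    exact hqs
  have hs2 : ∀ᶠ y in 𝓝 w, y.1 ∈ (extChartAt (𝓡 n) q.proj).target ∧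
      (extChartAt (𝓡 n) q.proj).symm y.1 ∈ (extChartAt (𝓡 n) v.proj).source :=
    continuous_fst.continuousAt.eventually hs
  have hev : (extChartAt (𝓡 n).tangent v ∘ (extChartAt (𝓡 n).tangent q).symm) =ᶠ[𝓝 w]
      tangentLift θ := by
    filter_upwards [hs2] with y hy using extChartAt_tangent_coordChange hy.1 hy.2
  have hlift : tangentLift θ w = z := by
    rw [← hev.self_of_nhds]
    change extChartAt (𝓡 n).tangent v ((extChartAt (𝓡 n).tangent q).symm w) = z
    rw [hw, extChartAt_to_inv, hq, PartialEquiv.right_inv _ hzt]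
  have hLL : energy (localF F q.proj) =ᶠ[𝓝 w]
      fun y => energy (localF F v.proj) (tangentLift θ y) := by
    filter_upwards [hs2] with y hy
    have h1 : localF F q.proj y.1 y.2 =
        localF F v.proj (tangentLift θ y).1 (tangentLift θ y).2 := by
      rw [localF_eq, localF_eq]
      change _ = F ((extChartAt (𝓡 n).tangent v).symm (tangentLift θ y))
      rw [← extChartAt_tangent_coordChange hy.1 hy.2, PartialEquiv.left_inv]
      rw [extChartAt_tangent_source]
      exact hy.2
    rw [energy, energy, h1]
  have hsurj : ∀ᶠ x in 𝓝 w.1, Function.Surjective (fderiv ℝ θ x) := by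
    filter_upwards [hs] with x hx
    rw [hθ, fderiv_extChartAt_symm hx.1]
    exact surjective_tangentCoordChange ((extChartAt (𝓡 n) q.proj).map_target hx.1) hx.2
  have hsm : SmoothNear θ w.1 := smoothNear_extChartAt_symm hs.self_of_nhds.1 hs.self_of_nhds.2
  have key := (isSpray (isLocalFinsler hF q.proj)).horizontal_transform
    (isSpray (isLocalFinsler hF v.proj)) hwz (by rw [hlift]; exact hz) hsm hsurj hLL (X q.proj)
  have e1 : fderiv ℝ θ w.1 (X q.proj) = chartField (𝓡 n) X v.proj z.1 := by
    rw [hθ, fderiv_extChartAt_symm hw1, hwq]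
    rfl
  rw [hlift, e1] at key
  rw [← key, ← hev.fderiv_eq, fderiv_extChartAt_symm (I := (𝓡 n).tangent) (mem_extChartAt_target q),
    hw, extChartAt_to_inv]
  exact congrArg (tangentCoordChange (𝓡 n).tangent q v q) (horizontalLift_eq hF hq0 (X q.proj))

theorem contMDiffOn_horizontalLiftField (hF : IsFinsler F) {X : ∀ x : M, TangentSpace (𝓡 n) x}
    (hX : IsSmoothField X) :
    ContMDiffOn (𝓡 n).tangent (𝓡 n).tangent.tangent ∞
      (fun v => (⟨v, horizontalLiftField F X v⟩ :
        TangentBundle (𝓡 n).tangent (TangentBundle (𝓡 n) M))) (nonzeroVectors n M) := by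
  intro v hv
  refine ContMDiffAt.contMDiffWithinAt (contMDiffAt_field_iff.2 ?_)
  have hv1 : extChartAt (𝓡 n).tangent v v ∈ slit (extChartAt (𝓡 n) v.proj).target :=
    extChartAt_mem_slit (mem_extChartAt_source _) hv
  have hf := isLocalFinsler hF v.proj
  have h1 : ContDiffAt ℝ ∞ (chartField (𝓡 n) X v.proj) (extChartAt (𝓡 n).tangent v v).1 := by
    have := contDiffOn_chartField (U := univ) (contMDiffOn_univ.2 hX) v.proj
    rw [preimage_univ, inter_univ] at this
    exact this.contDiffAt ((isOpen_extChartAt_target v.proj).mem_nhds hv1.1)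
  have h2 : ContDiffAt ℝ ∞ (fun z : EuclideanSpace ℝ (Fin n) × EuclideanSpace ℝ (Fin n) =>
      (chartField (𝓡 n) X v.proj z.1,
        -fderiv ℝ (sprayVec F v.proj) z (0, chartField (𝓡 n) X v.proj z.1)))
      (extChartAt (𝓡 n).tangent v v) := by
    have h3 := h1.comp (extChartAt (𝓡 n).tangent v v) contDiffAt_fst
    exact h3.prodMk ((((isSpray hf).smoothNear_coeff hv1).fderiv.contDiffAt.clm_apply
      (contDiffAt_const.prodMk h3)).neg)
  have h4 : ContDiffAt ℝ ∞ (chartField (𝓡 n).tangent (horizontalLiftField F X) v)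
      (extChartAt (𝓡 n).tangent v v) := by
    refine h2.congr_of_eventuallyEq ?_
    filter_upwards [hf.isOpen_slit.mem_nhds hv1] with z hz
      using chartField_horizontalLiftField hF X v hz
  refine (h4.contMDiffAt.comp v (contMDiffAt_extChartAt (I := (𝓡 n).tangent))).congr_of_eventuallyEq
    ?_
  filter_upwards [extChartAt_source_mem_nhds (I := (𝓡 n).tangent) v] with q hq
  exact (chartField_extChartAt (horizontalLiftField F X) hq).symm

theorem IsFinsler.map_zero (hF : IsFinsler F) (x : M) : F ⟨x, 0⟩ = 0 := by
  have := hF.homogeneous x 0 2 two_pos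
  rw [smul_zero] at this
  linarith

/-- By Euler's relations the vertical Hessian of `F²/2` at `(v, v)` equals `F(v)²`, which positive
definiteness forces to be nonzero. The sign of `F` is not determined, hence the later use of
`positiveVectors`. -/
theorem IsFinsler.ne_zero (hF : IsFinsler F) {v : TangentBundle (𝓡 n) M}
    (hv : v ∈ nonzeroVectors n M) : F v ≠ 0 := by
  have hf := isLocalFinsler hF v.proj
  have hz : extChartAt (𝓡 n).tangent v v ∈ slit (extChartAt (𝓡 n) v.proj).target :=
    extChartAt_mem_slit (mem_extChartAt_source _) hv
  intro h0
  refine hz.2 (hf.nondeg hz ?_)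
  rw [hf.hess_self hz, hf.fderiv_energy_self hz]
  have : localF F v.proj (extChartAt (𝓡 n).tangent v v).1 (extChartAt (𝓡 n).tangent v v).2 = 0 := by
    rw [localF_eq]
    exact (congrArg F (extChartAt_to_inv v)).trans h0
  rw [energy, this]
  norm_num

theorem IsFinsler.mem_nonzeroVectors (hF : IsFinsler F) {v : TangentBundle (𝓡 n) M}
    (hv : F v ≠ 0) : v ∈ nonzeroVectors n M := by
  intro h
  obtain ⟨x, y⟩ := v
  have h' : y = 0 := h
  rw [h'] at hv
  exact hv (hF.map_zero x)

theorem IsFinsler.contMDiffAt (hF : IsFinsler F) {v : TangentBundle (𝓡 n) M}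
    (hv : v ∈ nonzeroVectors n M) : ContMDiffAt (𝓡 n).tangent 𝓘(ℝ, ℝ) ∞ F v :=
  hF.smooth.contMDiffAt (isOpen_nonzeroVectors.mem_nhds hv)

/-- Horizontal vectors annihilate `F²/2`, whose differential is `F · dF`, and `F` does not vanish on
nonzero vectors. -/
theorem mfderiv_horizontalLift (hF : IsFinsler F) {v : TangentBundle (𝓡 n) M}
    (hv : v ∈ nonzeroVectors n M) (ξ : TangentSpace (𝓡 n) v.proj) :
    mfderiv (𝓡 n).tangent 𝓘(ℝ, ℝ) F v (horizontalLift F v ξ) = 0 := by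
  have hf := isLocalFinsler hF v.proj
  have hz : extChartAt (𝓡 n).tangent v v ∈ slit (extChartAt (𝓡 n) v.proj).target :=
    extChartAt_mem_slit (mem_extChartAt_source _) hv
  set z := extChartAt (𝓡 n).tangent v v
  have h1 : mfderiv (𝓡 n).tangent 𝓘(ℝ, ℝ) F v =
      fderiv ℝ (fun z : EuclideanSpace ℝ (Fin n) × EuclideanSpace ℝ (Fin n) =>
        localF F v.proj z.1 z.2) z := by
    rw [((hF.contMDiffAt hv).mdifferentiableAt (by simp)).mfderiv, ModelWithCorners.Boundaryless.range_eq_univ,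
      fderivWithin_univ]
    rfl
  have h2 := fderiv_energy_horizontal hF v.proj hz ξ
  have h3 : HasFDerivAt (energy (localF F v.proj)) (F v • fderiv ℝ
      (fun z : EuclideanSpace ℝ (Fin n) × EuclideanSpace ℝ (Fin n) => localF F v.proj z.1 z.2) z)
      z := by
    have h4 := (hf.smooth.contDiffAt (hf.isOpen_slit.mem_nhds hz)).differentiableAt
      (by simp) |>.hasFDerivAt
    have h5 := (h4.pow 2).const_mul (1 / 2)
    refine h5.congr_fderiv ?_
    have : localF F v.proj z.1 z.2 = F v := congrArg F (extChartAt_to_inv v)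
    rw [this]
    ext <;> simp <;> ring
  rw [h3.fderiv] at h2
  refine (smul_eq_zero.1 (Eq.trans ?_ h2)).resolve_left (hF.ne_zero hv)
  rw [h1]
  exact congrArg (fun a : EuclideanSpace ℝ (Fin n) × EuclideanSpace ℝ (Fin n) => F v • fderiv ℝ
      (fun z : EuclideanSpace ℝ (Fin n) × EuclideanSpace ℝ (Fin n) => localF F v.proj z.1 z.2) z a)
      (horizontalLift_eq hF hv ξ)

end Horizontal

/-! ### Commutators and Lie brackets -/

section Commutator

variable {k : ℕ} {E F : Type*} [NormedAddCommGroup E] [NormedSpace ℝ E]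
  [NormedAddCommGroup F] [NormedSpace ℝ F]

theorem mixedDeriv_const (hk : 1 ≤ k) (c : F) : mixedDeriv k (fun _ => c) = 0 := by
  simp [mixedDeriv, iteratedFDeriv_const_of_ne (by omega : k ≠ 0)]

theorem mixedDeriv_sub_const (hk : 1 ≤ k) (f : (Fin k → ℝ) → F) (c : F) :
    mixedDeriv k (fun t => f t - c) = mixedDeriv k f :=
  iteratedFDeriv_sub_const_apply hk f c 0 _

omit [NormedAddCommGroup F] [NormedSpace ℝ F] in
theorem IsConstOnAxes.of_eventually (hk : 1 ≤ k) {f : (Fin k → ℝ) → F} {c : F}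
    (h : ∀ᶠ t in 𝓝 (0 : Fin k → ℝ), (∃ j, t j = 0) → f t = c) : IsConstOnAxes k f := by
  have h0 : f 0 = c := h.self_of_nhds ⟨⟨0, hk⟩, rfl⟩
  filter_upwards [h] with t ht hj
  rw [ht hj, h0]

theorem HasOrderDeriv.congr {c d : ℝ → F} {m : F} (h : HasOrderDeriv k c m) (hcd : c =ᶠ[𝓝 0] d) :
    HasOrderDeriv k d m := by
  have h0 := hcd.self_of_nhds
  refine IsLittleO.congr' h ?_ EventuallyEq.rfl
  filter_upwards [hcd] with s hs
  rw [hs, h0]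

theorem tendsto_diagonal : Tendsto (fun (s : ℝ) (_ : Fin k) => s) (𝓝 0) (𝓝 0) :=
  (continuous_pi fun _ => continuous_id).tendsto' 0 0 rfl

/-- Moving the space variable by `O(s^k)` does not affect a family `K` with `K(0, w) = 0` to
order `k`. -/
theorem HasOrderDeriv.of_isBigO {K : (Fin k → ℝ) × E → F} {z : E} {c : ℝ → E} {m : F}
    (hk : 1 ≤ k) (hK : SmoothNear K (0, z)) (hK0 : ∀ᶠ w in 𝓝 z, K (0, w) = 0)
    (hc0 : c 0 = z) (hc : (fun s => c s - z) =O[𝓝 0] fun s : ℝ => s ^ k)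
    (h : HasOrderDeriv k (fun s => K (fun _ => s, z)) m) :
    HasOrderDeriv k (fun s => K (fun _ => s, c s)) m := by
  have hs : HasStrictFDerivAt K (fderiv ℝ K (0, z)) (0, z) :=
    hK.contDiffAt.hasStrictFDerivAt (by simp)
  -- Since `K(0, ·)` vanishes near `z`, so does its derivative in the space variable at `(0, z)`.
  have h2 : ∀ u, fderiv ℝ K (0, z) (0, u) = 0 := by
    intro u
    have e1 : HasFDerivAt (fun w => K (0, w)) ((fderiv ℝ K (0, z)).comp
      (ContinuousLinearMap.inr ℝ (Fin k → ℝ) E)) z :=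
      hs.hasFDerivAt.comp z ((hasFDerivAt_const (0 : Fin k → ℝ) z).prodMk (hasFDerivAt_id z))
    have hK0' : (fun w => K (0, w)) =ᶠ[𝓝 z] fun _ => 0 := hK0
    have e2 := e1.unique ((hasFDerivAt_const (0 : F) z).congr_of_eventuallyEq hK0')
    exact congrArg (fun A : E →L[ℝ] F => A u) e2
  have hct : Tendsto c (𝓝 0) (𝓝 z) := by
    have h1 : Tendsto (fun s => c s - z) (𝓝 0) (𝓝 0) := by
      refine hc.trans_tendsto ?_
      have := (continuous_pow (M := ℝ) k).tendsto 0
      rwa [zero_pow (by omega)] at this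
    simpa using h1.add_const z
  have ht : Tendsto (fun s : ℝ => (((fun _ => s : Fin k → ℝ), c s), ((fun _ => s : Fin k → ℝ), z)))
      (𝓝 0) (𝓝 ((0, z), (0, z))) :=
    ((tendsto_diagonal.prodMk_nhds hct).prodMk_nhds (tendsto_diagonal.prodMk_nhds tendsto_const_nhds))
  -- Strict differentiability compares `K(t, c)` with `K(t, z)` for moving `t`. The linear term
  -- vanishes by the preceding step, so the difference is `o(‖c - z‖)`, hence `o(s^k)`.
  have h3 := hs.isLittleO.comp_tendsto ht
  have h4 : (fun s => K (fun _ => s, c s) - K (fun _ => s, z)) =o[𝓝 0] fun s : ℝ => s ^ k := by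
    refine (h3.congr (fun s => ?_) (fun s => ?_)).trans_isBigO
      (g := fun s => ((0 : Fin k → ℝ), c s - z)) ?_
    · simp only [Function.comp_apply, Prod.mk_sub_mk, sub_self, h2, sub_zero]
    · simp [Function.comp_apply]
    · refine IsBigO.trans (IsBigO.of_bound 1 (Eventually.of_forall fun s => ?_)) hc
      simp
  refine (IsLittleO.add h h4).congr_left fun s => ?_
  simp only [hc0]
  abel

variable [FiniteDimensional ℝ E]

/-- The mixed derivative of a family of commutators with a flow is the Lie bracket. -/
theorem mixedDeriv_commutator (hk : 1 ≤ k) {Φ : (Fin k → ℝ) × E → E} {Ψ : (Fin k → ℝ) → E}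
    {V : E → E} {z : E} (hΦ : SmoothNear Φ (0, z)) (hΨ : SmoothNear Ψ 0) (hV : SmoothNear V z)
    (hΦΨ : ∀ᶠ t in 𝓝 0, Φ (t, Ψ t) = z)
    (hΦ0 : ∀ᶠ q in 𝓝 ((0 : Fin k → ℝ), z), (∃ j, q.1 j = 0) → Φ q = q.2)
    (hΨ0 : ∀ᶠ t in 𝓝 (0 : Fin k → ℝ), (∃ j, t j = 0) → Ψ t = z) :
    mixedDeriv k (fun t => fderiv ℝ (fun w => Φ (t, w)) (Ψ t) (V (Ψ t)) - V z) =
      VectorField.lieBracket ℝ V (fun w => mixedDeriv k fun t => Φ (t, w)) z := by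
  have hex : ∃ j : Fin k, (0 : Fin k → ℝ) j = 0 := ⟨⟨0, hk⟩, rfl⟩
  have hΨz : Ψ 0 = z := hΨ0.self_of_nhds hex
  have hΨc := IsConstOnAxes.of_eventually hk hΨ0
  have hcurve : ∀ᶠ t in 𝓝 (0 : Fin k → ℝ), ∀ᶠ q in 𝓝 (t, z), (∃ j, q.1 j = 0) → Φ q = q.2 :=
    (Continuous.prodMk_left z).continuousAt.eventually hΦ0.eventually_nhds
  have hcurve0 : ∀ᶠ w in 𝓝 z, ∀ᶠ q in 𝓝 ((0 : Fin k → ℝ), w), (∃ j, q.1 j = 0) → Φ q = q.2 :=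
    (Continuous.prodMk_right (0 : Fin k → ℝ)).continuousAt.eventually hΦ0.eventually_nhds
  set η := mixedDeriv k Ψ with hη
  have hΨd := hasOrderDeriv_mixedDeriv hk hΨ hΨc
  have hc0 : (fun s : ℝ => Ψ fun _ => s) 0 = z := hΨz
  have hcO : (fun s : ℝ => Ψ (fun _ => s) - z) =O[𝓝 0] fun s : ℝ => s ^ k := by
    have := hΨd.isBigO
    simp only [hc0] at this
    exact this
  have hsz : SmoothNear (fun t : Fin k → ℝ => (t, z)) 0 :=
    ContDiff.smoothNear (contDiff_id.prodMk contDiff_const) 0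
  have hsnd : SmoothNear (fun q : (Fin k → ℝ) × E => q.2) (0, z) :=
    ContDiff.smoothNear contDiff_snd _
  -- first the derivative of the inverse family
  have hηξ : η = -mixedDeriv k fun t => Φ (t, z) := by
    have h1 : SmoothNear (fun q : (Fin k → ℝ) × E => Φ q - q.2) (0, z) := by
      filter_upwards [hΦ] with q hq using hq.sub contDiffAt_snd
    have h2 : ∀ᶠ w in 𝓝 z, Φ ((0 : Fin k → ℝ), w) - w = 0 := by
      filter_upwards [hcurve0] with w hw
      rw [hw.self_of_nhds hex, sub_self]
    have h3 : HasOrderDeriv k (fun s : ℝ => Φ (fun _ => s, z) - z)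
        (mixedDeriv k fun t => Φ (t, z)) := by
      have h4 : IsConstOnAxes k fun t => Φ (t, z) - z := by
        refine IsConstOnAxes.of_eventually hk (c := 0) ?_
        filter_upwards [hcurve] with t ht hj
        rw [ht.self_of_nhds hj, sub_self]
      have h5 : SmoothNear (fun t : Fin k → ℝ => Φ (t, z) - z) 0 := SmoothNear.comp (f := fun t : Fin k → ℝ => (t, z)) h1 hsz
      have := hasOrderDeriv_mixedDeriv hk h5 h4
      rwa [mixedDeriv_sub_const hk] at this
    have h6 := (h3.of_isBigO (K := fun q => Φ q - q.2) hk h1 h2 hc0 hcO).add hΨd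
    have h7 : HasOrderDeriv k (fun _ : ℝ => z) (0 : E) := by
      refine (isLittleO_zero _ _).congr_left fun s => ?_
      simp
    have h8 : (fun s : ℝ => Φ (fun _ => s, Ψ fun _ => s) - Ψ (fun _ => s) + Ψ (fun _ => s))
        =ᶠ[𝓝 0] fun _ => z := by
      have : ∀ᶠ s in 𝓝 (0 : ℝ), Φ (fun _ => s, Ψ fun _ => s) = z := tendsto_diagonal.eventually hΦΨ
      filter_upwards [this] with s hs
      rw [hs, sub_add_cancel]
    have h9 := h7.congr h8.symm
    exact eq_neg_of_add_eq_zero_right (h6.unique h9)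
  -- the operator part
  set K : (Fin k → ℝ) × E → E := fun q => fderiv ℝ Φ q (0, V q.2) - V q.2 with hKdef
  have hVs : SmoothNear (fun q : (Fin k → ℝ) × E => V q.2) (0, z) :=
    SmoothNear.comp (f := fun q : (Fin k → ℝ) × E => q.2) hV hsnd
  have hK : SmoothNear K (0, z) := by
    filter_upwards [hΦ.fderiv, hVs] with q h1 h2
    exact (h1.clm_apply (contDiffAt_const.prodMk h2)).sub h2
  have hpart : ∀ t w, DifferentiableAt ℝ Φ (t, w) → ∀ u,
      fderiv ℝ (fun w => Φ (t, w)) w u = fderiv ℝ Φ (t, w) (0, u) := by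
    intro t w h u
    have e1 : HasFDerivAt (fun w => Φ (t, w)) ((fderiv ℝ Φ (t, w)).comp
      (ContinuousLinearMap.inr ℝ (Fin k → ℝ) E)) w :=
      h.hasFDerivAt.comp w ((hasFDerivAt_const t w).prodMk (hasFDerivAt_id w))
    rw [e1.fderiv]
    rfl
  have hΦd : ∀ᶠ q in 𝓝 ((0 : Fin k → ℝ), z), DifferentiableAt ℝ Φ q := by
    filter_upwards [hΦ] with q hq using hq.differentiableAt (by simp)
  have hid : ∀ t w, DifferentiableAt ℝ Φ (t, w) → (∃ j, t j = 0) →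
      (∀ᶠ q in 𝓝 (t, w), (∃ j, q.1 j = 0) → Φ q = q.2) → ∀ u, fderiv ℝ Φ (t, w) (0, u) = u := by
    intro t w hd hj he u
    rw [← hpart t w hd]
    have h1 : (fun w => Φ (t, w)) =ᶠ[𝓝 w] fun w => w := by
      filter_upwards [(Continuous.prodMk_right t).continuousAt.eventually he] with w' hw'
        using hw' hj
    rw [h1.fderiv_eq, fderiv_fun_id]
    rfl
  have hK0 : ∀ᶠ w in 𝓝 z, K (0, w) = 0 := by
    filter_upwards [hcurve0, (Continuous.prodMk_right (0 : Fin k → ℝ)).continuousAt.eventually hΦd]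
      with w hw hd
    exact sub_eq_zero.2 (hid 0 w hd hex hw _)
  have hKz : IsConstOnAxes k fun t => K (t, z) := by
    refine IsConstOnAxes.of_eventually hk (c := 0) ?_
    filter_upwards [hcurve, (Continuous.prodMk_left z).continuousAt.eventually hΦd] with t ht hd hj
    exact sub_eq_zero.2 (hid t z hd hj ht _)
  have hKd := hasOrderDeriv_mixedDeriv hk
    (SmoothNear.comp (f := fun t : Fin k → ℝ => (t, z)) hK hsz) hKz
  have hKm : mixedDeriv k (fun t => K (t, z)) =
      fderiv ℝ (fun w => mixedDeriv k fun t => Φ (t, w)) z (V z) := by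
    rw [fderiv_mixedDeriv_param hΦ, ← mixedDeriv_sub_const hk (fun t => fderiv ℝ (fun w => Φ (t, w)) z (V z)) (V z)]
    refine mixedDeriv_congr ?_
    filter_upwards [(Continuous.prodMk_left z).continuousAt.eventually hΦd] with t ht
    rw [hpart t z ht]
  have hVd : HasOrderDeriv k (fun s : ℝ => V (Ψ fun _ => s) - V z) (fderiv ℝ V z η) :=
    hΨd.comp (G := fun w => V w - V z) hk (by
      rw [show (Ψ fun _ => (0 : ℝ)) = z from hΨz]
      exact hV.differentiableAt.hasFDerivAt.sub_const _)
  -- The pushed-forward field minus `V z` is `K(t, Ψ t) + (V(Ψ t) - V z)`. The first summand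
  -- contributes `Dξ(V)` and the second `DV(η)` with `η = -ξ`, which together form the bracket.
  have hsum := (hKd.of_isBigO hk hK hK0 hc0 hcO).add hVd
  have hgraph : SmoothNear (fun t => (t, Ψ t)) 0 :=
    SmoothNear.prodMk (ContDiff.smoothNear contDiff_id 0) hΨ
  have hgraph0 : (fun t => (t, Ψ t)) (0 : Fin k → ℝ) = (0, z) := by simp [hΨz]
  have hq : (fun t => fderiv ℝ (fun w => Φ (t, w)) (Ψ t) (V (Ψ t)) - V z) =ᶠ[𝓝 0]
      fun t => K (t, Ψ t) + (V (Ψ t) - V z) := by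
    have h1 : ∀ᶠ t in 𝓝 (0 : Fin k → ℝ), DifferentiableAt ℝ Φ (t, Ψ t) :=
      (show Tendsto (fun t => (t, Ψ t)) (𝓝 0) (𝓝 (0, z)) from
        hgraph0 ▸ hgraph.continuousAt.tendsto).eventually hΦd
    filter_upwards [h1] with t ht
    rw [hpart t _ ht, hKdef]
    simp
  have hqs : SmoothNear (fun t => K (t, Ψ t) + (V (Ψ t) - V z)) 0 := by
    have h1 : SmoothNear (fun t => K (t, Ψ t)) 0 :=
      SmoothNear.comp (f := fun t => (t, Ψ t)) (by rw [hΨz]; exact hK) hgraph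
    have h2 : SmoothNear (fun t => V (Ψ t)) 0 := SmoothNear.comp (by rw [hΨz]; exact hV) hΨ
    filter_upwards [h1, h2] with t h1 h2 using h1.add (h2.sub contDiffAt_const)
  have hqc : IsConstOnAxes k fun t => K (t, Ψ t) + (V (Ψ t) - V z) := by
    refine IsConstOnAxes.of_eventually hk (c := 0) ?_
    have h0 : K (0, z) = 0 := hK0.self_of_nhds
    filter_upwards [hKz, hΨ0] with t h1 h2 hj
    rw [h2 hj, h1 hj, h0, sub_self, add_zero]
  rw [mixedDeriv_congr hq, (hasOrderDeriv_mixedDeriv hk hqs hqc).unique hsum, hKm, hηξ, map_neg,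
    VectorField.lieBracket, sub_eq_add_neg]

end Commutator

/-! ### Smooth families of maps in charts -/

section Families

variable {E : Type*} [NormedAddCommGroup E] [NormedSpace ℝ E]
  {H : Type*} [TopologicalSpace H] {J : ModelWithCorners ℝ E H}
  {N : Type*} [TopologicalSpace N] [ChartedSpace H N] [IsManifold J ∞ N] [J.Boundaryless]
  {P : Type*} [NormedAddCommGroup P] [NormedSpace ℝ P]

omit [IsManifold J ∞ N] [J.Boundaryless] [NormedSpace ℝ P] in
theorem tendsto_prod_extChartAt_symm {v v₀ : N} (hv : v₀ ∈ (extChartAt J v).source) (p : P) :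
    Tendsto (fun q : P × E => (q.1, (extChartAt J v).symm q.2)) (𝓝 (p, extChartAt J v v₀))
      (𝓝 (p, v₀)) := by
  refine continuousAt_fst.prodMk_nhds ?_
  have h1 := (continuousAt_extChartAt_symm' (I := J) hv).tendsto
  rw [(extChartAt J v).left_inv hv] at h1
  exact h1.comp continuousAt_snd

/-- A smooth family of maps is smooth in charts. -/
theorem smoothNear_chart {f : P × N → N} {O : Set (P × N)} {p : P} {v w v₀ : N} (hO : IsOpen O)
    (hf : ContMDiffOn (𝓘(ℝ, P).prod J) J ∞ f O) (hp : (p, v₀) ∈ O)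
    (hv : v₀ ∈ (extChartAt J v).source) (hw : f (p, v₀) ∈ (extChartAt J w).source) :
    SmoothNear (fun q : P × E => extChartAt J w (f (q.1, (extChartAt J v).symm q.2)))
      (p, extChartAt J v v₀) := by
  have ht := tendsto_prod_extChartAt_symm (J := J) hv p
  have h1 : ∀ᶠ q : P × N in 𝓝 (p, v₀), q ∈ O ∧ f q ∈ (extChartAt J w).source :=
    (show ∀ᶠ q in 𝓝 (p, v₀), q ∈ O from hO.mem_nhds hp).and
      ((hf.continuousOn.continuousAt (hO.mem_nhds hp)).eventually
        ((isOpen_extChartAt_source w).mem_nhds hw))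
  filter_upwards [ht.eventually h1, continuousAt_snd.eventually
    ((isOpen_extChartAt_target v).mem_nhds ((extChartAt J v).map_source hv))] with q hq hq2
  have h2 : ContMDiffAt 𝓘(ℝ, P × E) (𝓘(ℝ, P).prod J) ∞
      (fun q : P × E => (q.1, (extChartAt J v).symm q.2)) q := by
    refine ContMDiffAt.prodMk contDiffAt_fst.contMDiffAt ?_
    exact ((contMDiffOn_extChartAt_symm v).contMDiffAt
      ((isOpen_extChartAt_target v).mem_nhds hq2)).comp q contDiffAt_snd.contMDiffAt
  have h3 := (hf.contMDiffAt (hO.mem_nhds hq.1)).comp q h2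
  have h4 : ContMDiffAt J 𝓘(ℝ, E) ∞ (extChartAt J w) (f (q.1, (extChartAt J v).symm q.2)) :=
    contMDiffAt_extChartAt' (by have := hq.2; rwa [extChartAt_source] at this)
  exact contMDiffAt_iff_contDiffAt.1 (h4.comp q h3)

theorem fderiv_comp_eq_id {f h : E → E} {x : E} (hf : DifferentiableAt ℝ f x)
    (hh : DifferentiableAt ℝ h (f x)) (hid : ∀ᶠ y in 𝓝 x, h (f y) = y) (u : E) :
    fderiv ℝ h (f x) (fderiv ℝ f x u) = u := by
  have h1 := hh.hasFDerivAt.comp x hf.hasFDerivAt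
  have hid' : h ∘ f =ᶠ[𝓝 x] id := hid
  exact congrArg (fun A : E →L[ℝ] E => A u)
    (h1.unique ((hasFDerivAt_id x).congr_of_eventuallyEq hid'))

/-- The inverses of a smooth family of diffeomorphisms form a smooth family. -/
theorem contMDiffOn_inverse_family [FiniteDimensional ℝ E] [FiniteDimensional ℝ P]
    {C : Set P} {W : Set N} (hC : IsOpen C) (hW : IsOpen W) {Φ Ψ : P × N → N}
    (hΦ : ContMDiffOn (𝓘(ℝ, P).prod J) J ∞ Φ (C ×ˢ W))
    (hΨ : ∀ t ∈ C, ContMDiffOn J J ∞ (fun v => Ψ (t, v)) W)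
    (hΨW : ∀ t ∈ C, ∀ v ∈ W, Ψ (t, v) ∈ W)
    (hΦΨ : ∀ t ∈ C, ∀ v ∈ W, Φ (t, Ψ (t, v)) = v)
    (hΨΦ : ∀ t ∈ C, ∀ v ∈ W, Ψ (t, Φ (t, v)) = v) :
    ContMDiffOn (𝓘(ℝ, P).prod J) J ∞ Ψ (C ×ˢ W) := by
  rintro ⟨t₀, v₀⟩ ⟨ht₀, hv₀⟩
  refine ContMDiffAt.contMDiffWithinAt ?_
  set u₀ := Ψ (t₀, v₀) with hu₀
  have hu₀W : u₀ ∈ W := hΨW t₀ ht₀ v₀ hv₀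
  have hΦu : Φ (t₀, u₀) = v₀ := hΦΨ t₀ ht₀ v₀ hv₀
  set a := extChartAt J u₀ with ha
  set b := extChartAt J v₀ with hb
  set f : P × E → E := fun q => b (Φ (q.1, a.symm q.2)) with hfdef
  have hCW : IsOpen (C ×ˢ W) := hC.prod hW
  have hf : SmoothNear f (t₀, a u₀) := smoothNear_chart (p := t₀) (v₀ := u₀) hCW hΦ ⟨ht₀, hu₀W⟩
    (mem_extChartAt_source u₀) (by rw [hΦu]; exact mem_extChartAt_source v₀)
  set A : P × E → P × E := fun q => (q.1, f q) with hA
  have htend := tendsto_prod_extChartAt_symm (J := J) (mem_extChartAt_source u₀) t₀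
  have hgood : ∀ᶠ q in 𝓝 (t₀, a u₀), ContDiffAt ℝ ∞ f q ∧ q.2 ∈ a.target ∧
      (q.1, a.symm q.2) ∈ C ×ˢ W ∧ Φ (q.1, a.symm q.2) ∈ b.source := by
    have h1 : ∀ᶠ q in 𝓝 (t₀, u₀), q ∈ C ×ˢ W ∧ Φ q ∈ b.source := by
      have hmem : C ×ˢ W ∈ 𝓝 (t₀, u₀) := hCW.mem_nhds ⟨ht₀, hu₀W⟩
      refine (show ∀ᶠ q in 𝓝 (t₀, u₀), q ∈ C ×ˢ W from hmem).and
        ((hΦ.continuousOn.continuousAt hmem).eventually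
        ((isOpen_extChartAt_source v₀).mem_nhds ?_))
      rw [hΦu]
      exact mem_extChartAt_source v₀
    filter_upwards [hf, htend.eventually h1, continuousAt_snd.eventually
      (extChartAt_target_mem_nhds (I := J) u₀)] with q h1 h2 h3 using ⟨h1, h3, h2⟩
  obtain ⟨O, hO, hOo, hqO⟩ := eventually_nhds_iff.1 hgood
  have hAs : ContDiffOn ℝ ∞ A O := fun q hq =>
    (contDiffAt_fst.prodMk (hO q hq).1).contDiffWithinAt
  have hA' : HasFDerivAt A ((ContinuousLinearMap.fst ℝ P E).prod (fderiv ℝ f (t₀, a u₀)))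
      (t₀, a u₀) := hasFDerivAt_fst.prodMk hf.differentiableAt.hasFDerivAt
  -- the partial derivative is injective
  have hpart : ∀ w, fderiv ℝ f (t₀, a u₀) (0, w) = fderiv ℝ (fun z => f (t₀, z)) (a u₀) w := by
    intro w
    have e1 : HasFDerivAt (fun z => f (t₀, z)) ((fderiv ℝ f (t₀, a u₀)).comp
      (ContinuousLinearMap.inr ℝ P E)) (a u₀) :=
      hf.differentiableAt.hasFDerivAt.comp (a u₀)
        ((hasFDerivAt_const t₀ (a u₀)).prodMk (hasFDerivAt_id (a u₀)))
    rw [e1.fderiv]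
    rfl
  have hdf : DifferentiableAt ℝ (fun z => f (t₀, z)) (a u₀) :=
    hf.differentiableAt.comp (a u₀) (f := fun z => (t₀, z)) (by fun_prop)
  have hfu : f (t₀, a u₀) = b v₀ := by
    change b (Φ (t₀, a.symm (a u₀))) = b v₀
    rw [ha, extChartAt_to_inv, hΦu]
  have hdh : DifferentiableAt ℝ (fun z => a (Ψ (t₀, b.symm z))) (f (t₀, a u₀)) := by
    rw [hfu]
    have h1 : ContMDiffAt 𝓘(ℝ, E) J ∞ b.symm (b v₀) :=
      (contMDiffOn_extChartAt_symm v₀).contMDiffAt (extChartAt_target_mem_nhds v₀)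
    have h0 : b.symm (b v₀) = v₀ := extChartAt_to_inv v₀
    have h2 : ContMDiffAt J J ∞ (fun v => Ψ (t₀, v)) (b.symm (b v₀)) := by
      rw [h0]
      exact (hΨ t₀ ht₀).contMDiffAt (hW.mem_nhds hv₀)
    have h3 : ContMDiffAt J 𝓘(ℝ, E) ∞ a (Ψ (t₀, b.symm (b v₀))) := by
      rw [h0]
      exact contMDiffAt_extChartAt
    exact (contMDiffAt_iff_contDiffAt.1 (h3.comp (b v₀) (h2.comp (b v₀) h1))).differentiableAt
      (by simp)
  have hid : ∀ᶠ z in 𝓝 (a u₀), a (Ψ (t₀, b.symm (f (t₀, z)))) = z := by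
    filter_upwards [(Continuous.prodMk_right t₀).continuousAt.eventually hgood] with z hz
    change a (Ψ (t₀, b.symm (b (Φ (t₀, a.symm z))))) = z
    rw [b.left_inv hz.2.2.2, hΨΦ t₀ ht₀ _ hz.2.2.1.2, a.right_inv hz.2.1]
  -- For the fixed parameter `t₀` the map has the smooth inverse `Ψ(t₀, ·)`, so its partial
  -- derivative has a left inverse. Together with the identity on parameters this makes the
  -- derivative of `A` injective.
  have hinj : Function.Injective
      ((ContinuousLinearMap.fst ℝ P E).prod (fderiv ℝ f (t₀, a u₀))) := by
    rw [injective_iff_map_eq_zero]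
    rintro ⟨τ, w⟩ h
    have h1 : τ = 0 := congrArg Prod.fst h
    subst h1
    have h2 : fderiv ℝ f (t₀, a u₀) (0, w) = 0 := congrArg Prod.snd h
    rw [hpart] at h2
    have h3 := fderiv_comp_eq_id hdf hdh hid w
    rw [h2, map_zero] at h3
    rw [← h3]
    rfl
  let e : (P × E) ≃L[ℝ] (P × E) := (LinearEquiv.ofInjectiveEndo
    ((ContinuousLinearMap.fst ℝ P E).prod (fderiv ℝ f (t₀, a u₀)) : (P × E) →ₗ[ℝ] (P × E))
    hinj).toContinuousLinearEquiv
  have he : HasFDerivAt A (e : (P × E) →L[ℝ] (P × E)) (t₀, a u₀) :=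
    hA'.congr_fderiv (ContinuousLinearMap.ext fun _ => rfl)
  obtain ⟨S, L, hS, haS, hL, hLa, hLS, -⟩ := exists_contDiffOn_localInverse hOo hAs hqO e he
  have hAa : A (t₀, a u₀) = (t₀, b v₀) := Prod.ext rfl hfu
  rw [hAa] at haS hLa
  have hs1 : ContMDiffAt (𝓘(ℝ, P).prod J) 𝓘(ℝ, P × E) ∞ (fun p : P × N => (p.1, b p.2)) (t₀, v₀) := by
    refine ContMDiffAt.prodMk_space contMDiffAt_fst ?_
    exact (contMDiffAt_extChartAt (I := J) (n := ∞) (x := v₀)).comp (t₀, v₀) contMDiffAt_snd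
  have hs2 : ContMDiffAt 𝓘(ℝ, P × E) 𝓘(ℝ, E) ∞ (fun q => (L q).2) (t₀, b v₀) :=
    (contDiffAt_snd.comp (t₀, b v₀) (hL.contDiffAt (hS.mem_nhds haS))).contMDiffAt
  have hs3 : ContMDiffAt 𝓘(ℝ, E) J ∞ a.symm (L (t₀, b v₀)).2 := by
    rw [hLa]
    exact (contMDiffOn_extChartAt_symm u₀).contMDiffAt (extChartAt_target_mem_nhds u₀)
  refine (hs3.comp (t₀, v₀) (f := fun p : P × N => (L (p.1, b p.2)).2)
    (ContMDiffAt.comp (g := fun q : P × E => (L q).2) (f := fun p : P × N => (p.1, b p.2))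
      (t₀, v₀) hs2 hs1)).congr_of_eventuallyEq ?_
  have hcont : ContinuousAt (fun p : P × N => (p.1, b p.2)) (t₀, v₀) := hs1.continuousAt
  filter_upwards [hcont.eventually (hS.mem_nhds haS),
    continuousAt_snd.eventually (extChartAt_source_mem_nhds (I := J) v₀)] with p hp hp2
  -- The local inverse of `A` produces a point mapped by `Φ(t, ·)` to `p.2`; applying `Ψ(t, ·)`
  -- identifies it with `Ψ p`. No continuity of `Ψ` in `t` is presupposed.
  obtain ⟨hp3, hp4⟩ := hLS _ hp
  obtain ⟨-, h5, h6, h7⟩ := hO _ hp3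
  have h8 : (L (p.1, b p.2)).1 = p.1 := congrArg Prod.fst hp4
  have h9 : b (Φ ((L (p.1, b p.2)).1, a.symm (L (p.1, b p.2)).2)) = b p.2 := congrArg Prod.snd hp4
  have h10 := b.injOn h7 hp2 h9
  rw [h8] at h10 h6
  change Ψ p = a.symm (L (p.1, b p.2)).2
  have h11 := hΨΦ p.1 h6.1 _ h6.2
  dsimp only at h11
  rw [h10] at h11
  exact h11

end Families

/-! ### Homogeneous extension of maps of the indicatrix bundle -/

section Scaling

variable {n : ℕ} {M : Type*} [TopologicalSpace M] [ChartedSpace (EuclideanSpace ℝ (Fin n)) M]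
  [IsManifold (𝓡 n) ∞ M] {F : TangentBundle (𝓡 n) M → ℝ}

/-- Scalar multiplication in the fibres of the tangent bundle. -/
def scale (a : ℝ) (v : TangentBundle (𝓡 n) M) : TangentBundle (𝓡 n) M := ⟨v.proj, a • v.2⟩

theorem contMDiff_scale : ContMDiff (𝓘(ℝ, ℝ).prod (𝓡 n).tangent) (𝓡 n).tangent ∞
    (fun p : ℝ × TangentBundle (𝓡 n) M => scale p.1 p.2) := by
  rintro ⟨a, v⟩
  refine (Bundle.contMDiffAt_totalSpace (F := EuclideanSpace ℝ (Fin n))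
    (E := (TangentSpace (𝓡 n) : M → Type _))).2 ⟨?_, ?_⟩
  · exact ContMDiffAt.comp (I' := (𝓡 n).tangent)
      (g := fun w : TangentBundle (𝓡 n) M => w.proj) (f := Prod.snd) (a, v)
      (Bundle.contMDiff_proj (TangentSpace (𝓡 n) : M → Type _)).contMDiffAt contMDiffAt_snd
  · have h1 : ContMDiffAt (𝓘(ℝ, ℝ).prod (𝓡 n).tangent) 𝓘(ℝ, EuclideanSpace ℝ (Fin n)) ∞
        (fun p : ℝ × TangentBundle (𝓡 n) M =>
          (trivializationAt (EuclideanSpace ℝ (Fin n)) (TangentSpace (𝓡 n)) v.proj p.2).2) (a, v) :=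
      ContMDiffAt.comp (I' := (𝓡 n).tangent)
        (g := fun w : TangentBundle (𝓡 n) M =>
          (trivializationAt (EuclideanSpace ℝ (Fin n)) (TangentSpace (𝓡 n)) v.proj w).2)
        (f := Prod.snd) (a, v) ((Bundle.contMDiffAt_totalSpace (F := EuclideanSpace ℝ (Fin n))
        (E := (TangentSpace (𝓡 n) : M → Type _))).1 (contMDiffAt_id (x := v))).2 contMDiffAt_snd
    refine (contMDiffAt_fst.smul h1).congr_of_eventuallyEq (Eventually.of_forall fun p => ?_)
    exact (tangentCoordChange (𝓡 n) p.2.proj v.proj p.2.proj : EuclideanSpace ℝ (Fin n) →L[ℝ] _).map_smul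
      p.1 p.2.2

omit [IsManifold (𝓡 n) ∞ M] in
theorem scale_scale (a b : ℝ) (v : TangentBundle (𝓡 n) M) : scale a (scale b v) = scale (a * b) v :=
  congrArg (Bundle.TotalSpace.mk v.proj) (smul_smul a b v.2)

omit [IsManifold (𝓡 n) ∞ M] in
theorem one_scale (v : TangentBundle (𝓡 n) M) : scale 1 v = v :=
  congrArg (Bundle.TotalSpace.mk v.proj) (one_smul ℝ v.2)

theorem IsFinsler.apply_scale (hF : IsFinsler F) {a : ℝ} (ha : 0 < a) (v : TangentBundle (𝓡 n) M) :
    F (scale a v) = a * F v := hF.homogeneous v.proj v.2 a ha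

variable (F) in
/-- The vector of `IM` on the ray through `v`. -/
def normalize (v : TangentBundle (𝓡 n) M) : TangentBundle (𝓡 n) M := scale (F v)⁻¹ v

variable (F) in
/-- The set where the Finsler function is positive. -/
def positiveVectors : Set (TangentBundle (𝓡 n) M) := {v | 0 < F v}

theorem IsFinsler.isOpen_positiveVectors (hF : IsFinsler F) : IsOpen (positiveVectors F) :=
  isOpen_lt continuous_const hF.continuous

omit [IsManifold (𝓡 n) ∞ M] in
theorem indicatrixBundle_subset : indicatrixBundle F ⊆ positiveVectors F := fun v hv => by
  have : F v = 1 := hv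
  change 0 < F v
  rw [this]
  exact one_pos

theorem IsFinsler.contMDiffAt_of_pos (hF : IsFinsler F) {v : TangentBundle (𝓡 n) M}
    (hv : v ∈ positiveVectors F) : ContMDiffAt (𝓡 n).tangent 𝓘(ℝ, ℝ) ∞ F v :=
  hF.contMDiffAt (hF.mem_nonzeroVectors (ne_of_gt hv))

theorem IsFinsler.normalize_mem (hF : IsFinsler F) {v : TangentBundle (𝓡 n) M}
    (hv : v ∈ positiveVectors F) : normalize F v ∈ indicatrixBundle F := by
  have hv' : 0 < F v := hv
  exact (hF.apply_scale (inv_pos.2 hv') v).trans (inv_mul_cancel₀ hv'.ne')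

theorem IsFinsler.contMDiffOn_normalize (hF : IsFinsler F) :
    ContMDiffOn (𝓡 n).tangent (𝓡 n).tangent ∞ (normalize F) (positiveVectors F) := fun v hv =>
  (contMDiff_scale.contMDiffAt.comp v ((((hF.contMDiffAt_of_pos hv).inv₀ (ne_of_gt hv))).prodMk
    contMDiffAt_id)).contMDiffWithinAt

omit [IsManifold (𝓡 n) ∞ M] in
theorem normalize_of_mem {v : TangentBundle (𝓡 n) M} (hv : v ∈ indicatrixBundle F) :
    normalize F v = v := by
  have : F v = 1 := hv
  rw [normalize, this, inv_one, one_scale]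

theorem IsFinsler.normalize_scale (hF : IsFinsler F) {a : ℝ} (ha : 0 < a)
    {v : TangentBundle (𝓡 n) M} (hv : v ∈ indicatrixBundle F) : normalize F (scale a v) = v := by
  have h1 : F v = 1 := hv
  rw [normalize, hF.apply_scale ha, h1, mul_one, scale_scale, inv_mul_cancel₀ ha.ne', one_scale]

omit [IsManifold (𝓡 n) ∞ M] in
theorem scale_normalize {v : TangentBundle (𝓡 n) M} (hv : v ∈ positiveVectors F) :
    scale (F v) (normalize F v) = v := by
  rw [normalize, scale_scale, mul_inv_cancel₀ (ne_of_gt hv), one_scale]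

open Classical in
/-- The extension of a map of `IM` which is positively homogeneous of degree one. -/
def radialExt (f : indicatrixBundle F → indicatrixBundle F) (v : TangentBundle (𝓡 n) M) :
    TangentBundle (𝓡 n) M :=
  if h : normalize F v ∈ indicatrixBundle F then scale (F v) (f ⟨normalize F v, h⟩) else v

theorem IsFinsler.radialExt_eq (hF : IsFinsler F) (f : indicatrixBundle F → indicatrixBundle F)
    {v : TangentBundle (𝓡 n) M} (hv : v ∈ positiveVectors F) :
    radialExt f v = scale (F v) (f ⟨normalize F v, hF.normalize_mem hv⟩) :=
  dif_pos (hF.normalize_mem hv)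

theorem IsFinsler.radialExt_coe (hF : IsFinsler F) (f : indicatrixBundle F → indicatrixBundle F)
    (v : indicatrixBundle F) : radialExt f (v : TangentBundle (𝓡 n) M) = f v := by
  have h1 : F v = 1 := v.2
  rw [hF.radialExt_eq f (indicatrixBundle_subset v.2), h1, one_scale]
  exact congrArg (fun w => (f w : TangentBundle (𝓡 n) M)) (Subtype.ext (normalize_of_mem v.2))

theorem IsFinsler.apply_radialExt (hF : IsFinsler F) (f : indicatrixBundle F → indicatrixBundle F)
    {v : TangentBundle (𝓡 n) M} (hv : v ∈ positiveVectors F) : F (radialExt f v) = F v := by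
  have h1 : F (f ⟨normalize F v, hF.normalize_mem hv⟩) = 1 := (f _).2
  rw [hF.radialExt_eq f hv, hF.apply_scale hv, h1, mul_one]

theorem IsFinsler.radialExt_mem (hF : IsFinsler F) (f : indicatrixBundle F → indicatrixBundle F)
    {v : TangentBundle (𝓡 n) M} (hv : v ∈ positiveVectors F) :
    radialExt f v ∈ positiveVectors F := by
  change 0 < F _
  rw [hF.apply_radialExt f hv]
  exact hv

theorem IsFinsler.radialExt_radialExt (hF : IsFinsler F)
    {f g : indicatrixBundle F → indicatrixBundle F} (hfg : ∀ v, f (g v) = v)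
    {v : TangentBundle (𝓡 n) M} (hv : v ∈ positiveVectors F) : radialExt f (radialExt g v) = v := by
  rw [hF.radialExt_eq f (hF.radialExt_mem g hv), hF.apply_radialExt g hv]
  have : (⟨normalize F (radialExt g v), hF.normalize_mem (hF.radialExt_mem g hv)⟩ :
      indicatrixBundle F) = g ⟨normalize F v, hF.normalize_mem hv⟩ := by
    refine Subtype.ext ?_
    change normalize F (radialExt g v) = _
    rw [hF.radialExt_eq g hv, hF.normalize_scale hv (g _).2]
  rw [this, hfg]
  exact scale_normalize hv

theorem IsFinsler.contMDiffOn_radialExt (hF : IsFinsler F)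
    {f : indicatrixBundle F → indicatrixBundle F}
    (hf : SmoothMapOn (𝓡 n).tangent (indicatrixBundle F) fun v => (f v : TangentBundle (𝓡 n) M)) :
    ContMDiffOn (𝓡 n).tangent (𝓡 n).tangent ∞ (radialExt f) (positiveVectors F) := by
  obtain ⟨g, hgf, hg⟩ := hf
  have h1 : ContMDiffOn (𝓡 n).tangent (𝓡 n).tangent ∞ (fun v => g (normalize F v))
      (positiveVectors F) := hg.comp hF.contMDiffOn_normalize fun v hv => hF.normalize_mem hv
  have h2 : ContMDiffOn (𝓡 n).tangent (𝓘(ℝ, ℝ).prod (𝓡 n).tangent) ∞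
      (fun v => (F v, g (normalize F v))) (positiveVectors F) :=
    ContMDiffOn.prodMk (fun v hv => (hF.contMDiffAt_of_pos hv).contMDiffWithinAt) h1
  refine (contMDiff_scale.comp_contMDiffOn h2).congr fun v hv => ?_
  rw [hF.radialExt_eq f hv]
  exact congrArg (scale (F v)) (hgf ⟨normalize F v, hF.normalize_mem hv⟩).symm

variable {k : ℕ} {ε : ℝ} {φ : (Fin k → ℝ) → diffeoGroup (𝓡 n).tangent (indicatrixBundle F)}

theorem isOpen_paramCube : IsOpen (paramCube k ε) := by
  have : paramCube k ε = ⋂ i, {t | t i ∈ Ioo (-ε) ε} := by ext; simp [paramCube]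
  rw [this]
  exact isOpen_iInter_of_finite fun i => isOpen_Ioo.preimage (continuous_apply i)

theorem IsCommutatorLike.contMDiffOn_radialExt (hF : IsFinsler F)
    (hφ : IsCommutatorLike (𝓡 n).tangent (indicatrixBundle F) k ε φ) :
    ContMDiffOn (𝓘(ℝ, Fin k → ℝ).prod (𝓡 n).tangent) (𝓡 n).tangent ∞
      (fun p : (Fin k → ℝ) × TangentBundle (𝓡 n) M => radialExt (φ p.1).1 p.2)
      (paramCube k ε ×ˢ positiveVectors F) := by
  obtain ⟨⟨g, hgf, hg⟩, -⟩ := hφ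
  have h0 : ContMDiffOn (𝓘(ℝ, Fin k → ℝ).prod (𝓡 n).tangent) (𝓡 n).tangent ∞
      (fun p : (Fin k → ℝ) × TangentBundle (𝓡 n) M => normalize F p.2)
      (paramCube k ε ×ˢ positiveVectors F) :=
    hF.contMDiffOn_normalize.comp contMDiffOn_snd fun p hp => hp.2
  have h1 : ContMDiffOn (𝓘(ℝ, Fin k → ℝ).prod (𝓡 n).tangent) (𝓡 n).tangent ∞
      (fun p : (Fin k → ℝ) × TangentBundle (𝓡 n) M => g (p.1, normalize F p.2))
      (paramCube k ε ×ˢ positiveVectors F) :=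
    hg.comp (contMDiffOn_fst.prodMk h0) fun p hp => ⟨hp.1, hF.normalize_mem hp.2⟩
  have h3 : ContMDiffOn (𝓘(ℝ, Fin k → ℝ).prod (𝓡 n).tangent) 𝓘(ℝ, ℝ) ∞
      (fun p : (Fin k → ℝ) × TangentBundle (𝓡 n) M => F p.2)
      (paramCube k ε ×ˢ positiveVectors F) := fun p hp =>
    ((hF.contMDiffAt_of_pos hp.2).comp p contMDiffAt_snd).contMDiffWithinAt
  refine (contMDiff_scale.comp_contMDiffOn (h3.prodMk h1)).congr fun p hp => ?_
  rw [hF.radialExt_eq _ hp.2]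
  have := hgf p.1 hp.1 ⟨normalize F p.2, hF.normalize_mem hp.2⟩
  exact congrArg (scale (F p.2)) this.symm

/-- A smooth family is required to be jointly smooth only in the direct maps. Joint smoothness of
the inverses is deduced here, on the open set to which the maps were extended homogeneously. -/
theorem IsCommutatorLike.contMDiffOn_radialExt_symm (hF : IsFinsler F)
    (hφ : IsCommutatorLike (𝓡 n).tangent (indicatrixBundle F) k ε φ) :
    ContMDiffOn (𝓘(ℝ, Fin k → ℝ).prod (𝓡 n).tangent) (𝓡 n).tangent ∞
      (fun p : (Fin k → ℝ) × TangentBundle (𝓡 n) M => radialExt (φ p.1).1.symm p.2)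
      (paramCube k ε ×ˢ positiveVectors F) :=
  contMDiffOn_inverse_family isOpen_paramCube hF.isOpen_positiveVectors
    (hφ.contMDiffOn_radialExt hF) (fun t _ => hF.contMDiffOn_radialExt (φ t).2.2)
    (fun _ _ _ hv => hF.radialExt_mem _ hv)
    (fun t _ _ hv => hF.radialExt_radialExt (φ t).1.apply_symm_apply hv)
    (fun t _ _ hv => hF.radialExt_radialExt (φ t).1.symm_apply_apply hv)

end Scaling

/-! ### The flow of a horizontal lift -/

theorem mem_of_mem_flowDomain {E : Type*} [NormedAddCommGroup E] [NormedSpace ℝ E]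
    {H : Type*} [TopologicalSpace H] {J : ModelWithCorners ℝ E H}
    {N : Type*} [TopologicalSpace N] [ChartedSpace H N] {V : ∀ v : N, TangentSpace J v} {U : Set N}
    {t : ℝ} {v : N} (h : (t, v) ∈ flowDomain V U) : v ∈ U := by
  obtain ⟨δ, B, fl, ht, -, hv, h⟩ := h
  have hδ : 0 < δ := (abs_nonneg t).trans_lt ht
  have := h.mem v hv 0 ⟨neg_lt_zero.2 hδ, hδ⟩
  rwa [h.init v hv] at this

theorem hasDerivAt_comp_of_hasMFDerivAt {E : Type*} [NormedAddCommGroup E] [NormedSpace ℝ E]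
    {H : Type*} [TopologicalSpace H] {J : ModelWithCorners ℝ E H}
    {N : Type*} [TopologicalSpace N] [ChartedSpace H N] {f : N → ℝ} {γ : ℝ → N} {t : ℝ}
    {A : E →L[ℝ] ℝ} {w : E} (hf : HasMFDerivAt J 𝓘(ℝ, ℝ) f (γ t) A)
    (hγ : HasMFDerivAt 𝓘(ℝ, ℝ) J γ t ((1 : ℝ →L[ℝ] ℝ).smulRight w)) :
    HasDerivAt (fun s => f (γ s)) (A w) t := by
  have h : HasFDerivAt (fun s => f (γ s)) (A.comp ((1 : ℝ →L[ℝ] ℝ).smulRight w)) t :=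
    (hf.comp t hγ).hasFDerivAt
  refine h.hasDerivAt.congr_deriv ?_
  simp

section HorizontalFlow

variable {n : ℕ} {M : Type*} [TopologicalSpace M] [ChartedSpace (EuclideanSpace ℝ (Fin n)) M]
  [IsManifold (𝓡 n) ∞ M]

/-- The times and initial vectors for which the flow of the horizontal lift of `X` is defined. -/
def horizontalDomain (F : TangentBundle (𝓡 n) M → ℝ) (X : ∀ x : M, TangentSpace (𝓡 n) x) :
    Set (ℝ × TangentBundle (𝓡 n) M) := flowDomain (horizontalLiftField F X) (nonzeroVectors n M)

/-- The flow of the horizontal lift of `X`. -/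
def horizontalFlow (F : TangentBundle (𝓡 n) M → ℝ) (X : ∀ x : M, TangentSpace (𝓡 n) x) :
    ℝ × TangentBundle (𝓡 n) M → TangentBundle (𝓡 n) M :=
  flow (horizontalLiftField F X) (nonzeroVectors n M)

theorem hasMFDerivAt_tangentBundle_proj (v : TangentBundle (𝓡 n) M) :
    HasMFDerivAt (𝓡 n).tangent (𝓡 n) (fun w : TangentBundle (𝓡 n) M => w.proj) v
      (ContinuousLinearMap.fst ℝ (EuclideanSpace ℝ (Fin n)) (EuclideanSpace ℝ (Fin n))) := by
  refine ⟨(FiberBundle.continuous_proj (EuclideanSpace ℝ (Fin n))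
    (TangentSpace (𝓡 n) : M → Type _)).continuousAt, HasFDerivAt.hasFDerivWithinAt ?_⟩
  refine (hasFDerivAt_fst (𝕜 := ℝ) (E := EuclideanSpace ℝ (Fin n))
    (F := EuclideanSpace ℝ (Fin n))).congr_of_eventuallyEq ?_
  filter_upwards [extChartAt_target_mem_nhds (I := (𝓡 n).tangent) v] with z hz
  rw [extChartAt_tangent_target] at hz
  exact (extChartAt (𝓡 n) v.proj).right_inv hz.1

variable {F : TangentBundle (𝓡 n) M → ℝ} {X : ∀ x : M, TangentSpace (𝓡 n) x} [T2Space M]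

omit [T2Space M] in
theorem isOpen_horizontalDomain : IsOpen (horizontalDomain F X) := isOpen_flowDomain

section

variable (hF : IsFinsler F) (hX : IsSmoothField X)
include hF hX

omit [T2Space M] in
theorem zero_mem_horizontalDomain {v : TangentBundle (𝓡 n) M} (hv : v ∈ nonzeroVectors n M) :
    (0, v) ∈ horizontalDomain F X :=
  zero_mem_flowDomain isOpen_nonzeroVectors (contMDiffOn_horizontalLiftField hF hX) hv

theorem horizontalFlow_mem {p : ℝ × TangentBundle (𝓡 n) M} (hp : p ∈ horizontalDomain F X) :
    horizontalFlow F X p ∈ nonzeroVectors n M :=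
  flow_mem isOpen_nonzeroVectors (contMDiffOn_horizontalLiftField hF hX) hp

theorem horizontalFlow_zero {v : TangentBundle (𝓡 n) M} (hv : v ∈ nonzeroVectors n M) :
    horizontalFlow F X (0, v) = v :=
  flow_zero isOpen_nonzeroVectors (contMDiffOn_horizontalLiftField hF hX) hv

theorem horizontalFlow_neg {t : ℝ} {v : TangentBundle (𝓡 n) M}
    (hp : (t, v) ∈ horizontalDomain F X)
    (hp' : (-t, horizontalFlow F X (t, v)) ∈ horizontalDomain F X) :
    horizontalFlow F X (-t, horizontalFlow F X (t, v)) = v :=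
  flow_neg_flow isOpen_nonzeroVectors (contMDiffOn_horizontalLiftField hF hX)
    (mem_of_mem_flowDomain hp) hp hp'

theorem contMDiffOn_horizontalFlow : ContMDiffOn (𝓘(ℝ, ℝ).prod (𝓡 n).tangent) (𝓡 n).tangent ∞
    (horizontalFlow F X) (horizontalDomain F X) :=
  contMDiffOn_flow isOpen_nonzeroVectors (contMDiffOn_horizontalLiftField hF hX)

theorem hasMFDerivAt_horizontalFlow {t : ℝ} {v : TangentBundle (𝓡 n) M}
    (hp : (t, v) ∈ horizontalDomain F X) :
    HasMFDerivAt 𝓘(ℝ, ℝ) (𝓡 n).tangent (fun s => horizontalFlow F X (s, v)) t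
      ((1 : ℝ →L[ℝ] ℝ).smulRight (horizontalLiftField F X (horizontalFlow F X (t, v)))) :=
  hasMFDerivAt_flow isOpen_nonzeroVectors (contMDiffOn_horizontalLiftField hF hX) hp

theorem hasMFDerivAt_proj_horizontalFlow {t : ℝ} {v : TangentBundle (𝓡 n) M}
    (hp : (t, v) ∈ horizontalDomain F X) :
    HasMFDerivAt 𝓘(ℝ, ℝ) (𝓡 n) (fun s => (horizontalFlow F X (s, v)).proj) t
      ((1 : ℝ →L[ℝ] ℝ).smulRight (X (horizontalFlow F X (t, v)).proj)) :=
  (hasMFDerivAt_tangentBundle_proj _).comp t (hasMFDerivAt_horizontalFlow hF hX hp)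

/-- Horizontal flows preserve the Finsler function. -/
theorem apply_horizontalFlow {t : ℝ} {v : TangentBundle (𝓡 n) M}
    (hp : (t, v) ∈ horizontalDomain F X) : F (horizontalFlow F X (t, v)) = F v := by
  obtain ⟨δ, hδ, h⟩ := exists_Ioo_flowDomain hp
  have hd : ∀ s ∈ Ioo (-δ) δ, HasDerivAt (fun s => F (horizontalFlow F X (s, v))) 0 s := by
    intro s hs
    have hm := horizontalFlow_mem hF hX (h s hs)
    exact (hasDerivAt_comp_of_hasMFDerivAt
      ((hF.contMDiffAt hm).mdifferentiableAt (by simp)).hasMFDerivAt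
      (hasMFDerivAt_horizontalFlow hF hX (h s hs))).congr_deriv (mfderiv_horizontalLift hF hm (X _))
  have hδ0 : 0 < δ := (abs_nonneg t).trans_lt hδ
  have h0 := isOpen_Ioo.is_const_of_deriv_eq_zero isPreconnected_Ioo
    (fun s hs => (hd s hs).differentiableAt.differentiableWithinAt) (fun s hs => (hd s hs).deriv)
    (abs_lt.1 hδ : t ∈ Ioo (-δ) δ) (⟨neg_lt_zero.2 hδ0, hδ0⟩ : (0 : ℝ) ∈ Ioo (-δ) δ)
  refine h0.trans ?_
  rw [horizontalFlow_zero hF hX (mem_of_mem_flowDomain hp)]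

/-- Both projections are integral curves of `X` with the same initial point. So the horizontal flow
carries fibres to fibres, and a whole indicatrix is translated along one curve. -/
theorem proj_horizontalFlow_eq {t : ℝ} {v w : TangentBundle (𝓡 n) M}
    (hv : (t, v) ∈ horizontalDomain F X) (hw : (t, w) ∈ horizontalDomain F X)
    (hvw : v.proj = w.proj) :
    (horizontalFlow F X (t, v)).proj = (horizontalFlow F X (t, w)).proj := by
  obtain ⟨δ, hδ, h⟩ := exists_Ioo_flowDomain hv
  obtain ⟨δ', hδ', h'⟩ := exists_Ioo_flowDomain hw
  have hm : 0 < min δ δ' := lt_min ((abs_nonneg t).trans_lt hδ) ((abs_nonneg t).trans_lt hδ')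
  refine eqOn_Ioo_of_integralCurve (J := 𝓡 n) (V := X) (U := univ) (a := -min δ δ')
    (b := min δ δ') (t₀ := 0) (γ := fun s => (horizontalFlow F X (s, v)).proj)
    (γ' := fun s => (horizontalFlow F X (s, w)).proj)
    isOpen_univ (contMDiffOn_univ.2 hX) ⟨neg_lt_zero.2 hm, hm⟩ (fun _ _ => trivial)
    (fun s hs => hasMFDerivAt_proj_horizontalFlow hF hX (h s
      ⟨(neg_le_neg (min_le_left _ _)).trans_lt hs.1, hs.2.trans_le (min_le_left _ _)⟩))
    (fun s hs => hasMFDerivAt_proj_horizontalFlow hF hX (h' s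
      ⟨(neg_le_neg (min_le_right _ _)).trans_lt hs.1, hs.2.trans_le (min_le_right _ _)⟩)) ?_
    (abs_lt.1 (lt_min hδ hδ'))
  rw [horizontalFlow_zero hF hX (mem_of_mem_flowDomain hv),
    horizontalFlow_zero hF hX (mem_of_mem_flowDomain hw), hvw]

end

/-! ### Uniform existence times -/

/-- The times and initial vectors for which the horizontal flow may be undone on the whole
indicatrix. -/
def safeDomain (F : TangentBundle (𝓡 n) M → ℝ) (X : ∀ x : M, TangentSpace (𝓡 n) x) :
    Set (ℝ × TangentBundle (𝓡 n) M) :=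
  {p | p ∈ horizontalDomain F X ∧
    ∀ w ∈ indicatrix F (horizontalFlow F X p).proj, (-p.1, w) ∈ horizontalDomain F X}

omit [T2Space M] in
/-- Indicatrices are uniformly compact. -/
theorem IsFinsler.eventually_forall_indicatrix (hF : IsFinsler F)
    {O : Set (ℝ × TangentBundle (𝓡 n) M)} {x₀ : M}
    (h0 : ∀ w ∈ indicatrix F x₀, O ∈ 𝓝 (0, w)) :
    ∀ᶠ p : ℝ × M in 𝓝 (0, x₀), ∀ w ∈ indicatrix F p.2, (p.1, w) ∈ O := by
  set v₀ : TangentBundle (𝓡 n) M := ⟨x₀, 0⟩ with hv₀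
  set c := extChartAt (𝓡 n).tangent v₀ with hc
  set e := extChartAt (𝓡 n) x₀ with he
  set S := Metric.sphere (0 : EuclideanSpace ℝ (Fin n)) 1 with hS
  have hsymm : ∀ x ∈ e.source, ∀ y, c.symm (e x, y) = (⟨x,
      (tangentCoordChange (𝓡 n) x₀ x x y : EuclideanSpace ℝ (Fin n))⟩ :
        TangentBundle (𝓡 n) M) := by
    intro x hx y
    have h1 := extChartAt_tangent_symm v₀ (z := (e x, y)) (e.map_source hx)
    have h2 : ∀ q, q = x → (⟨q, (tangentCoordChange (𝓡 n) x₀ q q y : EuclideanSpace ℝ (Fin n))⟩ :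
        TangentBundle (𝓡 n) M) =
        ⟨x, (tangentCoordChange (𝓡 n) x₀ x x y : EuclideanSpace ℝ (Fin n))⟩ := by
      rintro _ rfl
      rfl
    exact h1.trans (h2 _ (e.left_inv hx))
  have hsc : ∀ x ∈ e.source, ∀ (a : ℝ) y, c.symm (e x, a • y) = scale a (c.symm (e x, y)) := by
    intro x hx a y
    rw [hsymm x hx, hsymm x hx]
    exact congrArg (Bundle.TotalSpace.mk x)
      ((tangentCoordChange (𝓡 n) x₀ x x : EuclideanSpace ℝ (Fin n) →L[ℝ] _).map_smul a y)
  have hx₀ : x₀ ∈ e.source := mem_extChartAt_source x₀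
  -- Every vector of a nearby indicatrix is the normalization of a vector of Euclidean norm `1` in
  -- the chart, so compactness of one sphere controls all nearby indicatrices.
  have key : ∀ᶠ p : ℝ × M in 𝓝 (0, x₀), ∀ y ∈ S, 0 < F (c.symm (e p.2, y)) →
      (p.1, normalize F (c.symm (e p.2, y))) ∈ O := by
    refine (isCompact_sphere _ _).eventually_forall_of_forall_eventually fun y hy => ?_
    have hct : ContinuousAt (fun q : (ℝ × M) × EuclideanSpace ℝ (Fin n) => c.symm (e q.1.2, q.2))
        ((0, x₀), y) := by
      have h1 : ContinuousAt c.symm (e x₀, y) := by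
        refine (continuousOn_extChartAt_symm v₀).continuousAt
          ((isOpen_extChartAt_target v₀).mem_nhds ?_)
        rw [extChartAt_tangent_target]
        exact ⟨mem_extChartAt_target x₀, trivial⟩
      have h2 : ContinuousAt (fun q : (ℝ × M) × EuclideanSpace ℝ (Fin n) => (e q.1.2, q.2))
          ((0, x₀), y) := by
        refine ContinuousAt.prodMk ?_ continuousAt_snd
        exact ContinuousAt.comp (g := e) (f := fun q : (ℝ × M) × EuclideanSpace ℝ (Fin n) => q.1.2)
          (continuousAt_extChartAt x₀) (continuousAt_snd.comp continuousAt_fst)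
      exact ContinuousAt.comp (f := fun q : (ℝ × M) × EuclideanSpace ℝ (Fin n) => (e q.1.2, q.2))
        h1 h2
    set w := c.symm (e x₀, y) with hw
    have hwx : w.proj = x₀ := by rw [hw, hsymm x₀ hx₀]
    -- Directions with `F < 0` carry no vector of the indicatrix; this persists nearby, making the
    -- claim vacuous there. `F = 0` is impossible on the unit sphere.
    rcases lt_trichotomy (F w) 0 with h | h | h
    · have h1 : ∀ᶠ q : (ℝ × M) × EuclideanSpace ℝ (Fin n) in 𝓝 ((0, x₀), y),
          F (c.symm (e q.1.2, q.2)) < 0 :=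
        (hF.continuous.continuousAt.comp hct).eventually (gt_mem_nhds h)
      filter_upwards [h1] with q hq hq'
      exact absurd hq' hq.not_gt
    · refine absurd h (hF.ne_zero ?_)
      refine (symm_mem_nonzeroVectors (v := v₀) (mem_extChartAt_target x₀)).2 ?_
      intro h
      have h' : y = 0 := h
      rw [h'] at hy
      simp at hy
    · have hw1 : normalize F w ∈ indicatrix F x₀ := ⟨hwx, hF.normalize_mem h⟩
      have h2 : ContinuousAt (fun q : (ℝ × M) × EuclideanSpace ℝ (Fin n) =>
          (q.1.1, normalize F (c.symm (e q.1.2, q.2)))) ((0, x₀), y) := by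
        refine (continuousAt_fst.comp continuousAt_fst).prodMk ?_
        exact ContinuousAt.comp (g := normalize F)
          (f := fun q : (ℝ × M) × EuclideanSpace ℝ (Fin n) => c.symm (e q.1.2, q.2))
          (hF.contMDiffOn_normalize.continuousOn.continuousAt
            (hF.isOpen_positiveVectors.mem_nhds h)) hct
      filter_upwards [h2.preimage_mem_nhds (h0 _ hw1)] with q hq _ using hq
  have hsrc : ∀ᶠ p : ℝ × M in 𝓝 (0, x₀), p.2 ∈ e.source :=
    continuousAt_snd.eventually (extChartAt_source_mem_nhds x₀)
  filter_upwards [key, hsrc] with p hp hp2 w hw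
  obtain ⟨hwp, hwF⟩ := hw
  have hwF' : F w = 1 := hwF
  have hwc : w ∈ c.source := by
    rw [hc, extChartAt_tangent_source]
    change w.proj ∈ e.source
    rwa [hwp]
  have hcw : c w = (e p.2, (c w).2) := Prod.ext (congrArg e hwp) rfl
  set y := (c w).2 with hy
  have hy0 : y ≠ 0 := (extChartAt_mem_slit (v := v₀) (by change w.proj ∈ e.source; rwa [hwp])
    (hF.mem_nonzeroVectors (by rw [hwF']; exact one_ne_zero))).2
  have hn : 0 < ‖y‖ := norm_pos_iff.2 hy0
  have hws : c.symm (e p.2, ‖y‖⁻¹ • y) = scale ‖y‖⁻¹ w := by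
    rw [hsc _ hp2, ← hcw, c.left_inv hwc]
  have h1 := hp (‖y‖⁻¹ • y) (by
    rw [hS, mem_sphere_zero_iff_norm, norm_smul, norm_inv, norm_norm, inv_mul_cancel₀ hn.ne'])
  rw [hws, hF.apply_scale (inv_pos.2 hn), hwF', mul_one, hF.normalize_scale (inv_pos.2 hn) hwF] at h1
  exact h1 (inv_pos.2 hn)

/-- Uniform compactness is used twice: once to flow all indicatrices near `x₀` for a short time, and
once to ensure that the short flow ends over points where the first statement applies with the
opposite time. -/
theorem eventually_safeDomain (hF : IsFinsler F) (hX : IsSmoothField X) (x₀ : M) :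
    ∀ᶠ p : ℝ × M in 𝓝 (0, x₀), ∀ w ∈ indicatrix F p.2, (p.1, w) ∈ safeDomain F X := by
  have hnz : ∀ {x : M} {w}, w ∈ indicatrix F x → w ∈ nonzeroVectors n M := fun {x w} hw =>
    hF.mem_nonzeroVectors (by rw [show F w = 1 from hw.2]; exact one_ne_zero)
  have hA : ∀ᶠ p : ℝ × M in 𝓝 (0, x₀), ∀ w ∈ indicatrix F p.2, (p.1, w) ∈ horizontalDomain F X :=
    hF.eventually_forall_indicatrix fun w hw =>
      isOpen_flowDomain.mem_nhds (zero_mem_horizontalDomain hF hX (hnz hw))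
  refine hF.eventually_forall_indicatrix fun w hw => ?_
  have hD : horizontalDomain F X ∈ 𝓝 (0, w) :=
    isOpen_flowDomain.mem_nhds (zero_mem_horizontalDomain hF hX (hnz hw))
  have hc : Tendsto (fun p : ℝ × TangentBundle (𝓡 n) M => (-p.1, (horizontalFlow F X p).proj))
      (𝓝 (0, w)) (𝓝 (0, x₀)) := by
    have h1 : ContinuousAt (horizontalFlow F X) (0, w) :=
      (contMDiffOn_horizontalFlow hF hX).continuousOn.continuousAt hD
    have h2 := ((FiberBundle.continuous_proj (EuclideanSpace ℝ (Fin n))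
      (TangentSpace (𝓡 n) : M → Type _)).continuousAt (x := horizontalFlow F X (0, w))).comp h1
    have h3 : Tendsto (fun p : ℝ × TangentBundle (𝓡 n) M => -p.1) (𝓝 (0, w)) (𝓝 0) :=
      (continuous_fst.neg).tendsto' _ _ neg_zero
    have h4 := h2.tendsto
    simp only [Function.comp_apply, horizontalFlow_zero hF hX (hnz hw)] at h4
    rw [hw.1] at h4
    exact h3.prodMk_nhds h4
  filter_upwards [hD, hc.eventually hA] with p h1 h2 using ⟨h1, h2⟩

/-- The admissible radii at a point form an interval, hence a convex set, and some constant radius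
is admissible locally. A partition of unity then glues these constants to a smooth function. -/
theorem exists_safe_radius [SecondCountableTopology M] (hF : IsFinsler F) (hX : IsSmoothField X) :
    ∃ δ : M → ℝ, ContMDiff (𝓡 n) 𝓘(ℝ, ℝ) ∞ δ ∧ (∀ x, 0 < δ x) ∧
      ∀ x τ, |τ| < δ x → ∀ w ∈ indicatrix F x, (τ, w) ∈ safeDomain F X := by
  have : LocallyCompactSpace M := ChartedSpace.locallyCompactSpace (EuclideanSpace ℝ (Fin n)) M
  obtain ⟨δ, hδ⟩ := exists_contMDiffMap_forall_mem_convex_of_local_const (𝓡 n) (n := (⊤ : ℕ∞)) (F := ℝ)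
    (t := fun x => {d | 0 < d ∧ ∀ τ, |τ| < d → ∀ w ∈ indicatrix F x, (τ, w) ∈ safeDomain F X})
    (fun x => by
      refine Set.OrdConnected.convex ⟨fun a ha b hb c hc => ⟨ha.1.trans_le hc.1, fun τ hτ =>
        hb.2 τ (hτ.trans_le hc.2)⟩⟩)
    (fun x => by
      have h1 := eventually_safeDomain hF hX x
      rw [nhds_prod_eq] at h1
      obtain ⟨pa, ha, pb, hb, h2⟩ := eventually_prod_iff.1 h1
      obtain ⟨d, hd, hd2⟩ := Metric.eventually_nhds_iff.1 ha
      refine ⟨d, ?_⟩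
      filter_upwards [hb] with y hy
      exact ⟨hd, fun τ hτ => h2 (hd2 (by simpa using hτ)) hy⟩)
  exact ⟨δ, δ.contMDiff, fun x => (hδ x).1, fun x => (hδ x).2⟩

end HorizontalFlow

/-! ### Horizontal flows are parallel translations -/

theorem hasMFDerivAt_comp_mul {E : Type*} [NormedAddCommGroup E] [NormedSpace ℝ E]
    {H : Type*} [TopologicalSpace H] {J : ModelWithCorners ℝ E H}
    {N : Type*} [TopologicalSpace N] [ChartedSpace H N] {γ : ℝ → N} {t a : ℝ} {w : E}
    (hγ : HasMFDerivAt 𝓘(ℝ, ℝ) J γ (t * a) ((1 : ℝ →L[ℝ] ℝ).smulRight w)) :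
    HasMFDerivAt 𝓘(ℝ, ℝ) J (fun s => γ (s * a)) t ((1 : ℝ →L[ℝ] ℝ).smulRight (a • w)) := by
  have h1 : HasMFDerivAt 𝓘(ℝ, ℝ) 𝓘(ℝ, ℝ) (fun s : ℝ => s * a) t
      ((1 : ℝ →L[ℝ] ℝ).smulRight a) := by
    have := (hasDerivAt_id t).mul_const a
    rw [one_mul] at this
    exact this.hasFDerivAt.hasMFDerivAt
  refine (hγ.comp t h1).congr_mfderiv ?_
  ext
  change ((1 : ℝ) • a) • w = (1 : ℝ) • a • w
  rw [one_smul, one_smul]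

theorem mfderivWithin_Icc_one {E : Type*} [NormedAddCommGroup E] [NormedSpace ℝ E]
    {H : Type*} [TopologicalSpace H] {J : ModelWithCorners ℝ E H}
    {N : Type*} [TopologicalSpace N] [ChartedSpace H N] {γ : ℝ → N} {t : ℝ} {w : E}
    (hγ : HasMFDerivAt 𝓘(ℝ, ℝ) J γ t ((1 : ℝ →L[ℝ] ℝ).smulRight w)) (ht : t ∈ Icc (0 : ℝ) 1) :
    (mfderivWithin 𝓘(ℝ, ℝ) J γ (Icc 0 1) t (1 : ℝ) : E) = w := by
  have h1 := hγ.hasMFDerivWithinAt.mfderivWithin (s := Icc 0 1)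
    ((uniqueDiffOn_Icc zero_lt_one).uniqueMDiffOn t ht)
  exact (congrArg (fun A : ℝ →L[ℝ] E => A 1) h1).trans (one_smul ℝ w)

section Transport

variable {n : ℕ} {M : Type*} [TopologicalSpace M] [ChartedSpace (EuclideanSpace ℝ (Fin n)) M]
  [IsManifold (𝓡 n) ∞ M] {F : TangentBundle (𝓡 n) M → ℝ} {X : ∀ x : M, TangentSpace (𝓡 n) x}

theorem horizontalLift_smul (F : TangentBundle (𝓡 n) M → ℝ) (v : TangentBundle (𝓡 n) M) (a : ℝ)
    (ξ : EuclideanSpace ℝ (Fin n)) :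
    horizontalLift F v (a • ξ : EuclideanSpace ℝ (Fin n)) =
      (a • (horizontalLift F v ξ : EuclideanSpace ℝ (Fin n) × EuclideanSpace ℝ (Fin n))) := by
  have aux : ∀ A : Fin n → ℝ, -∑ j, A j * (a • ξ) j = a * -∑ j, A j * ξ j := fun A => by
    rw [mul_neg, Finset.mul_sum]
    refine congrArg Neg.neg (Finset.sum_congr rfl fun j _ => ?_)
    rw [PiLp.smul_apply, smul_eq_mul]
    ring
  refine Prod.ext rfl ?_
  ext i
  exact aux _

theorem mem_nonzeroVectors_of_mem (hF : IsFinsler F) {v : TangentBundle (𝓡 n) M}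
    (hv : v ∈ indicatrixBundle F) : v ∈ nonzeroVectors n M :=
  hF.mem_nonzeroVectors (by rw [show F v = 1 from hv]; exact one_ne_zero)

variable [T2Space M]

open Classical in
/-- The flow of the horizontal lift of `X` on `IM`. -/
def transport (F : TangentBundle (𝓡 n) M → ℝ) (X : ∀ x : M, TangentSpace (𝓡 n) x) (t : ℝ)
    (v : indicatrixBundle F) : indicatrixBundle F :=
  if h : horizontalFlow F X (t, v) ∈ indicatrixBundle F then ⟨horizontalFlow F X (t, v), h⟩ else v

variable (hF : IsFinsler F) (hX : IsSmoothField X)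
include hF hX

theorem transport_coe {t : ℝ} {v : indicatrixBundle F} (h : (t, (v : TangentBundle (𝓡 n) M)) ∈
    horizontalDomain F X) : (transport F X t v : TangentBundle (𝓡 n) M) =
      horizontalFlow F X (t, v) := by
  have h1 : horizontalFlow F X (t, v) ∈ indicatrixBundle F :=
    (apply_horizontalFlow hF hX h).trans v.2
  rw [transport, dif_pos h1]

theorem proj_transport_eq {t : ℝ} {v w : indicatrixBundle F}
    (hv : (t, (v : TangentBundle (𝓡 n) M)) ∈ horizontalDomain F X)
    (hw : (t, (w : TangentBundle (𝓡 n) M)) ∈ horizontalDomain F X)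
    (hvw : v.1.proj = w.1.proj) : (transport F X t v).1.proj = (transport F X t w).1.proj := by
  rw [transport_coe hF hX hv, transport_coe hF hX hw, proj_horizontalFlow_eq hF hX hv hw hvw]

/-- This is what `safeDomain` provides: any vector of the indicatrix at the endpoint, not only the
image of `v`, can be flowed back. A fibre-preserving map may therefore act between the two flows. -/
theorem neg_mem_horizontalDomain {t : ℝ} {v w : indicatrixBundle F}
    (h : (t, (v : TangentBundle (𝓡 n) M)) ∈ safeDomain F X)
    (hw : w.1.proj = (transport F X t v).1.proj) :
    (-t, (w : TangentBundle (𝓡 n) M)) ∈ horizontalDomain F X := by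
  rw [transport_coe hF hX h.1] at hw
  exact h.2 w ⟨hw, w.2⟩

theorem transport_neg {t : ℝ} {v : indicatrixBundle F}
    (h : (t, (v : TangentBundle (𝓡 n) M)) ∈ safeDomain F X) :
    transport F X (-t) (transport F X t v) = v := by
  have h1 := neg_mem_horizontalDomain hF hX h (w := transport F X t v) rfl
  refine Subtype.ext ?_
  rw [transport_coe hF hX h1]
  rw [transport_coe hF hX h.1] at h1 ⊢
  exact horizontalFlow_neg hF hX h.1 h1

theorem proj_transport_neg {t : ℝ} {v w : indicatrixBundle F}
    (h : (t, (v : TangentBundle (𝓡 n) M)) ∈ safeDomain F X)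
    (hw : w.1.proj = (transport F X t v).1.proj) :
    (transport F X (-t) w).1.proj = v.1.proj := by
  rw [proj_transport_eq hF hX (neg_mem_horizontalDomain hF hX h hw)
    (neg_mem_horizontalDomain hF hX h rfl) hw, transport_neg hF hX h]

theorem transport_neg' {t : ℝ} {v w : indicatrixBundle F}
    (h : (t, (v : TangentBundle (𝓡 n) M)) ∈ safeDomain F X)
    (hw : w.1.proj = (transport F X t v).1.proj)
    (h' : (t, (transport F X (-t) w : TangentBundle (𝓡 n) M)) ∈ horizontalDomain F X) :
    transport F X t (transport F X (-t) w) = w := by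
  have h1 := neg_mem_horizontalDomain hF hX h hw
  refine Subtype.ext ?_
  rw [transport_coe hF hX h']
  rw [transport_coe hF hX h1] at h' ⊢
  have h2 := horizontalFlow_neg hF hX h1 (by rwa [neg_neg])
  rwa [neg_neg] at h2

/-- Transport between indicatrices along an integral curve of `X`. -/
def transportEquiv {t : ℝ} {p : M} (h : ∀ v ∈ indicatrix F p, (t, v) ∈ safeDomain F X)
    (v₀ : indicatrixBundle F) (hv₀ : v₀.1.proj = p) :
    indicatrix F p ≃ indicatrix F (transport F X t v₀).1.proj where
  toFun v := ⟨transport F X t ⟨v, v.2.2⟩, proj_transport_eq hF hX (h v v.2).1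
    (h v₀ ⟨hv₀, v₀.2⟩).1 (v.2.1.trans hv₀.symm), (transport F X t ⟨v, v.2.2⟩).2⟩
  invFun w := ⟨transport F X (-t) ⟨w, w.2.2⟩,
    (proj_transport_neg hF hX (h v₀ ⟨hv₀, v₀.2⟩) w.2.1).trans hv₀,
    (transport F X (-t) ⟨w, w.2.2⟩).2⟩
  left_inv v := Subtype.ext (congrArg (fun w : indicatrixBundle F => (w : TangentBundle (𝓡 n) M))
    (transport_neg hF hX (v := ⟨v, v.2.2⟩) (h v v.2)))
  right_inv w := Subtype.ext (congrArg
    (fun w : indicatrixBundle F => (w : TangentBundle (𝓡 n) M)) (transport_neg' hF hX (w := ⟨w, w.2.2⟩) (h v₀ ⟨hv₀, v₀.2⟩) w.2.1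
      (h _ ⟨(proj_transport_neg hF hX (h v₀ ⟨hv₀, v₀.2⟩) w.2.1).trans hv₀,
        (transport F X (-t) ⟨w, w.2.2⟩).2⟩).1))

omit [T2Space M] hF hX in
theorem mul_mem_horizontalDomain {t s : ℝ} {v : TangentBundle (𝓡 n) M}
    (h : (t, v) ∈ horizontalDomain F X) (hs : s ∈ Icc (0 : ℝ) 1) :
    (s * t, v) ∈ horizontalDomain F X := by
  refine flowDomain_mono h ?_
  rw [abs_mul, abs_of_nonneg hs.1]
  exact mul_le_of_le_one_left (abs_nonneg t) hs.2

/-- A flow line of `X^h` has velocity the horizontal lift of `X`, and `X` is the velocity of its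
projection, so it is parallel. Rescaling time to `[0, 1]` multiplies both velocities by `t`, and the
lift is linear; the sign of `t` plays no role. -/
theorem isTranslationAlong_transportEquiv {t : ℝ} {p : M}
    (h : ∀ v ∈ indicatrix F p, (t, v) ∈ safeDomain F X)
    (v₀ : indicatrixBundle F) (hv₀ : v₀.1.proj = p) :
    IsTranslationAlong F (fun s => (horizontalFlow F X (s * t, v₀)).proj)
      (transportEquiv hF hX h v₀ hv₀) := by
  intro v
  have hd := (h v v.2).1
  have hd₀ := (h v₀ ⟨hv₀, v₀.2⟩).1
  refine ⟨fun s => horizontalFlow F X (s * t, v), ⟨fun s hs => ?_, fun s hs => ⟨?_, ?_⟩⟩,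
    fun s hs => ?_, ?_, ?_⟩
  · exact (hasMFDerivAt_comp_mul (γ := fun s => horizontalFlow F X (s, v))
      (hasMFDerivAt_horizontalFlow hF hX
      (mul_mem_horizontalDomain hd hs))).mdifferentiableAt.mdifferentiableWithinAt
  · exact horizontalFlow_mem hF hX (mul_mem_horizontalDomain hd hs)
  · have e1 := mfderivWithin_Icc_one (hasMFDerivAt_comp_mul
      (γ := fun s => horizontalFlow F X (s, v)) (hasMFDerivAt_horizontalFlow hF hX
      (mul_mem_horizontalDomain hd hs))) hs
    have e2 := mfderivWithin_Icc_one (hasMFDerivAt_comp_mul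
      (γ := fun s => (horizontalFlow F X (s, v)).proj) (hasMFDerivAt_proj_horizontalFlow hF hX
      (mul_mem_horizontalDomain hd hs))) hs
    refine e1.trans (Eq.trans ?_ (congrArg (horizontalLift F _) e2).symm)
    exact (horizontalLift_smul F _ t _).symm
  · exact proj_horizontalFlow_eq hF hX (mul_mem_horizontalDomain hd hs)
      (mul_mem_horizontalDomain hd₀ hs) (v.2.1.trans hv₀.symm)
  · dsimp only
    rw [zero_mul, horizontalFlow_zero hF hX (mem_nonzeroVectors_of_mem hF v.2.2)]
  · dsimp only
    rw [one_mul]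
    exact (transport_coe hF hX (v := ⟨v, v.2.2⟩) hd).symm

/-- The projected integral curve is `C^∞`, so a single arc suffices for every `r`. -/
theorem isTranslation_transportEquiv (r : ℕ∞) {t : ℝ} {p : M}
    (h : ∀ v ∈ indicatrix F p, (t, v) ∈ safeDomain F X)
    (v₀ : indicatrixBundle F) (hv₀ : v₀.1.proj = p) :
    IsTranslation F r p _ (transportEquiv hF hX h v₀ hv₀) := by
  have hd₀ := (h v₀ ⟨hv₀, v₀.2⟩).1
  refine IsTranslation.append (Equiv.refl _) (transportEquiv hF hX h v₀ hv₀) _ IsTranslation.refl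
    (fun s hs => ?_) ?_ ?_ (isTranslationAlong_transportEquiv hF hX h v₀ hv₀)
  · have h1 : ContMDiffAt (𝓘(ℝ, ℝ).prod (𝓡 n).tangent) (𝓡 n).tangent ∞ (horizontalFlow F X)
        (s * t, v₀) := (contMDiffOn_horizontalFlow hF hX).contMDiffAt
      (isOpen_horizontalDomain.mem_nhds (mul_mem_horizontalDomain hd₀ hs))
    have h2 : ContMDiffAt 𝓘(ℝ, ℝ) (𝓘(ℝ, ℝ).prod (𝓡 n).tangent) ∞
        (fun s : ℝ => (s * t, (v₀ : TangentBundle (𝓡 n) M))) s :=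
      ContMDiffAt.prodMk (contDiffAt_id.mul contDiffAt_const).contMDiffAt contMDiffAt_const
    have h3 := ContMDiffAt.comp (f := fun s : ℝ => (s * t, (v₀ : TangentBundle (𝓡 n) M))) s h1 h2
    have h4 : ContMDiffAt 𝓘(ℝ, ℝ) (𝓡 n) ∞
        (fun s => (horizontalFlow F X (s * t, v₀)).proj) s :=
      ContMDiffAt.comp (I' := (𝓡 n).tangent) (g := fun w : TangentBundle (𝓡 n) M => w.proj) s
        (Bundle.contMDiff_proj (TangentSpace (𝓡 n) : M → Type _)).contMDiffAt h3
    exact (h4.of_le (by exact_mod_cast le_top)).contMDiffWithinAt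
  · rw [zero_mul, horizontalFlow_zero hF hX (mem_nonzeroVectors_of_mem hF v₀.2), hv₀]
  · rw [one_mul, transport_coe hF hX hd₀]

/-! ### Commutators of holonomies with horizontal flows -/

omit [T2Space M] hF hX in
theorem proj_apply_of_mem_fibredHolonomyGroup {r : ℕ∞}
    {f : diffeoGroup (𝓡 n).tangent (indicatrixBundle F)} (hf : f ∈ fibredHolonomyGroup F r)
    (v : indicatrixBundle F) : (f.1 v).1.proj = v.1.proj := by
  obtain ⟨φ, -, h⟩ := hf v.1.proj
  have := h ⟨v, rfl, v.2⟩
  rw [show f.1 v = f.1 ⟨v, v.2⟩ from rfl, this]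
  exact (φ.1 ⟨v, rfl, v.2⟩).2.1

/-- The fibrewise commutator of `f` and the horizontal flow at the time `τ`. -/
def commutatorEquiv (f : Equiv.Perm (indicatrixBundle F)) (hf : ∀ v, (f v).1.proj = v.1.proj)
    (τ : M → ℝ) (hτ : ∀ v ∈ indicatrixBundle F, (τ v.proj, v) ∈ safeDomain F X) :
    Equiv.Perm (indicatrixBundle F) := by
  have hf' : ∀ v, (f.symm v).1.proj = v.1.proj := fun v => by
    rw [← hf (f.symm v), f.apply_symm_apply]
  have hs : ∀ (x : M) (w : indicatrixBundle F), w.1.proj = x →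
      (τ x, (w : TangentBundle (𝓡 n) M)) ∈ safeDomain F X := by
    rintro _ w rfl
    exact hτ w w.2
  exact {
    toFun := fun v => transport F X (-τ v.1.proj) (f (transport F X (τ v.1.proj) (f.symm v)))
    invFun := fun v => f (transport F X (-τ v.1.proj) (f.symm (transport F X (τ v.1.proj) v)))
    left_inv := fun v => by
      have h1 := hs _ _ (hf' v)
      have h2 := hf (transport F X (τ v.1.proj) (f.symm v))
      -- The commutator returns to the fibre it started from, so the inverse uses the same value of
      -- `τ` and the factors cancel.
      have h3 : (transport F X (-τ v.1.proj) (f (transport F X (τ v.1.proj) (f.symm v)))).1.proj =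
        v.1.proj := (proj_transport_neg hF hX h1 h2).trans (hf' v)
      dsimp only
      rw [h3, transport_neg' hF hX h1 h2 (hs _ _ h3).1, f.symm_apply_apply,
        transport_neg hF hX h1, f.apply_symm_apply]
    right_inv := fun v => by
      have h1 := hs _ v rfl
      have h2 := hf' (transport F X (τ v.1.proj) v)
      have h3 : (transport F X (-τ v.1.proj) (f.symm (transport F X (τ v.1.proj) v))).1.proj =
        v.1.proj := proj_transport_neg hF hX h1 h2
      dsimp only
      rw [hf, h3, f.symm_apply_apply, transport_neg' hF hX h1 h2 (hs _ _ h3).1,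
        f.apply_symm_apply, transport_neg hF hX h1] }

end Transport

/-! ### Smoothness of the commutators -/

/-- A function of `s` with values in `(-d, d)` and derivative `1` at `0`. -/
def truncatedTime (d s : ℝ) : ℝ := s * d ^ 2 / (d ^ 2 + s ^ 2)

theorem truncatedTime_zero (d : ℝ) : truncatedTime d 0 = 0 := by simp [truncatedTime]

theorem abs_truncatedTime_lt {d : ℝ} (hd : 0 < d) (s : ℝ) : |truncatedTime d s| < d := by
  have h1 : 0 < d ^ 2 + s ^ 2 := by positivity
  rw [truncatedTime, abs_div, abs_of_pos h1, div_lt_iff₀ h1, abs_mul, abs_of_pos (pow_pos hd 2)]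
  -- This follows from `(|s| - d/2)² ≥ 0` and `d > 0`; multiplied by `d` it is the required bound.
  have h2 : |s| * d < d ^ 2 + s ^ 2 := by
    rw [← sq_abs s]
    nlinarith [sq_nonneg (|s| - d / 2), sq_nonneg d, pow_pos hd 2]
  nlinarith

theorem contDiffAt_truncatedTime {d : ℝ} (hd : 0 < d) (s : ℝ) :
    ContDiffAt ℝ ∞ (fun p : ℝ × ℝ => truncatedTime p.1 p.2) (d, s) := by
  refine ContDiffAt.div (contDiffAt_snd.mul (contDiffAt_fst.pow 2))
    ((contDiffAt_fst.pow 2).add (contDiffAt_snd.pow 2)) ?_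
  positivity

theorem hasDerivAt_truncatedTime {d : ℝ} (hd : 0 < d) : HasDerivAt (truncatedTime d) 1 0 := by
  have h1 : HasDerivAt (fun s : ℝ => s * d ^ 2) (1 * d ^ 2) 0 := (hasDerivAt_id 0).mul_const _
  have h2 : HasDerivAt (fun s : ℝ => d ^ 2 + s ^ 2) (((2 : ℕ) : ℝ) * 0 ^ (2 - 1)) 0 :=
    (hasDerivAt_pow 2 (0 : ℝ)).const_add _
  refine (h1.div h2 (by positivity)).congr_deriv ?_
  field_simp
  ring

section Commutator

variable {n : ℕ} {M : Type*} [TopologicalSpace M] [ChartedSpace (EuclideanSpace ℝ (Fin n)) M]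
  [IsManifold (𝓡 n) ∞ M] {F : TangentBundle (𝓡 n) M → ℝ} {X : ∀ x : M, TangentSpace (𝓡 n) x}

variable (F X) in
/-- The extension of the fibrewise commutator to nonzero vectors. -/
def commutatorMap (f : Equiv.Perm (indicatrixBundle F)) (t : ℝ)
    (v : TangentBundle (𝓡 n) M) : TangentBundle (𝓡 n) M :=
  horizontalFlow F X (-t, radialExt f (horizontalFlow F X (t, radialExt f.symm v)))

variable (F X) in
/-- The extension of the inverse of the fibrewise commutator. -/
def commutatorMapInv (f : Equiv.Perm (indicatrixBundle F)) (t : ℝ)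
    (v : TangentBundle (𝓡 n) M) : TangentBundle (𝓡 n) M :=
  radialExt f (horizontalFlow F X (-t, radialExt f.symm (horizontalFlow F X (t, v))))

variable [T2Space M] (hF : IsFinsler F) (hX : IsSmoothField X)
include hF hX

section Coe

variable {f : Equiv.Perm (indicatrixBundle F)} (hf : ∀ v, (f v).1.proj = v.1.proj)
  {τ : M → ℝ} (hτ : ∀ v ∈ indicatrixBundle F, (τ v.proj, v) ∈ safeDomain F X)
include hf hτ

omit [T2Space M] [IsManifold (𝓡 n) ∞ M] hF hX hτ in
theorem proj_symm_eq (v : indicatrixBundle F) : (f.symm v).1.proj = v.1.proj := by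
  rw [← hf (f.symm v), f.apply_symm_apply]

theorem commutator_domain (v : indicatrixBundle F) :
    (τ v.1.proj, (f.symm v : TangentBundle (𝓡 n) M)) ∈ safeDomain F X ∧
    (-τ v.1.proj, (f (transport F X (τ v.1.proj) (f.symm v)) : TangentBundle (𝓡 n) M)) ∈
      horizontalDomain F X := by
  have h1 : (τ v.1.proj, (f.symm v : TangentBundle (𝓡 n) M)) ∈ safeDomain F X := by
    have := hτ (f.symm v) (f.symm v).2
    rwa [proj_symm_eq hf v] at this
  exact ⟨h1, neg_mem_horizontalDomain hF hX h1 (hf _)⟩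

theorem commutator_inv_domain (v : indicatrixBundle F) :
    (-τ v.1.proj, (f.symm (transport F X (τ v.1.proj) v) : TangentBundle (𝓡 n) M)) ∈
      horizontalDomain F X :=
  neg_mem_horizontalDomain hF hX (hτ v v.2) (proj_symm_eq hf _)

theorem commutatorEquiv_coe (v : indicatrixBundle F) :
    (commutatorEquiv hF hX f hf τ hτ v : TangentBundle (𝓡 n) M) =
      commutatorMap F X f (τ v.1.proj) v := by
  obtain ⟨h1, h2⟩ := commutator_domain hF hX hf hτ v
  change (transport F X (-τ v.1.proj) (f (transport F X (τ v.1.proj) (f.symm v))) :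
    TangentBundle (𝓡 n) M) = _
  rw [transport_coe hF hX h2, commutatorMap, hF.radialExt_coe, ← transport_coe hF hX h1.1,
    hF.radialExt_coe]

theorem commutatorEquiv_symm_coe (v : indicatrixBundle F) :
    ((commutatorEquiv hF hX f hf τ hτ).symm v : TangentBundle (𝓡 n) M) =
      commutatorMapInv F X f (τ v.1.proj) v := by
  have h2 := commutator_inv_domain hF hX hf hτ v
  change (f (transport F X (-τ v.1.proj) (f.symm (transport F X (τ v.1.proj) v))) :
    TangentBundle (𝓡 n) M) = _
  rw [commutatorMapInv, ← transport_coe hF hX (hτ v v.2).1, hF.radialExt_coe,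
    ← transport_coe hF hX h2, hF.radialExt_coe]

theorem commutatorEquiv_eq_one_of_time {v : indicatrixBundle F} (h0 : τ v.1.proj = 0) :
    commutatorEquiv hF hX f hf τ hτ v = v := by
  have h1 : ∀ w : indicatrixBundle F, transport F X 0 w = w := fun w => Subtype.ext (by
    have hw := mem_nonzeroVectors_of_mem hF w.2
    rw [transport_coe hF hX (zero_mem_horizontalDomain hF hX hw), horizontalFlow_zero hF hX hw])
  change transport F X (-τ v.1.proj) (f (transport F X (τ v.1.proj) (f.symm v))) = v
  rw [h0, neg_zero, h1, h1, f.apply_symm_apply]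

end Coe

theorem contMDiffAt_horizontalFlow_comp {E : Type*} [NormedAddCommGroup E] [NormedSpace ℝ E]
    {H : Type*} [TopologicalSpace H] {J : ModelWithCorners ℝ E H}
    {Q : Type*} [TopologicalSpace Q] [ChartedSpace H Q] {a : Q → ℝ}
    {h : Q → TangentBundle (𝓡 n) M} {q : Q} (ha : ContMDiffAt J 𝓘(ℝ, ℝ) ∞ a q)
    (hh : ContMDiffAt J (𝓡 n).tangent ∞ h q) (hq : (a q, h q) ∈ horizontalDomain F X) :
    ContMDiffAt J (𝓡 n).tangent ∞ (fun q => horizontalFlow F X (a q, h q)) q :=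
  ContMDiffAt.comp (f := fun q => (a q, h q)) q ((contMDiffOn_horizontalFlow hF hX).contMDiffAt
    (isOpen_horizontalDomain.mem_nhds hq)) (ha.prodMk hh)

section Family

variable {k : ℕ} {ε : ℝ} {φ : (Fin k → ℝ) → diffeoGroup (𝓡 n).tangent (indicatrixBundle F)}
  (hφ : IsCommutatorLike (𝓡 n).tangent (indicatrixBundle F) k ε φ) {δ : M → ℝ}
  (hδ : ContMDiff (𝓡 n) 𝓘(ℝ, ℝ) ∞ δ) (hδ0 : ∀ x, 0 < δ x)

omit [T2Space M] hF hX in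
include hδ hδ0 in
theorem contMDiff_truncatedTime :
    ContMDiff (𝓘(ℝ, Fin (k + 1) → ℝ).prod (𝓡 n).tangent) 𝓘(ℝ, ℝ) ∞
      (fun p : (Fin (k + 1) → ℝ) × TangentBundle (𝓡 n) M =>
        truncatedTime (δ p.2.proj) (p.1 (Fin.last k))) := by
  intro p
  have h1 : ContMDiffAt (𝓘(ℝ, Fin (k + 1) → ℝ).prod (𝓡 n).tangent) (𝓡 n) ∞
      (fun p : (Fin (k + 1) → ℝ) × TangentBundle (𝓡 n) M => p.2.proj) p :=
    ContMDiffAt.comp (I' := (𝓡 n).tangent) (g := fun w : TangentBundle (𝓡 n) M => w.proj)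
      (f := Prod.snd) p (Bundle.contMDiff_proj (TangentSpace (𝓡 n) : M → Type _)).contMDiffAt
      contMDiffAt_snd
  have h2 : ContMDiffAt (𝓘(ℝ, Fin (k + 1) → ℝ).prod (𝓡 n).tangent) 𝓘(ℝ, ℝ) ∞
      (fun p : (Fin (k + 1) → ℝ) × TangentBundle (𝓡 n) M => p.1 (Fin.last k)) p :=
    ContMDiffAt.comp (g := fun T : Fin (k + 1) → ℝ => T (Fin.last k)) p
      (contDiff_apply ℝ ℝ (Fin.last k)).contDiffAt.contMDiffAt contMDiffAt_fst
  exact ContMDiffAt.comp (g := fun q : ℝ × ℝ => truncatedTime q.1 q.2) p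
    (contDiffAt_truncatedTime (hδ0 _) _).contMDiffAt
    ((hδ.contMDiffAt.comp p h1).prodMk_space h2)

omit [T2Space M] hX in
include hφ in
theorem contMDiffAt_radialExt_init {h : (Fin (k + 1) → ℝ) × TangentBundle (𝓡 n) M →
    TangentBundle (𝓡 n) M} {p : (Fin (k + 1) → ℝ) × TangentBundle (𝓡 n) M}
    (hp : p.1 ∈ paramCube (k + 1) ε)
    (hh : ContMDiffAt (𝓘(ℝ, Fin (k + 1) → ℝ).prod (𝓡 n).tangent) (𝓡 n).tangent ∞ h p)
    (hhp : h p ∈ positiveVectors F) :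
    ContMDiffAt (𝓘(ℝ, Fin (k + 1) → ℝ).prod (𝓡 n).tangent) (𝓡 n).tangent ∞
      (fun p => radialExt (φ (Fin.init p.1)).1 (h p)) p ∧
    ContMDiffAt (𝓘(ℝ, Fin (k + 1) → ℝ).prod (𝓡 n).tangent) (𝓡 n).tangent ∞
      (fun p => radialExt (φ (Fin.init p.1)).1.symm (h p)) p := by
  have hi : ContMDiffAt 𝓘(ℝ, Fin (k + 1) → ℝ) 𝓘(ℝ, Fin k → ℝ) ∞
      (fun T : Fin (k + 1) → ℝ => (Fin.init T : Fin k → ℝ)) p.1 := by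
    refine ContDiffAt.contMDiffAt (contDiffAt_pi.2 fun i => ?_)
    exact (contDiff_apply ℝ ℝ i.castSucc).contDiffAt
  have h1 : ContMDiffAt (𝓘(ℝ, Fin (k + 1) → ℝ).prod (𝓡 n).tangent)
      (𝓘(ℝ, Fin k → ℝ).prod (𝓡 n).tangent) ∞
      (fun p => ((Fin.init p.1 : Fin k → ℝ), h p)) p :=
    (ContMDiffAt.comp p hi contMDiffAt_fst).prodMk hh
  have hm : paramCube k ε ×ˢ positiveVectors F ∈ 𝓝 ((Fin.init p.1 : Fin k → ℝ), h p) :=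
    (isOpen_paramCube.prod hF.isOpen_positiveVectors).mem_nhds ⟨fun i => hp i.castSucc, hhp⟩
  exact ⟨ContMDiffAt.comp (f := fun p => ((Fin.init p.1 : Fin k → ℝ), h p)) p
      ((hφ.contMDiffOn_radialExt hF).contMDiffAt hm) h1,
    ContMDiffAt.comp (f := fun p => ((Fin.init p.1 : Fin k → ℝ), h p)) p
      ((hφ.contMDiffOn_radialExt_symm hF).contMDiffAt hm) h1⟩

variable (hφf : ∀ t ∈ paramCube k ε, ∀ v, ((φ t).1 v).1.proj = v.1.proj)
  (hδX : ∀ x τ, |τ| < δ x → ∀ w ∈ indicatrix F x, (τ, w) ∈ safeDomain F X)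

omit [T2Space M] hF hX in
include hδ0 hδX in
theorem truncatedTime_safe (s : ℝ) (v : TangentBundle (𝓡 n) M) (hv : v ∈ indicatrixBundle F) :
    ((fun x => truncatedTime (δ x) s) v.proj, v) ∈ safeDomain F X :=
  hδX v.proj _ (abs_truncatedTime_lt (hδ0 _) s) v ⟨rfl, hv⟩

include hφ hφf hδ hδ0 hδX

/-- At a point of the cube times `IM` every intermediate value lies in the open domain on which the
next factor is smooth, so the composite is smooth in a full neighbourhood in `TM`. -/
theorem contMDiffAt_commutatorMap {p : (Fin (k + 1) → ℝ) × TangentBundle (𝓡 n) M}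
    (hp : p ∈ paramCube (k + 1) ε ×ˢ indicatrixBundle F) :
    ContMDiffAt (𝓘(ℝ, Fin (k + 1) → ℝ).prod (𝓡 n).tangent) (𝓡 n).tangent ∞
      (fun p => commutatorMap F X (φ (Fin.init p.1)).1
        (truncatedTime (δ p.2.proj) (p.1 (Fin.last k))) p.2) p := by
  have ht : (Fin.init p.1 : Fin k → ℝ) ∈ paramCube k ε := fun i => hp.1 i.castSucc
  set v : indicatrixBundle F := ⟨p.2, hp.2⟩
  obtain ⟨h1, h2⟩ := commutator_domain
    (τ := fun x => truncatedTime (δ x) (p.1 (Fin.last k))) hF hX (hφf _ ht)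
    (truncatedTime_safe hδ0 hδX (p.1 (Fin.last k))) v
  have hτ := contMDiff_truncatedTime (k := k) hδ hδ0 p
  have e1 : radialExt (φ (Fin.init p.1)).1.symm p.2 = (φ (Fin.init p.1)).1.symm v :=
    hF.radialExt_coe _ v
  have s1 := (contMDiffAt_radialExt_init hF hφ hp.1 contMDiffAt_snd
    (indicatrixBundle_subset hp.2)).2
  have s2 := contMDiffAt_horizontalFlow_comp hF hX hτ s1 (by rw [e1]; exact h1.1)
  have e2 : horizontalFlow F X (truncatedTime (δ p.2.proj) (p.1 (Fin.last k)),
      radialExt (φ (Fin.init p.1)).1.symm p.2) = transport F X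
        (truncatedTime (δ p.2.proj) (p.1 (Fin.last k))) ((φ (Fin.init p.1)).1.symm v) := by
    rw [e1]
    exact (transport_coe hF hX h1.1).symm
  have s3 := (contMDiffAt_radialExt_init hF hφ hp.1 s2
    (by rw [e2]; exact indicatrixBundle_subset (transport F X _ _).2)).1
  refine contMDiffAt_horizontalFlow_comp hF hX hτ.neg s3 ?_
  rw [e2, hF.radialExt_coe]
  exact h2

theorem contMDiffAt_commutatorMapInv {p : (Fin (k + 1) → ℝ) × TangentBundle (𝓡 n) M}
    (hp : p ∈ paramCube (k + 1) ε ×ˢ indicatrixBundle F) :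
    ContMDiffAt (𝓘(ℝ, Fin (k + 1) → ℝ).prod (𝓡 n).tangent) (𝓡 n).tangent ∞
      (fun p => commutatorMapInv F X (φ (Fin.init p.1)).1
        (truncatedTime (δ p.2.proj) (p.1 (Fin.last k))) p.2) p := by
  have ht : (Fin.init p.1 : Fin k → ℝ) ∈ paramCube k ε := fun i => hp.1 i.castSucc
  set v : indicatrixBundle F := ⟨p.2, hp.2⟩
  have h1 := truncatedTime_safe hδ0 hδX (p.1 (Fin.last k)) p.2 hp.2
  have h2 := commutator_inv_domain
    (τ := fun x => truncatedTime (δ x) (p.1 (Fin.last k))) hF hX (hφf _ ht)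
    (truncatedTime_safe hδ0 hδX (p.1 (Fin.last k))) v
  have hτ := contMDiff_truncatedTime (k := k) hδ hδ0 p
  have s1 := contMDiffAt_horizontalFlow_comp hF hX hτ contMDiffAt_snd h1.1
  have e1 : horizontalFlow F X (truncatedTime (δ p.2.proj) (p.1 (Fin.last k)), p.2) =
      transport F X (truncatedTime (δ p.2.proj) (p.1 (Fin.last k))) v :=
    (transport_coe hF hX (v := v) h1.1).symm
  have s2 := (contMDiffAt_radialExt_init hF hφ hp.1 s1
    (by rw [e1]; exact indicatrixBundle_subset (transport F X _ _).2)).2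
  have e2 : radialExt (φ (Fin.init p.1)).1.symm (horizontalFlow F X
      (truncatedTime (δ p.2.proj) (p.1 (Fin.last k)), p.2)) = (φ (Fin.init p.1)).1.symm
      (transport F X (truncatedTime (δ p.2.proj) (p.1 (Fin.last k))) v) := by
    rw [e1, hF.radialExt_coe]
  have s3 := contMDiffAt_horizontalFlow_comp hF hX hτ.neg s2 (by rw [e2]; exact h2)
  refine (contMDiffAt_radialExt_init hF hφ hp.1 s3 ?_).1
  rw [e2]
  have e3 := transport_coe hF hX h2
  have h3 : F (horizontalFlow F X (-truncatedTime (δ p.2.proj) (p.1 (Fin.last k)),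
      ((φ (Fin.init p.1)).1.symm
      (transport F X (truncatedTime (δ p.2.proj) (p.1 (Fin.last k))) v) :
        TangentBundle (𝓡 n) M))) = 1 :=
    (congrArg F e3.symm).trans (transport F X _ _).2
  exact indicatrixBundle_subset h3

end Family

end Commutator

/-! ### The commutators belong to the fibred holonomy group -/

section CommutatorFamily

variable {n : ℕ} {M : Type*} [TopologicalSpace M] [ChartedSpace (EuclideanSpace ℝ (Fin n)) M]
  [IsManifold (𝓡 n) ∞ M] {F : TangentBundle (𝓡 n) M → ℝ} {X : ∀ x : M, TangentSpace (𝓡 n) x}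

/-- Elements of `Hol(p)` must be diffeomorphisms of the indicatrix. Their smoothness is inherited by
restriction from `Ψ` and its inverse, so it need not be proved for the parallel translations
composing `ρ`. -/
theorem mem_fibredHolonomyGroup_of_eq {r : ℕ∞}
    {Ψ : diffeoGroup (𝓡 n).tangent (indicatrixBundle F)} {p : M}
    {ρ : indicatrix F p ≃ indicatrix F p} (hρ : IsTranslation F r p p ρ)
    (h : ∀ v : indicatrix F p, (Ψ.1 ⟨v, v.2.2⟩ : TangentBundle (𝓡 n) M) = ρ v) :
    ∃ φ ∈ holonomyGroup F r p, ∀ v : indicatrix F p,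
      (Ψ.1 ⟨v, v.2.2⟩ : TangentBundle (𝓡 n) M) = φ.1 v := by
  have hsub : indicatrix F p ⊆ indicatrixBundle F := fun v hv => hv.2
  have hinv : ∀ v : indicatrix F p,
      (Ψ.1.symm ⟨v, v.2.2⟩ : TangentBundle (𝓡 n) M) = ρ.symm v := fun v => by
    have e : Ψ.1 ⟨ρ.symm v, (ρ.symm v).2.2⟩ = ⟨v, v.2.2⟩ := Subtype.ext (by simp [h])
    rw [← e, Equiv.symm_apply_apply]
  obtain ⟨⟨a, ha, ha'⟩, ⟨b, hb, hb'⟩⟩ := Ψ.2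
  exact ⟨⟨ρ, ⟨a, fun v => (ha ⟨v, v.2.2⟩).trans (h v), ha'.mono hsub⟩,
    ⟨b, fun v => (hb ⟨v, v.2.2⟩).trans (hinv v), hb'.mono hsub⟩⟩, hρ, h⟩

variable [T2Space M] (hF : IsFinsler F) (hX : IsSmoothField X)
include hF hX

/-- Over `p` the commutator is `a⁻¹`, the translation to the endpoint `q`, `b`, and the translation
back, with `a ∈ Hol(p)` and `b ∈ Hol(q)`. The concatenated curve is a loop at `p`. -/
theorem mem_fibredHolonomyGroup_of_eq_commutatorEquiv {r : ℕ∞}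
    {g Ψ : diffeoGroup (𝓡 n).tangent (indicatrixBundle F)} (hg : g ∈ fibredHolonomyGroup F r)
    {τ : M → ℝ} (hτ : ∀ v ∈ indicatrixBundle F, (τ v.proj, v) ∈ safeDomain F X)
    (hΨ : Ψ.1 = commutatorEquiv hF hX g.1 (proj_apply_of_mem_fibredHolonomyGroup hg) τ hτ) :
    Ψ ∈ fibredHolonomyGroup F r := by
  intro p
  -- A vector over `p` is needed to name the endpoint of the integral curve. If the indicatrix at
  -- `p` is empty, the identity serves.
  by_cases h : ∃ v₀ : indicatrixBundle F, v₀.1.proj = p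
  swap
  · exact ⟨1, one_mem _, fun v => absurd ⟨⟨v, v.2.2⟩, v.2.1⟩ h⟩
  obtain ⟨v₀, hv₀⟩ := h
  have h' : ∀ v ∈ indicatrix F p, (τ p, v) ∈ safeDomain F X := fun v hv => by
    rw [← hv.1]
    exact hτ v hv.2
  have htr := isTranslation_transportEquiv hF hX r h' v₀ hv₀
  set tr := transportEquiv hF hX h' v₀ hv₀ with htr_def
  obtain ⟨a, ha, ea⟩ := hg p
  obtain ⟨b, hb, eb⟩ := hg (transport F X (τ p) v₀).1.proj
  have ha' : IsTranslation F r p p a.1 := ha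
  have hb' : IsTranslation F r _ _ b.1 := hb
  refine mem_fibredHolonomyGroup_of_eq
    (ρ := a.1.symm.trans (tr.trans (b.1.trans tr.symm)))
    (ha'.symm.trans (htr.trans (hb'.trans htr.symm))) fun v => ?_
  have e1 : g.1.symm ⟨v, v.2.2⟩ = ⟨a.1.symm v, (a.1.symm v).2.2⟩ := by
    have e : g.1 ⟨a.1.symm v, (a.1.symm v).2.2⟩ = ⟨v, v.2.2⟩ := Subtype.ext (by simp [ea])
    rw [← e, Equiv.symm_apply_apply]
  have e3 : ∀ u : indicatrix F (transport F X (τ p) v₀).1.proj,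
      g.1 ⟨u, u.2.2⟩ = ⟨b.1 u, (b.1 u).2.2⟩ := fun u => Subtype.ext (eb u)
  rw [hΨ]
  change (transport F X (-τ v.1.proj) (g.1 (transport F X (τ v.1.proj)
    (g.1.symm ⟨v, v.2.2⟩))) : TangentBundle (𝓡 n) M) = _
  rw [congrArg τ v.2.1, e1]
  change (transport F X (-τ p) (g.1 ⟨tr (a.1.symm v), (tr (a.1.symm v)).2.2⟩) :
    TangentBundle (𝓡 n) M) = _
  rw [e3]
  rfl

variable {k : ℕ} {ε : ℝ} {φ : (Fin k → ℝ) → diffeoGroup (𝓡 n).tangent (indicatrixBundle F)}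
  (hφ : IsCommutatorLike (𝓡 n).tangent (indicatrixBundle F) k ε φ) {δ : M → ℝ}
  (hδ : ContMDiff (𝓡 n) 𝓘(ℝ, ℝ) ∞ δ) (hδ0 : ∀ x, 0 < δ x)
  (hδX : ∀ x τ, |τ| < δ x → ∀ w ∈ indicatrix F x, (τ, w) ∈ safeDomain F X)
include hφ hδ hδ0 hδX

theorem exists_commutatorFamily {r : ℕ∞}
    (hφG : ∀ t ∈ paramCube k ε, φ t ∈ fibredHolonomyGroup F r) :
    ∃ ψ : (Fin (k + 1) → ℝ) → diffeoGroup (𝓡 n).tangent (indicatrixBundle F),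
      IsCommutatorLike (𝓡 n).tangent (indicatrixBundle F) (k + 1) ε ψ ∧
      (∀ T ∈ paramCube (k + 1) ε, ψ T ∈ fibredHolonomyGroup F r) ∧
      ∀ T ∈ paramCube (k + 1) ε, ∀ v : indicatrixBundle F,
        ((ψ T).1 v : TangentBundle (𝓡 n) M) = commutatorMap F X (φ (Fin.init T)).1
          (truncatedTime (δ v.1.proj) (T (Fin.last k))) v := by
  have hφf : ∀ t ∈ paramCube k ε, ∀ v, ((φ t).1 v).1.proj = v.1.proj := fun t ht =>
    proj_apply_of_mem_fibredHolonomyGroup (hφG t ht)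
  have hinit : ∀ T ∈ paramCube (k + 1) ε, (Fin.init T : Fin k → ℝ) ∈ paramCube k ε :=
    fun T hT i => hT i.castSucc
  have hsafe := fun s => truncatedTime_safe (F := F) (X := X) hδ0 hδX s
  have hpair : ∀ T : Fin (k + 1) → ℝ, ContMDiff (𝓡 n).tangent
      (𝓘(ℝ, Fin (k + 1) → ℝ).prod (𝓡 n).tangent) ∞
      (fun v : TangentBundle (𝓡 n) M => (T, v)) := fun T =>
    contMDiff_const.prodMk contMDiff_id
  -- The family must be defined for all parameters; outside the cube the identity is used and plays
  -- no role.
  have hex : ∀ T : Fin (k + 1) → ℝ,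
      ∃ g : diffeoGroup (𝓡 n).tangent (indicatrixBundle F), ∀ hT : T ∈ paramCube (k + 1) ε,
      g.1 = commutatorEquiv hF hX (φ (Fin.init T)).1 (hφf _ (hinit T hT))
        (fun x => truncatedTime (δ x) (T (Fin.last k))) (hsafe _) := by
    intro T
    by_cases hT : T ∈ paramCube (k + 1) ε
    swap
    · exact ⟨1, fun h => absurd h hT⟩
    refine ⟨⟨commutatorEquiv hF hX (φ (Fin.init T)).1 (hφf _ (hinit T hT))
        (fun x => truncatedTime (δ x) (T (Fin.last k))) (hsafe _),
      ⟨fun v => commutatorMap F X (φ (Fin.init T)).1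
          (truncatedTime (δ v.proj) (T (Fin.last k))) v, fun v => ?_, fun v hv => ?_⟩,
      ⟨fun v => commutatorMapInv F X (φ (Fin.init T)).1
          (truncatedTime (δ v.proj) (T (Fin.last k))) v, fun v => ?_, fun v hv => ?_⟩⟩,
      fun _ => rfl⟩
    · exact (commutatorEquiv_coe (τ := fun x => truncatedTime (δ x) (T (Fin.last k))) hF hX
        (hφf _ (hinit T hT)) (hsafe _) v).symm
    · exact (ContMDiffAt.comp (f := fun v : TangentBundle (𝓡 n) M => (T, v)) v
        (contMDiffAt_commutatorMap hF hX hφ hδ hδ0 hφf hδX (p := (T, v)) ⟨hT, hv⟩)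
        (hpair T).contMDiffAt).contMDiffWithinAt
    · exact (commutatorEquiv_symm_coe (τ := fun x => truncatedTime (δ x) (T (Fin.last k))) hF hX
        (hφf _ (hinit T hT)) (hsafe _) v).symm
    · exact (ContMDiffAt.comp (f := fun v : TangentBundle (𝓡 n) M => (T, v)) v
        (contMDiffAt_commutatorMapInv hF hX hφ hδ hδ0 hφf hδX (p := (T, v)) ⟨hT, hv⟩)
        (hpair T).contMDiffAt).contMDiffWithinAt
  choose ψ hψ using hex
  have hcoe : ∀ T ∈ paramCube (k + 1) ε, ∀ v : indicatrixBundle F,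
        ((ψ T).1 v : TangentBundle (𝓡 n) M) = commutatorMap F X (φ (Fin.init T)).1
          (truncatedTime (δ v.1.proj) (T (Fin.last k))) v := fun T hT v => by
    rw [hψ T hT]
    exact commutatorEquiv_coe hF hX (hφf _ (hinit T hT)) (hsafe _) v
  refine ⟨ψ, ⟨⟨fun p => commutatorMap F X (φ (Fin.init p.1)).1
    (truncatedTime (δ p.2.proj) (p.1 (Fin.last k))) p.2, fun T hT v => (hcoe T hT v).symm,
    fun p hp => (contMDiffAt_commutatorMap hF hX hφ hδ hδ0 hφf hδX hp).contMDiffWithinAt⟩, ?_⟩,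
    fun T hT => mem_fibredHolonomyGroup_of_eq_commutatorEquiv hF hX (hφG _ (hinit T hT)) (hsafe _)
      (hψ T hT), hcoe⟩
  rintro T hT ⟨j, hj⟩
  refine Subtype.ext (Equiv.ext fun v => ?_)
  rw [hψ T hT]
  revert hj
  -- If the last coordinate vanishes the flow time is `0` and `φ_t` cancels its inverse; if another
  -- one vanishes, `φ_t` is the identity and the two flows cancel.
  refine Fin.lastCases (fun hj => ?_) (fun i hj => ?_) j
  · refine commutatorEquiv_eq_one_of_time hF hX (hφf _ (hinit T hT)) (hsafe _) ?_
    rw [hj, truncatedTime_zero]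
  · have h1 : φ (Fin.init T) = 1 := hφ.2 _ (hinit T hT) ⟨i, hj⟩
    change transport F X (-_) ((φ (Fin.init T)).1 (transport F X _
      ((φ (Fin.init T)).1.symm v))) = v
    rw [h1]
    exact transport_neg hF hX (hsafe _ v v.2)

end CommutatorFamily

/-! ### Mixed derivatives of families of points -/

section MixedChart

variable {E : Type*} [NormedAddCommGroup E] [NormedSpace ℝ E]
  {H : Type*} [TopologicalSpace H] {J : ModelWithCorners ℝ E H}
  {N : Type*} [TopologicalSpace N] [ChartedSpace H N] [IsManifold J ∞ N] [J.Boundaryless] {k : ℕ}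

theorem mixedDeriv_extChartAt_change [FiniteDimensional ℝ E] (hk : 1 ≤ k) {f : (Fin k → ℝ) → N}
    {p q : N} (hf : ContinuousAt f 0) (hs : SmoothNear (fun t => extChartAt J p (f t)) 0)
    (h0 : ∀ᶠ t in 𝓝 (0 : Fin k → ℝ), (∃ j, t j = 0) → f t = f 0)
    (hp : f 0 ∈ (extChartAt J p).source) (hq : f 0 ∈ (extChartAt J q).source) :
    mixedDeriv k (fun t => extChartAt J q (f t)) =
      tangentCoordChange J p q (f 0) (mixedDeriv k fun t => extChartAt J p (f t)) := by
  have hz := (extChartAt J p).map_source hp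
  have hinv := (extChartAt J p).left_inv hp
  have h1 := mixedDeriv_comp hk hs (h0.mono fun t ht hj => congrArg (extChartAt J p) (ht hj))
    (G := extChartAt J q ∘ (extChartAt J p).symm)
    (smoothNear_extChartAt_symm hz (by rwa [hinv]))
  rw [fderiv_extChartAt_symm hz, hinv] at h1
  rw [← h1]
  refine mixedDeriv_congr ?_
  filter_upwards [hf.eventually ((isOpen_extChartAt_source p).mem_nhds hp)] with t ht
  simp only [Function.comp]
  rw [(extChartAt J p).left_inv ht]

/-- Since tangent vectors at `v` are stored in the chart at `v`, the derivative of that chart at `v`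
is the identity on components. -/
theorem mfderiv_extChartAt_self_apply (v : N) (w : E) :
    mfderiv J 𝓘(ℝ, E) (extChartAt J v) v w = w := by
  have h := (hasMFDerivAt_extChartAt_tangentCoordChange (J := J) (mem_extChartAt_source v)).mfderiv
  exact (congrArg (fun A : E →L[ℝ] E => A w) h).trans
    (tangentCoordChange_self (mem_extChartAt_source _))

/-- The quotients `(c(s) - c(0)) / s^k` converge to `m` while `c(s)` stays in `S`. This is how a
mixed derivative of points of `IM` is seen to be tangent to `IM`. -/
theorem HasOrderDeriv.mem_tangentConeAt {c : ℝ → E} {m : E} (hk : 1 ≤ k)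
    (h : HasOrderDeriv k c m) {S : Set E} (hS : ∀ᶠ s in 𝓝 0, c s ∈ S) :
    m ∈ tangentConeAt ℝ S (c 0) := by
  refine mem_tangentConeAt_of_seq (𝓝[≠] (0 : ℝ)) (fun s => (s ^ k)⁻¹) (fun s => c s - c 0)
    (tendsto_sub_nhds_zero_iff.2 ((h.tendsto hk).mono_left nhdsWithin_le_nhds))
    ((hS.filter_mono nhdsWithin_le_nhds).mono fun s hs => by simpa using hs) ?_
  have h1 : (fun s : ℝ => c s - c 0 - s ^ k • m) =o[𝓝[≠] 0] fun s : ℝ => s ^ k :=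
    IsLittleO.mono h nhdsWithin_le_nhds
  have h2 := h1.tendsto_inv_smul_nhds_zero
  rw [← tendsto_sub_nhds_zero_iff]
  refine h2.congr' ?_
  filter_upwards [self_mem_nhdsWithin] with s hs
  have hs' : s ^ k ≠ 0 := pow_ne_zero _ hs
  rw [smul_sub, inv_smul_smul₀ hs']

theorem mem_tangentConeAt_of_hasDerivAt {c : ℝ → E} {m : E} (h : HasDerivAt c m 0) {S : Set E}
    (hS : ∀ᶠ s in 𝓝 0, c s ∈ S) : m ∈ tangentConeAt ℝ S (c 0) := by
  refine HasOrderDeriv.mem_tangentConeAt (k := 1) le_rfl ?_ hS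
  have := hasDerivAt_iff_isLittleO.1 h
  simpa [HasOrderDeriv] using this

/-- The bracket along a subset of a manifold, computed from extensions of the components of the
fields in a chart. -/
theorem mlieBracketWithin_eq_lieBracket {V W : ∀ v : N, TangentSpace J v} {V' W' : E → E}
    {s : Set N} {v : N} (hv : v ∈ s)
    (hV : ∀ᶠ z in 𝓝 (extChartAt J v v), (extChartAt J v).symm z ∈ s → chartField J V v z = V' z)
    (hW : ∀ᶠ z in 𝓝 (extChartAt J v v), (extChartAt J v).symm z ∈ s → chartField J W v z = W' z)
    (hV' : DifferentiableAt ℝ V' (extChartAt J v v))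
    (hW' : DifferentiableAt ℝ W' (extChartAt J v v))
    (hVt : V' (extChartAt J v v) ∈
      tangentConeAt ℝ ((extChartAt J v).symm ⁻¹' s) (extChartAt J v v))
    (hWt : W' (extChartAt J v v) ∈
      tangentConeAt ℝ ((extChartAt J v).symm ⁻¹' s) (extChartAt J v v)) :
    (VectorField.mlieBracketWithin J V W s v : E) =
      VectorField.lieBracket ℝ V' W' (extChartAt J v v) := by
  set z₀ := extChartAt J v v with hz₀
  set S : Set E := (extChartAt J v).symm ⁻¹' s with hS
  -- The pullback under the inverse chart, which enters the manifold bracket, is the field of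
  -- components in the chart.
  have hpull : ∀ Y : ∀ v : N, TangentSpace J v, ∀ z ∈ (extChartAt J v).target,
      (VectorField.mpullbackWithin 𝓘(ℝ, E) J (extChartAt J v).symm Y (range J) z : E) =
        chartField J Y v z := by
    intro Y z hz
    have hq := (extChartAt J v).map_target hz
    have h1 := (hasMFDerivAt_extChartAt_symm hz).mfderiv
    have h2 : mfderivWithin 𝓘(ℝ, E) J (extChartAt J v).symm (range J) z =
        (tangentCoordChange J v ((extChartAt J v).symm z) ((extChartAt J v).symm z) :
          E →L[ℝ] E) := by
      rw [J.range_eq_univ, mfderivWithin_univ]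
      exact h1
    have h3 : (tangentCoordChange J v ((extChartAt J v).symm z) ((extChartAt J v).symm z) :
          E →L[ℝ] E).inverse =
        (tangentCoordChange J ((extChartAt J v).symm z) v ((extChartAt J v).symm z) :
          E →L[ℝ] E) := by
      have : IsManifold J 1 N := .of_le (n := ∞) (by simp)
      refine ContinuousLinearMap.inverse_eq ?_ ?_
      · ext w
        exact tangentCoordChange_tangentCoordChange_self hq w
      · ext w
        exact (tangentCoordChange_comp ⟨⟨hq, mem_extChartAt_source _⟩, hq⟩).trans
          (tangentCoordChange_self hq)
    refine Eq.trans ?_ (congrArg (fun A : E →L[ℝ] E => A (Y ((extChartAt J v).symm z))) h3)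
    exact congrArg (fun A : E →L[ℝ] E => A.inverse (Y ((extChartAt J v).symm z))) h2
  have hzS : z₀ ∈ S := by
    change (extChartAt J v).symm (extChartAt J v v) ∈ s
    rwa [extChartAt_to_inv]
  obtain ⟨O, hO, hOo, hzO⟩ := eventually_nhds_iff.1 ((hV.and hW).and
    (show ∀ᶠ z in 𝓝 z₀, z ∈ (extChartAt J v).target from extChartAt_target_mem_nhds v))
  have hcone : tangentConeAt ℝ (S ∩ O) z₀ = tangentConeAt ℝ S z₀ :=
    tangentConeAt_congr (nhdsWithin_inter_of_mem' (mem_nhdsWithin_of_mem_nhds (hOo.mem_nhds hzO)))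
  have key : VectorField.lieBracketWithin ℝ
      (VectorField.mpullbackWithin 𝓘(ℝ, E) J (extChartAt J v).symm V (range J))
      (VectorField.mpullbackWithin 𝓘(ℝ, E) J (extChartAt J v).symm W (range J))
      ((extChartAt J v).symm ⁻¹' s ∩ range J) z₀ = VectorField.lieBracket ℝ V' W' z₀ := by
    have hset : ((extChartAt J v).symm ⁻¹' s ∩ range J : Set E) =ᶠ[𝓝 z₀] (S ∩ O : Set E) := by
      rw [J.range_eq_univ, inter_univ]
      filter_upwards [hOo.mem_nhds hzO] with z hz
      exact propext ⟨fun h => ⟨h, hz⟩, fun h => h.1⟩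
    refine (VectorField.lieBracketWithin_congr_set hset).trans ?_
    refine lieBracketWithin_eq_of_extension ⟨hzS, hzO⟩ (fun z hz => ?_) (fun z hz => ?_) hV' hW'
      ?_ ?_
    · exact (hpull V z (hO z hz.2).2).trans ((hO z hz.2).1.1 hz.1)
    · exact (hpull W z (hO z hz.2).2).trans ((hO z hz.2).1.2 hz.1)
    · rw [hcone]
      refine Eq.mpr (congrArg (· ∈ tangentConeAt ℝ S z₀) ?_) hVt
      exact (hpull V z₀ (hO z₀ hzO).2).trans ((hO z₀ hzO).1.1 hzS)
    · rw [hcone]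
      refine Eq.mpr (congrArg (· ∈ tangentConeAt ℝ S z₀) ?_) hWt
      exact (hpull W z₀ (hO z₀ hzO).2).trans ((hO z₀ hzO).1.2 hzS)
  -- The remaining transport back to the manifold is by the inverse of the chart derivative at `v`,
  -- which is the identity.
  have hinv : ∀ A : E →L[ℝ] E, (∀ w, A w = w) → ∀ w, A.inverse w = w := by
    intro A hA w
    rw [show A = ContinuousLinearMap.id ℝ E from ContinuousLinearMap.ext hA,
      ContinuousLinearMap.inverse_id]
    rfl
  rw [← key]
  exact hinv _ (mfderiv_extChartAt_self_apply v) _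

end MixedChart

/-! ### The mixed derivative of a conjugate by a flow -/

section Conjugate

variable {E : Type*} [NormedAddCommGroup E] [NormedSpace ℝ E] [FiniteDimensional ℝ E] {k : ℕ}

/-- The flow time is differentiated first. Because `Fl_0` is the identity and `σ'(0) = 1`, this
gives `DΦ_t(V(Ψ t)) - V(z)`, whose mixed derivative is the bracket by `mixedDeriv_commutator`. -/
theorem mixedDeriv_flow_commutator (hk : 1 ≤ k) {Φ : (Fin k → ℝ) × E → E} {Ψ : (Fin k → ℝ) → E}
    {Fl : ℝ × E → E} {V : E → E} {z : E} {σ : ℝ → ℝ}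
    (hΦ : SmoothNear Φ (0, z)) (hΨ : SmoothNear Ψ 0) (hV : SmoothNear V z)
    (hFl : SmoothNear Fl (0, z)) (hσ : SmoothNear σ 0)
    (hΦΨ : ∀ᶠ t in 𝓝 0, Φ (t, Ψ t) = z)
    (hΦ0 : ∀ᶠ q in 𝓝 ((0 : Fin k → ℝ), z), (∃ j, q.1 j = 0) → Φ q = q.2)
    (hΨ0 : ∀ᶠ t in 𝓝 (0 : Fin k → ℝ), (∃ j, t j = 0) → Ψ t = z)
    (hFl0 : ∀ᶠ w in 𝓝 z, Fl (0, w) = w)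
    (hFlV : ∀ᶠ w in 𝓝 z, HasDerivAt (fun s => Fl (s, w)) (V w) 0)
    (hσ0 : σ 0 = 0) (hσ1 : HasDerivAt σ 1 0) :
    mixedDeriv (k + 1) (fun T => Fl (-σ (T (Fin.last k)),
        Φ (Fin.init T, Fl (σ (T (Fin.last k)), Ψ (Fin.init T))))) =
      VectorField.lieBracket ℝ V (fun w => mixedDeriv k fun t => Φ (t, w)) z := by
  have hex : ∃ j : Fin k, (0 : Fin k → ℝ) j = 0 := ⟨⟨0, hk⟩, rfl⟩
  have hΨz : Ψ 0 = z := hΨ0.self_of_nhds hex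
  have hΦz : Φ (0, z) = z := hΦ0.self_of_nhds hex
  have hFlz : Fl (0, z) = z := hFl0.self_of_nhds
  have hinit : ContDiff ℝ ∞ fun T : Fin (k + 1) → ℝ => (Fin.init T : Fin k → ℝ) :=
    contDiff_pi.2 fun i => contDiff_apply ℝ ℝ i.castSucc
  have hinit0 : (Fin.init (0 : Fin (k + 1) → ℝ) : Fin k → ℝ) = 0 := rfl
  have hlast : ContDiff ℝ ∞ fun T : Fin (k + 1) → ℝ => T (Fin.last k) :=
    contDiff_apply ℝ ℝ (Fin.last k)
  have s1 : SmoothNear (fun T : Fin (k + 1) → ℝ => σ (T (Fin.last k))) 0 :=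
    SmoothNear.comp (g := σ) hσ (ContDiff.smoothNear hlast 0)
  have s2 : SmoothNear (fun T : Fin (k + 1) → ℝ => Ψ (Fin.init T)) 0 :=
    SmoothNear.comp (g := Ψ) hΨ (ContDiff.smoothNear hinit 0)
  have s3 : SmoothNear (fun T : Fin (k + 1) → ℝ => Fl (σ (T (Fin.last k)), Ψ (Fin.init T))) 0 := by
    refine SmoothNear.comp (g := Fl) ?_ (s1.prodMk s2)
    change SmoothNear Fl (σ 0, Ψ 0)
    rwa [hσ0, hΨz]
  have s4 : SmoothNear (fun T : Fin (k + 1) → ℝ =>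
      Φ (Fin.init T, Fl (σ (T (Fin.last k)), Ψ (Fin.init T)))) 0 := by
    refine SmoothNear.comp (g := Φ) ?_ ((ContDiff.smoothNear hinit 0).prodMk s3)
    change SmoothNear Φ (0, Fl (σ 0, Ψ 0))
    rwa [hσ0, hΨz, hFlz]
  have s5 : SmoothNear (fun T : Fin (k + 1) → ℝ => Fl (-σ (T (Fin.last k)),
      Φ (Fin.init T, Fl (σ (T (Fin.last k)), Ψ (Fin.init T))))) 0 := by
    refine SmoothNear.comp (g := Fl) ?_
      ((SmoothNear.comp (g := fun s : ℝ => -s) (ContDiff.smoothNear contDiff_neg _) s1).prodMk s4)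
    change SmoothNear Fl (-σ 0, Φ (0, Fl (σ 0, Ψ 0)))
    rwa [hσ0, hΨz, hFlz, neg_zero, hΦz]
  rw [mixedDeriv_snoc s5, ← mixedDeriv_commutator hk hΦ hΨ hV hΦΨ hΦ0 hΨ0]
  refine mixedDeriv_congr ?_
  have c0 : Tendsto (fun t : Fin k → ℝ => Fin.snoc (α := fun _ => ℝ) t 0) (𝓝 0)
      (𝓝 (0 : Fin (k + 1) → ℝ)) := by
    have := (snocZero k).continuous.tendsto 0
    rwa [map_zero] at this
  have cΨ : Tendsto Ψ (𝓝 0) (𝓝 z) := by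
    have := hΨ.continuousAt.tendsto
    rwa [hΨz] at this
  have cΦ : Tendsto (fun t => (t, Ψ t)) (𝓝 (0 : Fin k → ℝ)) (𝓝 (0, z)) :=
    tendsto_id.prodMk_nhds cΨ
  have cFl : Tendsto (fun t => ((0 : ℝ), Ψ t)) (𝓝 (0 : Fin k → ℝ)) (𝓝 (0, z)) :=
    tendsto_const_nhds.prodMk_nhds cΨ
  have hFlz' : DifferentiableAt ℝ Fl (0, z) := hFl.differentiableAt
  have hFlinr : ∀ u, fderiv ℝ Fl (0, z) (0, u) = u := fun u => by
    have h1 : HasFDerivAt (fun w => Fl ((0 : ℝ), w))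
        ((fderiv ℝ Fl (0, z)).comp (ContinuousLinearMap.inr ℝ ℝ E)) z :=
      HasFDerivAt.comp z hFlz'.hasFDerivAt (hasFDerivAt_prodMk_right (0 : ℝ) z)
    exact congrArg (fun A : E →L[ℝ] E => A u)
      (h1.unique ((hasFDerivAt_id z).congr_of_eventuallyEq hFl0))
  have hFlinl : ∀ w, DifferentiableAt ℝ Fl (0, w) → HasDerivAt (fun s => Fl (s, w)) (V w) 0 →
      fderiv ℝ Fl (0, w) (1, 0) = V w := fun w h h' => by
    have h1 : HasDerivAt (fun s : ℝ => (s, w)) (1, 0) 0 :=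
      (hasDerivAt_id 0).prodMk (hasDerivAt_const 0 w)
    exact (HasFDerivAt.comp_hasDerivAt (f := fun s : ℝ => (s, w)) 0 h.hasFDerivAt h1).unique h'
  filter_upwards [c0.eventually s5, cΨ.eventually hFlV, cΨ.eventually hFl0, cΦ.eventually hΦ,
    cFl.eventually hFl, hΦΨ] with t h5 hVt hFl0t hΦt hFlt hΦΨt
  have d0 : HasDerivAt (fun s : ℝ => Fin.snoc (α := fun _ => ℝ) t s)
      (Pi.single (Fin.last k) 1 : Fin (k + 1) → ℝ) 0 := by
    have e : (fun s : ℝ => Fin.snoc (α := fun _ => ℝ) t s) =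
        fun s => snocZero k t + s • Pi.single (Fin.last k) 1 := funext (snoc_eq_snocZero_add t)
    rw [e]
    simpa using ((hasDerivAt_id (0 : ℝ)).smul_const
      (Pi.single (Fin.last k) 1 : Fin (k + 1) → ℝ)).const_add (snocZero k t)
  have d1 := HasFDerivAt.comp_hasDerivAt (f := fun s : ℝ => Fin.snoc (α := fun _ => ℝ) t s) 0
    (h5.differentiableAt (by simp)).hasFDerivAt d0
  have e1 : ((fun T : Fin (k + 1) → ℝ => Fl (-σ (T (Fin.last k)),
      Φ (Fin.init T, Fl (σ (T (Fin.last k)), Ψ (Fin.init T))))) ∘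
        fun s : ℝ => Fin.snoc (α := fun _ => ℝ) t s) =
      fun s => Fl (-σ s, Φ (t, Fl (σ s, Ψ t))) := by
    funext s
    simp only [Function.comp, Fin.snoc_last, Fin.init_snoc]
  rw [e1] at d1
  have d2 : HasDerivAt (fun s => Fl (σ s, Ψ t)) (V (Ψ t)) 0 := by
    have : HasDerivAt (fun s => Fl (s, Ψ t)) (V (Ψ t)) (σ 0) := by rwa [hσ0]
    exact (this.scomp 0 hσ1).congr_deriv (one_smul _ _)
  have d3 : HasDerivAt (fun s => Φ (t, Fl (σ s, Ψ t)))
      (fderiv ℝ (fun w => Φ (t, w)) (Ψ t) (V (Ψ t))) 0 := by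
    have hd : DifferentiableAt ℝ (fun w => Φ (t, w)) (Fl (σ 0, Ψ t)) := by
      rw [hσ0, hFl0t]
      exact (hΦt.differentiableAt (by simp)).comp (Ψ t)
        (hasFDerivAt_prodMk_right t (Ψ t)).differentiableAt
    have := HasFDerivAt.comp_hasDerivAt (f := fun s => Fl (σ s, Ψ t)) 0 hd.hasFDerivAt d2
    rwa [hσ0, hFl0t] at this
  have d4 : HasDerivAt (fun s => (-σ s, Φ (t, Fl (σ s, Ψ t))))
      (-1, fderiv ℝ (fun w => Φ (t, w)) (Ψ t) (V (Ψ t))) 0 := hσ1.neg.prodMk d3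
  -- At `s = 0` the outer flow is evaluated at `(0, z)` for every `t`, because `Φ(t, Ψ t) = z`; its
  -- derivative there is explicit.
  have hpt : (-σ 0, Φ (t, Fl (σ 0, Ψ t))) = ((0 : ℝ), z) := by
    rw [hσ0, hFl0t, hΦΨt, neg_zero]
  have hFlz'' : HasFDerivAt Fl (fderiv ℝ Fl (0, z)) (-σ 0, Φ (t, Fl (σ 0, Ψ t))) := by
    rw [hpt]
    exact hFlz'.hasFDerivAt
  have d5 := HasFDerivAt.comp_hasDerivAt (f := fun s => (-σ s, Φ (t, Fl (σ s, Ψ t)))) 0 hFlz'' d4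
  have d6 := d1.unique d5
  rw [d6]
  have split : ((-1 : ℝ), fderiv ℝ (fun w => Φ (t, w)) (Ψ t) (V (Ψ t))) =
      -((1 : ℝ), (0 : E)) + (0, fderiv ℝ (fun w => Φ (t, w)) (Ψ t) (V (Ψ t))) := by
    ext <;> simp
  rw [split, map_add, map_neg, hFlinr, hFlinl z hFlz' hFlV.self_of_nhds]
  abel

end Conjugate

/-! ### Strongly tangent fields and their Berwald derivatives in charts -/

section StronglyTangent

variable {n : ℕ} {M : Type*} [TopologicalSpace M] [ChartedSpace (EuclideanSpace ℝ (Fin n)) M]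
  [IsManifold (𝓡 n) ∞ M] {F : TangentBundle (𝓡 n) M → ℝ}

local notation "E₂" => EuclideanSpace ℝ (Fin n) × EuclideanSpace ℝ (Fin n)

theorem IsFinsler.radialExt_id (hF : IsFinsler F) {v : TangentBundle (𝓡 n) M}
    (hv : v ∈ positiveVectors F) : radialExt (1 : Equiv.Perm (indicatrixBundle F)) v = v := by
  rw [hF.radialExt_eq _ hv]
  exact scale_normalize hv

theorem zero_mem_paramCube {k : ℕ} {ε : ℝ} (hε : 0 < ε) : (0 : Fin k → ℝ) ∈ paramCube k ε :=
  fun _ => ⟨neg_lt_zero.2 hε, hε⟩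

variable {k : ℕ} {ε : ℝ} {φ : (Fin k → ℝ) → diffeoGroup (𝓡 n).tangent (indicatrixBundle F)}

/-- The components in the chart at `p` of the mixed derivative of the family `φ`. -/
def mixedField (φ : (Fin k → ℝ) → diffeoGroup (𝓡 n).tangent (indicatrixBundle F))
    (p : TangentBundle (𝓡 n) M) (z : E₂) : E₂ :=
  mixedDeriv k fun t => extChartAt (𝓡 n).tangent p
    (radialExt (φ t).1 ((extChartAt (𝓡 n).tangent p).symm z))

/-- The field `ξ` is the mixed derivative of the family `φ`. -/
def IsMixedDeriv (φ : (Fin k → ℝ) → diffeoGroup (𝓡 n).tangent (indicatrixBundle F))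
    (ξ : ∀ v : TangentBundle (𝓡 n) M, TangentSpace (𝓡 n).tangent v) : Prop :=
  ∀ y : indicatrixBundle F, mixedDeriv k (fun t => extChartAt (𝓡 n).tangent
    (y : TangentBundle (𝓡 n) M) ((φ t).1 y : TangentBundle (𝓡 n) M)) = (ξ y : E₂)

variable (hF : IsFinsler F) (hk : 1 ≤ k) (hε : 0 < ε)
  (hφ : IsCommutatorLike (𝓡 n).tangent (indicatrixBundle F) k ε φ)
include hF hk hε hφ

omit hF in
theorem IsCommutatorLike.apply_zero : φ 0 = 1 := hφ.2 0 (zero_mem_paramCube hε) ⟨⟨0, hk⟩, rfl⟩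

variable {p v : TangentBundle (𝓡 n) M} (hv : v ∈ indicatrixBundle F)
  (hp : v ∈ (extChartAt (𝓡 n).tangent p).source)
include hv hp

theorem smoothNear_radialFamily :
    SmoothNear (fun q : (Fin k → ℝ) × E₂ => extChartAt (𝓡 n).tangent p
      (radialExt (φ q.1).1 ((extChartAt (𝓡 n).tangent p).symm q.2)))
      (0, extChartAt (𝓡 n).tangent p v) := by
  refine smoothNear_chart (J := (𝓡 n).tangent)
    (f := fun q : (Fin k → ℝ) × TangentBundle (𝓡 n) M => radialExt (φ q.1).1 q.2)
    (isOpen_paramCube.prod hF.isOpen_positiveVectors) (hφ.contMDiffOn_radialExt hF)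
    ⟨zero_mem_paramCube hε, indicatrixBundle_subset hv⟩ hp ?_
  change radialExt (φ 0).1 v ∈ _
  rw [hφ.apply_zero hk hε]
  exact (congrArg (· ∈ (extChartAt (𝓡 n).tangent p).source)
    (hF.radialExt_id (indicatrixBundle_subset hv))).mpr hp

theorem smoothNear_radialFamily_symm :
    SmoothNear (fun q : (Fin k → ℝ) × E₂ => extChartAt (𝓡 n).tangent p
      (radialExt (φ q.1).1.symm ((extChartAt (𝓡 n).tangent p).symm q.2)))
      (0, extChartAt (𝓡 n).tangent p v) := by
  refine smoothNear_chart (J := (𝓡 n).tangent)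
    (f := fun q : (Fin k → ℝ) × TangentBundle (𝓡 n) M => radialExt (φ q.1).1.symm q.2)
    (isOpen_paramCube.prod hF.isOpen_positiveVectors) (hφ.contMDiffOn_radialExt_symm hF)
    ⟨zero_mem_paramCube hε, indicatrixBundle_subset hv⟩ hp ?_
  change radialExt (φ 0).1.symm v ∈ _
  rw [hφ.apply_zero hk hε]
  exact (congrArg (· ∈ (extChartAt (𝓡 n).tangent p).source)
    (hF.radialExt_id (indicatrixBundle_subset hv))).mpr hp

omit hk in
theorem eventually_radialFamily_eq : ∀ᶠ q in 𝓝 ((0 : Fin k → ℝ), extChartAt (𝓡 n).tangent p v),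
    (∃ j, q.1 j = 0) → extChartAt (𝓡 n).tangent p
      (radialExt (φ q.1).1 ((extChartAt (𝓡 n).tangent p).symm q.2)) = q.2 := by
  have h1 : ∀ᶠ q : (Fin k → ℝ) × TangentBundle (𝓡 n) M in 𝓝 (0, v),
      q ∈ paramCube k ε ×ˢ positiveVectors F :=
    (isOpen_paramCube.prod hF.isOpen_positiveVectors).mem_nhds
      ⟨zero_mem_paramCube hε, indicatrixBundle_subset hv⟩
  filter_upwards [(tendsto_prod_extChartAt_symm hp 0).eventually h1, continuousAt_snd.eventually
    ((isOpen_extChartAt_target p).mem_nhds ((extChartAt (𝓡 n).tangent p).map_source hp))]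
    with q hq hq2 hj
  rw [hφ.2 q.1 hq.1 hj]
  exact (congrArg (extChartAt (𝓡 n).tangent p) (hF.radialExt_id hq.2)).trans
    ((extChartAt (𝓡 n).tangent p).right_inv hq2)

omit hp hF hk in
theorem continuousAt_family :
    ContinuousAt (fun t => ((φ t).1 ⟨v, hv⟩ : TangentBundle (𝓡 n) M)) 0 := by
  obtain ⟨⟨g, hg, hg'⟩, -⟩ := hφ
  have h1 : ContinuousOn (fun t : Fin k → ℝ => g (t, v)) (paramCube k ε) :=
    hg'.continuousOn.comp (by fun_prop) fun t ht => ⟨ht, hv⟩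
  refine (h1.continuousAt (isOpen_paramCube.mem_nhds (zero_mem_paramCube hε))).congr ?_
  filter_upwards [isOpen_paramCube.mem_nhds (zero_mem_paramCube hε)] with t ht
  exact hg t ht ⟨v, hv⟩

omit hp hF in
theorem tendsto_family :
    Tendsto (fun t => ((φ t).1 ⟨v, hv⟩ : TangentBundle (𝓡 n) M)) (𝓝 0) (𝓝 v) := by
  have h := (continuousAt_family hε hφ hv).tendsto
  rwa [show ((φ 0).1 ⟨v, hv⟩ : TangentBundle (𝓡 n) M) = v by
    rw [hφ.apply_zero hk hε]; rfl] at h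

theorem smoothNear_family :
    SmoothNear (fun t => extChartAt (𝓡 n).tangent p ((φ t).1 ⟨v, hv⟩ : TangentBundle (𝓡 n) M))
      0 := by
  have h1 := SmoothNear.comp (f := fun t : Fin k → ℝ => (t, extChartAt (𝓡 n).tangent p v))
    (smoothNear_radialFamily hF hk hε hφ hv hp)
    (ContDiff.smoothNear (contDiff_id.prodMk contDiff_const) _)
  refine h1.congr (Eventually.of_forall fun t => ?_)
  dsimp only
  rw [(extChartAt (𝓡 n).tangent p).left_inv hp]
  exact congrArg _ (hF.radialExt_coe (φ t).1 ⟨v, hv⟩).symm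

omit hp hF hk in
theorem eventually_family_eq :
    ∀ᶠ t in 𝓝 (0 : Fin k → ℝ), (∃ j, t j = 0) →
      ((φ t).1 ⟨v, hv⟩ : TangentBundle (𝓡 n) M) = v := by
  filter_upwards [isOpen_paramCube.mem_nhds (zero_mem_paramCube hε)] with t ht hj
  rw [hφ.2 t ht hj]
  rfl

omit hk hε hφ in
theorem mixedField_extChartAt : mixedField φ p (extChartAt (𝓡 n).tangent p v) =
    mixedDeriv k fun t =>
      extChartAt (𝓡 n).tangent p ((φ t).1 ⟨v, hv⟩ : TangentBundle (𝓡 n) M) := by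
  rw [mixedField]
  refine congrArg (mixedDeriv k) (funext fun t => congrArg _ ?_)
  rw [(extChartAt (𝓡 n).tangent p).left_inv hp]
  exact hF.radialExt_coe (φ t).1 ⟨v, hv⟩

theorem smoothNear_mixedField :
    SmoothNear (mixedField φ p) (extChartAt (𝓡 n).tangent p v) :=
  (smoothNear_radialFamily hF hk hε hφ hv hp).mixedDeriv_param

omit hv hp
variable {ξ : ∀ v : TangentBundle (𝓡 n) M, TangentSpace (𝓡 n).tangent v}
  (hξ : IsMixedDeriv φ ξ)
include hξ

-- By chart independence of mixed derivatives, `mixedField φ p` is in coordinates an extension of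
-- `ξ` off `IM`. It is the smooth extension used to prove regularity and to compute brackets.
include hv hp in
theorem mixedField_extChartAt_eq : mixedField φ p (extChartAt (𝓡 n).tangent p v) =
    (tangentCoordChange (𝓡 n).tangent v p v (ξ v) : E₂) := by
  have h0 : ((φ 0).1 ⟨v, hv⟩ : TangentBundle (𝓡 n) M) = v := by
    rw [hφ.apply_zero hk hε]
    rfl
  rw [mixedField_extChartAt hF hv hp]
  have h1 := mixedDeriv_extChartAt_change (J := (𝓡 n).tangent) (p := v) (q := p) hk
    (continuousAt_family hε hφ hv)
    (smoothNear_family hF hk hε hφ hv (mem_extChartAt_source v))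
    ((eventually_family_eq hε hφ hv).mono fun t ht hj => (ht hj).trans h0.symm)
    (by rw [h0]; exact mem_extChartAt_source v) (by rwa [h0])
  rw [h0] at h1
  refine h1.trans (congrArg (tangentCoordChange (𝓡 n).tangent v p v : E₂ →L[ℝ] E₂) ?_)
  exact hξ ⟨v, hv⟩

/-- Smoothness holds because `mixedField` is a smooth local extension. Tangency holds because `F(φ_t
v) = 1` for all `t`, and the mixed derivative of this constant is `dF(ξ)`. -/
theorem isIndicatrixField_of_mixedDeriv : IsIndicatrixField F ξ := by
  refine ⟨fun v hv => contMDiffWithinAt_field_iff.2 ?_, fun v hv => ?_⟩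
  · have h1 : ContMDiffAt (𝓡 n).tangent 𝓘(ℝ, E₂) ∞
        (fun q => mixedField φ v (extChartAt (𝓡 n).tangent v q)) v :=
      ContMDiffAt.comp (I' := 𝓘(ℝ, E₂)) (g := mixedField φ v)
        (f := extChartAt (𝓡 n).tangent v) v ((smoothNear_mixedField hF hk hε hφ hv
        (mem_extChartAt_source v)).contDiffAt.contMDiffAt)
        (contMDiffAt_extChartAt (I := (𝓡 n).tangent))
    refine h1.contMDiffWithinAt.congr_of_eventuallyEq ?_
      (mixedField_extChartAt_eq hF hk hε hφ hv (mem_extChartAt_source v) hξ).symm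
    filter_upwards [self_mem_nhdsWithin, mem_nhdsWithin_of_mem_nhds
      ((isOpen_extChartAt_source (I := (𝓡 n).tangent) v).mem_nhds (mem_extChartAt_source v))] with q hq hq'
    exact (mixedField_extChartAt_eq hF hk hε hφ hq hq' hξ).symm
  · have hnz := mem_nonzeroVectors_of_mem hF hv
    have h0 : ((φ 0).1 ⟨v, hv⟩ : TangentBundle (𝓡 n) M) = v := by
      rw [hφ.apply_zero hk hε]
      rfl
    have hsm : ContMDiffOn (𝓡 n).tangent 𝓘(ℝ, ℝ) ∞ F (nonzeroVectors n M) := hF.smooth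
    have hG : SmoothNear (fun z => F ((extChartAt (𝓡 n).tangent v).symm z))
        (extChartAt (𝓡 n).tangent v v) := by
      have h2 : ContMDiffOn 𝓘(ℝ, E₂) 𝓘(ℝ, ℝ) ∞ (fun z => F ((extChartAt (𝓡 n).tangent v).symm z))
          ((extChartAt (𝓡 n).tangent v).target ∩
            (extChartAt (𝓡 n).tangent v).symm ⁻¹' nonzeroVectors n M) :=
        hsm.comp ((contMDiffOn_extChartAt_symm v).mono inter_subset_left) fun z hz => hz.2
      refine ContDiffOn.smoothNear (contMDiffOn_iff_contDiffOn.1 h2) ?_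
      refine ((continuousOn_extChartAt_symm v).isOpen_inter_preimage (isOpen_extChartAt_target v)
        isOpen_nonzeroVectors).mem_nhds ⟨mem_extChartAt_target v, ?_⟩
      rwa [mem_preimage, extChartAt_to_inv]
    have h3 := mixedDeriv_comp hk (smoothNear_family hF hk hε hφ hv (mem_extChartAt_source v))
      ((eventually_family_eq hε hφ hv).mono fun t ht hj =>
        congrArg (extChartAt (𝓡 n).tangent v) ((ht hj).trans h0.symm))
      (G := fun z => F ((extChartAt (𝓡 n).tangent v).symm z)) (by rw [h0]; exact hG)
    have h4 : mixedDeriv k (fun t => F ((extChartAt (𝓡 n).tangent v).symm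
        (extChartAt (𝓡 n).tangent v ((φ t).1 ⟨v, hv⟩ : TangentBundle (𝓡 n) M)))) = 0 := by
      rw [← mixedDeriv_const hk (1 : ℝ)]
      refine mixedDeriv_congr ?_
      filter_upwards [(tendsto_family hk hε hφ hv).eventually
        ((isOpen_extChartAt_source (I := (𝓡 n).tangent) v).mem_nhds
          (mem_extChartAt_source (I := (𝓡 n).tangent) v))]
        with t ht
      rw [(extChartAt (𝓡 n).tangent v).left_inv ht]
      exact ((φ t).1 ⟨v, hv⟩).2
    rw [h4, h0] at h3
    have h5 : mfderiv (𝓡 n).tangent 𝓘(ℝ, ℝ) F v =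
        fderiv ℝ (fun z : E₂ => F ((extChartAt (𝓡 n).tangent v).symm z))
          (extChartAt (𝓡 n).tangent v v) := by
      rw [((hF.contMDiffAt hnz).mdifferentiableAt (by simp)).mfderiv,
        ModelWithCorners.Boundaryless.range_eq_univ, fderivWithin_univ]
      rfl
    rw [h5]
    refine Eq.trans ?_ h3.symm
    exact congrArg (fderiv ℝ (fun z : E₂ => F ((extChartAt (𝓡 n).tangent v).symm z))
          (extChartAt (𝓡 n).tangent v v)) (hξ ⟨v, hv⟩).symm

variable {X : ∀ x : M, TangentSpace (𝓡 n) x} [T2Space M] (hX : IsSmoothField X)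
include hX

omit hk hε hφ hξ [T2Space M] in
theorem smoothNear_chartField_horizontalLiftField (hv : v ∈ nonzeroVectors n M) :
    SmoothNear (chartField (𝓡 n).tangent (horizontalLiftField F X) v)
      (extChartAt (𝓡 n).tangent v v) := by
  refine ContDiffOn.smoothNear
    (contDiffOn_chartField (contMDiffOn_horizontalLiftField hF hX) v) ?_
  refine ((continuousOn_extChartAt_symm v).isOpen_inter_preimage (isOpen_extChartAt_target v)
    isOpen_nonzeroVectors).mem_nhds ⟨mem_extChartAt_target v, ?_⟩
  rwa [mem_preimage, extChartAt_to_inv]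

omit hk hε hφ hξ in
theorem hasDerivAt_extChartAt_horizontalFlow {q : TangentBundle (𝓡 n) M}
    (hq : q ∈ nonzeroVectors n M) (hqv : q ∈ (extChartAt (𝓡 n).tangent v).source) :
    HasDerivAt (fun s => extChartAt (𝓡 n).tangent v (horizontalFlow F X (s, q)))
      (chartField (𝓡 n).tangent (horizontalLiftField F X) v (extChartAt (𝓡 n).tangent v q)) 0 := by
  have h0 := horizontalFlow_zero hF hX hq
  have h1 := hasDerivAt_extChartAt_comp (p := v) (hasMFDerivAt_horizontalFlow hF hX
    (zero_mem_horizontalDomain hF hX hq)) (by rwa [h0])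
  refine h1.congr_deriv ?_
  rw [chartField_extChartAt _ hqv, h0]

-- The bracket along `IM` may be computed from extensions since both fields lie in the tangent cone
-- of `IM`: `X^h` through its flow, which preserves `F`, and `ξ` through the diagonal curves
-- `φ_(s,…,s) v`.
include hv in
theorem berwaldDeriv_eq_lieBracket :
    (berwaldDeriv F X ξ v : E₂) = VectorField.lieBracket ℝ
      (chartField (𝓡 n).tangent (horizontalLiftField F X) v) (mixedField φ v)
      (extChartAt (𝓡 n).tangent v v) := by
  have hnz := mem_nonzeroVectors_of_mem hF hv
  have hsrc := mem_extChartAt_source (I := (𝓡 n).tangent) v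
  have hsrc' := (isOpen_extChartAt_source (I := (𝓡 n).tangent) v).mem_nhds hsrc
  have h0 : ((φ 0).1 ⟨v, hv⟩ : TangentBundle (𝓡 n) M) = v := by
    rw [hφ.apply_zero hk hε]
    rfl
  have hfl0 := horizontalFlow_zero hF hX hnz
  refine mlieBracketWithin_eq_lieBracket hv (Eventually.of_forall fun _ _ => rfl) ?_
    (smoothNear_chartField_horizontalLiftField hF hX hnz).differentiableAt
    (smoothNear_mixedField hF hk hε hφ hv hsrc).differentiableAt ?_ ?_
  · filter_upwards [extChartAt_target_mem_nhds (I := (𝓡 n).tangent) v] with z hz hzs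
    have h1 := mixedField_extChartAt_eq hF hk hε hφ hzs
      ((extChartAt (𝓡 n).tangent v).map_target hz) hξ
    rw [(extChartAt (𝓡 n).tangent v).right_inv hz] at h1
    exact h1.symm
  · have h1 := hasDerivAt_extChartAt_horizontalFlow (v := v) hF hX hnz hsrc
    have hd := zero_mem_horizontalDomain hF hX hnz
    have hc : ContinuousAt (fun s : ℝ => (s, v)) 0 := by fun_prop
    have h2 : ∀ᶠ s in 𝓝 (0 : ℝ), (s, v) ∈ horizontalDomain F X :=
      hc.eventually (isOpen_horizontalDomain.mem_nhds hd)
    have h3 : ∀ᶠ s in 𝓝 (0 : ℝ),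
        horizontalFlow F X (s, v) ∈ (extChartAt (𝓡 n).tangent v).source := by
      have hc' := (hasMFDerivAt_horizontalFlow hF hX hd).continuousAt.tendsto
      rw [hfl0] at hc'
      exact hc'.eventually hsrc'
    have h4 := mem_tangentConeAt_of_hasDerivAt h1
      (S := (extChartAt (𝓡 n).tangent v).symm ⁻¹' indicatrixBundle F) (by
        filter_upwards [h2, h3] with s hs hs'
        rw [mem_preimage, (extChartAt (𝓡 n).tangent v).left_inv hs']
        exact (apply_horizontalFlow hF hX hs).trans hv)
    rwa [hfl0] at h4
  · have h1 := hasOrderDeriv_mixedDeriv hk (smoothNear_family hF hk hε hφ hv hsrc)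
      ((eventually_family_eq hε hφ hv).mono fun t ht hj =>
        congrArg (extChartAt (𝓡 n).tangent v) ((ht hj).trans h0.symm))
    rw [← mixedField_extChartAt hF hv hsrc] at h1
    have h2 : ∀ᶠ t in 𝓝 (0 : Fin k → ℝ), ((φ t).1 ⟨v, hv⟩ : TangentBundle (𝓡 n) M) ∈
        (extChartAt (𝓡 n).tangent v).source :=
      (tendsto_family hk hε hφ hv).eventually hsrc'
    have h4 := HasOrderDeriv.mem_tangentConeAt hk h1
      (S := (extChartAt (𝓡 n).tangent v).symm ⁻¹' indicatrixBundle F) (by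
        filter_upwards [tendsto_diagonal.eventually h2] with s hs
        rw [mem_preimage, (extChartAt (𝓡 n).tangent v).left_inv hs]
        exact ((φ _).1 ⟨v, hv⟩).2)
    rwa [show (φ fun _ => (0 : ℝ)) = φ 0 from rfl, h0] at h4

end StronglyTangent

/-! ### The mixed derivative of the commutators -/

section MixedCommutator

variable {n : ℕ} {M : Type*} [TopologicalSpace M] [ChartedSpace (EuclideanSpace ℝ (Fin n)) M]
  [IsManifold (𝓡 n) ∞ M] {F : TangentBundle (𝓡 n) M → ℝ}
  {k : ℕ} {ε : ℝ} {φ : (Fin k → ℝ) → diffeoGroup (𝓡 n).tangent (indicatrixBundle F)}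
  {ξ : ∀ v : TangentBundle (𝓡 n) M, TangentSpace (𝓡 n).tangent v}
  {X : ∀ x : M, TangentSpace (𝓡 n) x} {δ : M → ℝ}

theorem IsStronglyTangent.exists_isMixedDeriv
    {G : Subgroup (diffeoGroup (𝓡 n).tangent (indicatrixBundle F))}
    (h : IsStronglyTangent (𝓡 n).tangent (indicatrixBundle F) G ξ) :
    ∃ (k : ℕ) (ε : ℝ) (φ : (Fin k → ℝ) → diffeoGroup (𝓡 n).tangent (indicatrixBundle F)),
      1 ≤ k ∧ 0 < ε ∧ IsCommutatorLike (𝓡 n).tangent (indicatrixBundle F) k ε φ ∧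
      (∀ t ∈ paramCube k ε, φ t ∈ G) ∧ IsMixedDeriv φ ξ := by
  obtain ⟨k, ε, φ, hk, hε, hφ, hG, h⟩ := h
  exact ⟨k, ε, φ, hk, hε, hφ, hG, fun y => (h y).trans (mfderiv_extChartAt_self_apply _ _)⟩

theorem IsMixedDeriv.isStronglyTangent
    {G : Subgroup (diffeoGroup (𝓡 n).tangent (indicatrixBundle F))} (h : IsMixedDeriv φ ξ)
    (hk : 1 ≤ k) (hε : 0 < ε)
    (hφ : IsCommutatorLike (𝓡 n).tangent (indicatrixBundle F) k ε φ)
    (hG : ∀ t ∈ paramCube k ε, φ t ∈ G) :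
    IsStronglyTangent (𝓡 n).tangent (indicatrixBundle F) G ξ :=
  ⟨k, ε, φ, hk, hε, hφ, hG, fun y => (h y).trans (mfderiv_extChartAt_self_apply _ _).symm⟩

/-- The commutators, read in the chart at `v`, are the composites treated by
`mixedDeriv_flow_commutator`, and the resulting coordinate bracket is that of
`berwaldDeriv_eq_lieBracket`. -/
theorem isMixedDeriv_berwaldDeriv [T2Space M] (hF : IsFinsler F) (hX : IsSmoothField X)
    (hk : 1 ≤ k) (hε : 0 < ε)
    (hφ : IsCommutatorLike (𝓡 n).tangent (indicatrixBundle F) k ε φ) (hξ : IsMixedDeriv φ ξ)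
    (hδ : ∀ x, 0 < δ x)
    {ψ : (Fin (k + 1) → ℝ) → diffeoGroup (𝓡 n).tangent (indicatrixBundle F)}
    (hψ : ∀ T ∈ paramCube (k + 1) ε, ∀ v : indicatrixBundle F,
      ((ψ T).1 v : TangentBundle (𝓡 n) M) = commutatorMap F X (φ (Fin.init T)).1
        (truncatedTime (δ v.1.proj) (T (Fin.last k))) v) :
    IsMixedDeriv ψ (berwaldDeriv F X ξ) := by
  rintro ⟨v, hv⟩
  have hnz := mem_nonzeroVectors_of_mem hF hv
  have hpos := indicatrixBundle_subset hv
  have hsrc := mem_extChartAt_source (I := (𝓡 n).tangent) v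
  have hsrc' := (isOpen_extChartAt_source (I := (𝓡 n).tangent) v).mem_nhds hsrc
  have hd := zero_mem_horizontalDomain hF hX hnz
  have hcube := isOpen_paramCube.mem_nhds (zero_mem_paramCube (k := k) hε)
  have hO := (isOpen_paramCube.prod hF.isOpen_positiveVectors).mem_nhds
    (⟨zero_mem_paramCube hε, hpos⟩ : ((0 : Fin k → ℝ), v) ∈ paramCube k ε ×ˢ positiveVectors F)
  have hone : ∀ t ∈ paramCube k ε, (∃ j, t j = 0) → radialExt (φ t).1.symm v = v := by
    intro t ht hj
    rw [hφ.2 t ht hj]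
    exact hF.radialExt_id hpos
  -- The point `v` is fixed while the parameters vary, so the flow time is a function of the last
  -- parameter alone, with derivative `1` at `0`.
  set σ : ℝ → ℝ := truncatedTime (δ v.proj)
  have hσ : SmoothNear σ 0 := Eventually.of_forall fun s =>
    ContDiffAt.comp (g := fun p : ℝ × ℝ => truncatedTime p.1 p.2) s
      (contDiffAt_truncatedTime (hδ v.proj) s) (contDiffAt_const.prodMk contDiffAt_id)
  have hσ0 : σ 0 = 0 := truncatedTime_zero _
  have hfl0 := horizontalFlow_zero hF hX hnz
  have tΦ : Tendsto (fun q : (Fin k → ℝ) × TangentBundle (𝓡 n) M => radialExt (φ q.1).1 q.2)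
      (𝓝 (0, v)) (𝓝 v) := by
    have h1 := ((hφ.contMDiffOn_radialExt hF).continuousOn.continuousAt hO).tendsto
    rwa [show radialExt (φ ((0 : Fin k → ℝ), v).1).1 ((0 : Fin k → ℝ), v).2 = v by
      rw [hφ.apply_zero hk hε]; exact hF.radialExt_id hpos] at h1
  have tΨ : Tendsto (fun t => radialExt (φ t).1.symm v) (𝓝 (0 : Fin k → ℝ)) (𝓝 v) := by
    have h1 := ((hφ.contMDiffOn_radialExt_symm hF).continuousOn.continuousAt hO).tendsto
    rw [show radialExt (φ ((0 : Fin k → ℝ), v).1).1.symm ((0 : Fin k → ℝ), v).2 = v from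
      hone 0 (zero_mem_paramCube hε) ⟨⟨0, hk⟩, rfl⟩] at h1
    exact h1.comp (Continuous.prodMk_left v).continuousAt
  have tFl : Tendsto (horizontalFlow F X) (𝓝 (0, v)) (𝓝 v) := by
    have h1 := ((contMDiffOn_horizontalFlow hF hX).continuousOn.continuousAt
      (isOpen_horizontalDomain.mem_nhds hd)).tendsto
    rwa [hfl0] at h1
  have hwsrc : ∀ᶠ w in 𝓝 (extChartAt (𝓡 n).tangent v v),
      (extChartAt (𝓡 n).tangent v).symm w ∈ nonzeroVectors n M ∧
        w ∈ (extChartAt (𝓡 n).tangent v).target := by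
    have h1 := (continuousAt_extChartAt_symm (I := (𝓡 n).tangent) v).tendsto
    rw [extChartAt_to_inv] at h1
    have h2 : ∀ᶠ w in 𝓝 v, w ∈ nonzeroVectors n M := isOpen_nonzeroVectors.mem_nhds hnz
    have h3 : ∀ᶠ w in 𝓝 (extChartAt (𝓡 n).tangent v v), w ∈ (extChartAt (𝓡 n).tangent v).target :=
      extChartAt_target_mem_nhds v
    exact (h1.eventually h2).and h3
  have hΨs : SmoothNear (fun t => extChartAt (𝓡 n).tangent v (radialExt (φ t).1.symm v)) 0 := by
    have h1 := SmoothNear.comp (f := fun t : Fin k → ℝ => (t, extChartAt (𝓡 n).tangent v v))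
      (smoothNear_radialFamily_symm hF hk hε hφ hv hsrc)
      (ContDiff.smoothNear (contDiff_id.prodMk contDiff_const) _)
    refine h1.congr (Eventually.of_forall fun t => ?_)
    dsimp only
    rw [extChartAt_to_inv]
  have key := mixedDeriv_flow_commutator hk
    (Fl := fun q => extChartAt (𝓡 n).tangent v
      (horizontalFlow F X (q.1, (extChartAt (𝓡 n).tangent v).symm q.2)))
    (smoothNear_radialFamily hF hk hε hφ hv hsrc) hΨs
    (smoothNear_chartField_horizontalLiftField hF hX hnz)
    (smoothNear_chart (J := (𝓡 n).tangent) isOpen_horizontalDomain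
      (contMDiffOn_horizontalFlow hF hX) hd hsrc (by rwa [hfl0])) hσ
    (by
      filter_upwards [tΨ.eventually hsrc'] with t ht
      rw [(extChartAt (𝓡 n).tangent v).left_inv ht,
        hF.radialExt_radialExt (φ t).1.apply_symm_apply hpos])
    (eventually_radialFamily_eq hF hε hφ hv hsrc)
    (by
      filter_upwards [hcube] with t ht hj
      rw [hone t ht hj])
    (by
      filter_upwards [hwsrc] with w hw
      rw [horizontalFlow_zero hF hX hw.1, (extChartAt (𝓡 n).tangent v).right_inv hw.2])
    (by
      filter_upwards [hwsrc] with w hw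
      have h1 := hasDerivAt_extChartAt_horizontalFlow (v := v) hF hX hw.1
        ((extChartAt (𝓡 n).tangent v).map_target hw.2)
      rwa [(extChartAt (𝓡 n).tangent v).right_inv hw.2] at h1)
    hσ0 (hasDerivAt_truncatedTime (hδ v.proj))
  refine Eq.trans ?_ (key.trans (berwaldDeriv_eq_lieBracket hF hk hε hφ hv hξ hX).symm)
  refine mixedDeriv_congr ?_
  have tinit : Tendsto (fun T : Fin (k + 1) → ℝ => (Fin.init T : Fin k → ℝ)) (𝓝 0) (𝓝 0) :=
    (continuous_pi fun i => continuous_apply i.castSucc).tendsto' 0 0 rfl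
  have tσ : Tendsto (fun T : Fin (k + 1) → ℝ => σ (T (Fin.last k))) (𝓝 0) (𝓝 0) := by
    have h1 := hσ.continuousAt.tendsto
    rw [hσ0] at h1
    exact h1.comp ((continuous_apply (Fin.last k)).tendsto' 0 0 rfl)
  have t1 : Tendsto (fun T : Fin (k + 1) → ℝ => radialExt (φ (Fin.init T)).1.symm v) (𝓝 0) (𝓝 v) :=
    tΨ.comp tinit
  have t2 : Tendsto (fun T : Fin (k + 1) → ℝ => horizontalFlow F X
      (σ (T (Fin.last k)), radialExt (φ (Fin.init T)).1.symm v)) (𝓝 0) (𝓝 v) :=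
    tFl.comp (tσ.prodMk_nhds t1)
  have t3 : Tendsto (fun T : Fin (k + 1) → ℝ => radialExt (φ (Fin.init T)).1 (horizontalFlow F X
      (σ (T (Fin.last k)), radialExt (φ (Fin.init T)).1.symm v))) (𝓝 0) (𝓝 v) :=
    tΦ.comp (tinit.prodMk_nhds t2)
  -- For small parameters all intermediate points stay in the chart at `v`, so the inserted charts
  -- and inverse charts cancel.
  filter_upwards [isOpen_paramCube.mem_nhds (zero_mem_paramCube (k := k + 1) hε),
    t1.eventually hsrc', t2.eventually hsrc', t3.eventually hsrc'] with T hT h1 h2 h3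
  rw [hψ T hT]
  dsimp only
  rw [(extChartAt (𝓡 n).tangent v).left_inv h1, (extChartAt (𝓡 n).tangent v).left_inv h2,
    (extChartAt (𝓡 n).tangent v).left_inv h3]
  rfl

end MixedCommutator

end FinslerHolonomy

end

/-! ### Conclusion: strong tangency of the Berwald derivative. -/

theorem mainTheorem4 {n : ℕ} {M : Type*} [TopologicalSpace M] [T2Space M]
    [SecondCountableTopology M] [ChartedSpace (EuclideanSpace ℝ (Fin n)) M]
    [IsManifold (𝓡 n) ∞ M]
    (F : TangentBundle (𝓡 n) M → ℝ) (hF : FinslerHolonomy.IsFinsler F)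
    (r : ℕ∞) (hr : 1 ≤ r)
    (ξ : ∀ v : TangentBundle (𝓡 n) M, TangentSpace (𝓡 n).tangent v)
    (hξ : FinslerHolonomy.IsIndicatrixField F ξ)
    (hξt : FinslerHolonomy.IsStronglyTangent (𝓡 n).tangent (FinslerHolonomy.indicatrixBundle F)
      (FinslerHolonomy.fibredHolonomyGroup F r) ξ)
    (X : ∀ x : M, TangentSpace (𝓡 n) x) (hX : FinslerHolonomy.IsSmoothField X) :
    FinslerHolonomy.IsIndicatrixField F (FinslerHolonomy.berwaldDeriv F X ξ) ∧
      FinslerHolonomy.IsStronglyTangent (𝓡 n).tangent (FinslerHolonomy.indicatrixBundle F)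
        (FinslerHolonomy.fibredHolonomyGroup F r) (FinslerHolonomy.berwaldDeriv F X ξ) := by
  obtain ⟨k, ε, φ, hk, hε, hφ, hφG, hφξ⟩ := hξt.exists_isMixedDeriv
  obtain ⟨δ, hδ, hδ0, hδX⟩ := FinslerHolonomy.exists_safe_radius hF hX
  obtain ⟨ψ, hψ, hψG, hψv⟩ :=
    FinslerHolonomy.exists_commutatorFamily hF hX hφ hδ hδ0 hδX hφG
  have h := FinslerHolonomy.isMixedDeriv_berwaldDeriv hF hX hk hε hφ hφξ hδ0 hψv
  -- Being the mixed derivative of the commutator family gives both claims at once: smoothness and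
  -- tangency of the bracket, and its strong tangency with `k + 1` parameters.
  exact ⟨FinslerHolonomy.isIndicatrixField_of_mixedDeriv hF (Nat.le_add_left 1 k) hε hψ h,
    h.isStronglyTangent (Nat.le_add_left 1 k) hε hψ hψG⟩
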